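/- **Notation.** Let $\mathrm{Sym}_0(3)$ be the space of symmetric traceless real $3\times 3$ matrices with the Frobenius norm $|A|=\sqrt{\mathrm{tr}(A^2)}$, let $H=L^2(\mathbb{R}^3;\mathrm{Sym}_0(3))\cap L^6(\mathbb{R}^3;\mathrm{Sym}_0(3))$ with norm $\|R\|_H=\max\{\|R\|_2,\|R\|_6\}$, and let $\Phi(x,t)=(4\pi t)^{-3/2}e^{-|x|^2/4t}$. For $\delta>0$ let $\mathcal{A}$ be the space of all $Q\in L^\infty(\mathbb{R}^3;\mathrm{Sym}_0(3))$ with $$\|Q\|_{\mathcal{A}}:=\operatorname*{ess\,sup}_{x\in\mathbb{R}^3}(1+|x|)^{8+\delta}|Q(x)|<\infty .$$ For an interval $I\subseteq[0,\infty)$ let $X_0(I)$ be the set of $V:\mathbb{R}^3\times[0,\infty)\to\mathrm{Sym}_0(3)$ that are continuous on $\mathbb{R}^3\times I$ and satisfy $$\sup_{x\in\mathbb{R}^3,\;t\in I}\Big(1+\frac{|x|}{\sqrt{t+1}}\Big)^{4+\delta/2}(t+1)^2\,|V(x,t)|<\infty .$$ Consider, for $(a,b,c)\in\mathcal{D}:=\{(a,b,c)\in(0,\infty)^3: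 b^2>27ac\}$, the $Q$-tensor equation $$\frac{\partial Q}{\partial t}=\Delta Q-aQ+b\Big(Q^2-\tfrac13\mathrm{tr}(Q^2)I\Big)-c\,\mathrm{tr}(Q^2)\,Q. \tag{1}$$ A *smooth solution of (1) with initial datum $Q_0$* is a map $Q:\mathbb{R}^3\times(0,\infty)\to\mathrm{Sym}_0(3)$ of class $C^\infty$ that satisfies (1) pointwise on $\mathbb{R}^3\times(0,\infty)$, with $Q(\cdot,t)\in H$ for every $t>0$ and $\|Q(\cdot,t)-Q_0\|_H\to0$ as $t\downarrow0$. **Theorem.** Fix $\delta>0$ and $(a,b,c)\in\mathcal{D}$. There is $\eta>0$, depending only on $\delta$ and $(a,b,c)$, such that for every $Q_0\in\mathcal{A}$ with $\|Q_0\|_{\mathcal{A}}\le\eta$ equation (1) has one and only one smooth solution $Q$ with initial datum $Q_0$, and this solution has the form $$Q(x,t)=A\,e^{-at}\,\Phi(x,t+1)+e^{-at}\,V(x,t)\qquad(x\in\mathbb{R}^3,\ t>0)$$ for some $A\in\mathrm{Sym}_0(3)$ and some $V\in X_0((0,\infty))$. If $Q_0$ has a continuous representative, then moreover $V\in X_0([0,\infty))$.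 -/

import Mathlib

open Set Filter MeasureTheory Topology
open scoped ContDiff ENNReal Laplacian

noncomputable section

namespace QTensor

/-- The physical space `ℝ³` with its Euclidean norm and Lebesgue measure. -/
abbrev Space : Type := EuclideanSpace ℝ (Fin 3)

/-- The symmetric traceless real `3 × 3` matrices, as a subspace of all matrices. -/
def sym0 : Submodule ℝ (Matrix (Fin 3) (Fin 3) ℝ) where
  carrier := {A | A.transpose = A ∧ A.trace = 0}
  add_mem' := by
    rintro A B ⟨hA, hA'⟩ ⟨hB, hB'⟩
    exact ⟨by rw [Matrix.transpose_add, hA, hB], by rw [Matrix.trace_add, hA', hB', add_zero]⟩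
  zero_mem' := ⟨Matrix.transpose_zero, Matrix.trace_zero _ _⟩
  smul_mem' := by
    rintro r A ⟨hA, hA'⟩
    exact ⟨by rw [Matrix.transpose_smul, hA], by rw [Matrix.trace_smul, hA', smul_zero]⟩

/-- The type of symmetric traceless real `3 × 3` matrices. It carries the vector space structure
of `sym0` and, below, the Frobenius inner product `A : B = tr (A B)`. -/
def Sym0 : Type := sym0

instance : AddCommGroup Sym0 := inferInstanceAs (AddCommGroup sym0)

instance : Module ℝ Sym0 := inferInstanceAs (Module ℝ sym0)

/-- The underlying matrix. -/
def Sym0.toMatrix : Sym0 →ₗ[ℝ] Matrix (Fin 3) (Fin 3) ℝ := sym0.subtype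

theorem Sym0.transpose_toMatrix (A : Sym0) : A.toMatrix.transpose = A.toMatrix := A.2.1

theorem Sym0.trace_toMatrix (A : Sym0) : A.toMatrix.trace = 0 := A.2.2

theorem Sym0.trace_mul_self (A : Sym0) :
    (A.toMatrix * A.toMatrix).trace = ∑ i, ∑ j, A.toMatrix i j ^ 2 := by
  have h : ∀ i j, A.toMatrix j i = A.toMatrix i j := fun i j =>
    congrFun (congrFun A.transpose_toMatrix i) j
  simp only [Matrix.trace, Matrix.diag_apply, Matrix.mul_apply]
  refine Finset.sum_congr rfl fun i _ => Finset.sum_congr rfl fun j _ => ?_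
  rw [h i j, sq]

theorem Sym0.toMatrix_injective : Function.Injective Sym0.toMatrix := sym0.injective_subtype

/-- The Frobenius inner product `A : B = A_ij B_ji = tr (A B)`. -/
@[reducible] def Sym0.innerCore : InnerProductSpace.Core ℝ Sym0 where
  inner A B := (A.toMatrix * B.toMatrix).trace
  conj_inner_symm A B := by
    simp only [conj_trivial]
    exact Matrix.trace_mul_comm _ _
  re_inner_nonneg A := by
    simp only [RCLike.re_to_real]
    rw [Sym0.trace_mul_self]
    exact Finset.sum_nonneg fun i _ => Finset.sum_nonneg fun j _ => sq_nonneg _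
  add_left A B C := by simp only [map_add, add_mul, Matrix.trace_add]
  smul_left A B r := by
    simp only [map_smul, Matrix.smul_mul, Matrix.trace_smul, smul_eq_mul, conj_trivial]
  definite A h := by
    rw [Sym0.trace_mul_self] at h
    apply Sym0.toMatrix_injective
    rw [map_zero]
    ext i j
    have h1 := (Finset.sum_eq_zero_iff_of_nonneg
      (fun i _ => Finset.sum_nonneg fun j _ => sq_nonneg (A.toMatrix i j))).1 h i
      (Finset.mem_univ i)
    have h2 := (Finset.sum_eq_zero_iff_of_nonneg
      (fun j _ => sq_nonneg (A.toMatrix i j))).1 h1 j (Finset.mem_univ j)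
    exact pow_eq_zero_iff (two_ne_zero) |>.1 h2

/-- The Frobenius norm `|A| = √(A : A)`. -/
instance : NormedAddCommGroup Sym0 := Sym0.innerCore.toNormedAddCommGroup

instance : InnerProductSpace ℝ Sym0 := InnerProductSpace.ofCore Sym0.innerCore.toCore

/-- `tr (Q²)`. -/
def trSq (Q : Sym0) : ℝ := (Q.toMatrix * Q.toMatrix).trace

/-- `Q² - (1/3) tr (Q²) I`, again symmetric and traceless. -/
def devSq (Q : Sym0) : Sym0 :=
  ⟨Q.toMatrix * Q.toMatrix - (trSq Q / 3) • (1 : Matrix (Fin 3) (Fin 3) ℝ), by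
    refine ⟨?_, ?_⟩
    · rw [Matrix.transpose_sub, Matrix.transpose_mul, Q.transpose_toMatrix,
        Matrix.transpose_smul, Matrix.transpose_one]
    · rw [Matrix.trace_sub, Matrix.trace_smul, Matrix.trace_one, Fintype.card_fin, smul_eq_mul]
      simp only [trSq]
      push_cast
      ring⟩

/-- The region of uniaxial bistability in parameter space. -/
def paramRegion : Set (ℝ × ℝ × ℝ) :=
  {p | 0 < p.1 ∧ 0 < p.2.1 ∧ 0 < p.2.2 ∧ 27 * p.1 * p.2.2 < p.2.1 ^ 2}

/-- The heat kernel on `ℝ³`. -/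
def heatKernel (x : Space) (t : ℝ) : ℝ :=
  Real.exp (-‖x‖ ^ 2 / (4 * t)) / (4 * Real.pi * t) ^ (3 / 2 : ℝ)

/-- The weighted norm `ess sup (1 + |x|) ^ (8 + δ) |Q₀ x|`, with values in `[0, ∞]`. -/
def normA (δ : ℝ) (Q₀ : Space → Sym0) : ℝ≥0∞ :=
  essSup (fun x => ENNReal.ofReal ((1 + ‖x‖) ^ (8 + δ) * ‖Q₀ x‖)) volume

/-- Membership in the weighted space of essentially bounded initial data. -/
def MemA (δ : ℝ) (Q₀ : Space → Sym0) : Prop :=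
  MemLp Q₀ ⊤ volume ∧ normA δ Q₀ < ⊤

/-- The space-time weight `(1 + |x| / √(t+1)) ^ (4 + δ/2) (t+1)²`. -/
def weight (δ : ℝ) (x : Space) (t : ℝ) : ℝ :=
  (1 + ‖x‖ / Real.sqrt (t + 1)) ^ (4 + δ / 2) * (t + 1) ^ 2

/-- `V` is continuous on `ℝ³ × I` and its weighted supremum over `ℝ³ × I` is finite. -/
def MemX0 (δ : ℝ) (I : Set ℝ) (V : Space → ℝ → Sym0) : Prop :=
  ContinuousOn (fun p : Space × ℝ => V p.1 p.2) (univ ×ˢ I) ∧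
    ∃ C : ℝ, ∀ x : Space, ∀ t ∈ I, weight δ x t * ‖V x t‖ ≤ C

/-- Membership in the phase space `H = L² ∩ L⁶`. -/
def MemH (R : Space → Sym0) : Prop :=
  MemLp R 2 volume ∧ MemLp R 6 volume

/-- The norm `max {‖R‖₂, ‖R‖₆}` of `H`, with values in `[0, ∞]`. -/
def normH (R : Space → Sym0) : ℝ≥0∞ :=
  max (eLpNorm R 2 volume) (eLpNorm R 6 volume)

/-- `Q` is a global classically smooth solution of
`∂Q/∂t = ΔQ - a Q + b (Q² - (1/3) tr (Q²) I) - c tr (Q²) Q` on `ℝ³ × (0, ∞)`, which lies in `H` at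
each positive time and attains the initial datum `Q₀` in `H` as `t ↓ 0`. -/
structure IsSmoothSolution (a b c : ℝ) (Q₀ : Space → Sym0) (Q : Space → ℝ → Sym0) : Prop where
  smooth : ContDiffOn ℝ ∞ (fun p : Space × ℝ => Q p.1 p.2) (univ ×ˢ Ioi 0)
  equation : ∀ x : Space, ∀ t : ℝ, 0 < t →
    deriv (fun s => Q x s) t =
      Δ (fun y => Q y t) x - a • Q x t + b • devSq (Q x t) - (c * trSq (Q x t)) • Q x t
  memH : ∀ t : ℝ, 0 < t → MemH (fun x => Q x t)
  initial : Tendsto (fun t => normH (fun x => Q x t - Q₀ x)) (𝓝[>] 0) (𝓝 0)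

end QTensor

end

open Set Filter MeasureTheory Topology
open scoped ContDiff ENNReal Laplacian

noncomputable section

set_option maxSynthPendingDepth 3
set_option linter.unusedSectionVars false

namespace QTensor

/-! ### The Gaussian measure -/

/-! Put `Q = e^{-at} u`. The linear decay disappears, and `u` solves a heat equation with reaction
`N(t, u) = b e^{-at} (u² - tr(u²) I / 3) - c e^{-2at} |u|² u`, which is superlinear in `u` and
decays in time. Small data therefore behave like solutions of the free heat equation, and everything
reduces to the Duhamel formula `u(t) = e^{tΔ} f + ∫₀ᵗ e^{(t-s)Δ} N(s, u(s)) ds`.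

Existence (`exists_mild`) is a contraction in the space weighted by `e^{κt} (1 + ε|x|)^{-(8+δ)}`.
The heat semigroup preserves the spatial weight up to the factor `e^{κt}` with `κ = 2((8+δ)ε)²`
(`norm_heat_le_decay`), and a small `ε` makes `κ ≤ a/4`. In this space `N` carries the factor
`e^{-(a-2κ)t}`, which is integrable in time.

Smoothness (`IsMild.smooth`) is a bootstrap. The gradient of `e^{(t-s)Δ}` costs the integrable
factor `(t-s)^{-1/2}`, so each passage through the Duhamel formula, restarted at a positive time,
gains one spatial derivative. A right derivative in time comes from the restarted formula. It is
continuous, hence a genuine derivative, and the equation then converts spatial regularity into joint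
regularity.

Uniqueness (`eq_zero_of_absorption`) needs no decay of the competitor. The difference `w` of two
solutions satisfies an energy inequality with a term `-(c/8)|w|⁴`, because the cubic term is
monotone and dominates the quadratic one. Multiply by a cutoff of radius `R`: the quartic term
absorbs the cutoff error except for `O(R^{-4})` on a ball of volume `O(R³)`. Gronwall's inequality
and `R → ∞` give `w = 0`.

For the asymptotics, a source of mass `m` active at time `s` contributes `m Φ(x, t+1)` with an error
of relative order `(t+1)^{-1/2}`, since one derivative of the heat kernel in parabolic scaling gains
that factor (`abs_heatKernel_sub_le`). The error keeps a spatial weight of exponent `q` as long as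
the source has `q+1` moments, that is, decays faster than `|x|^{-(q+4)}`. With `q = 4 + δ/2` the
exponent `8 + δ` suffices. Polynomial losses in `s` are paid for by the exponential decay of `N`,
and `A` is the mass of the datum plus the total mass of the reaction term. -/

theorem heatKernel_one (w : Space) :
    heatKernel w 1 = Real.exp (-(1 / 4) * ‖w‖ ^ 2) / (4 * Real.pi) ^ (3 / 2 : ℝ) := by
  simp only [heatKernel, mul_one]
  congr 2
  ring

theorem heatKernel_nonneg (x : Space) {t : ℝ} (ht : 0 ≤ t) : 0 ≤ heatKernel x t := by
  unfold heatKernel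
  positivity

theorem continuous_heatKernel_one : Continuous fun w : Space => heatKernel w 1 := by
  simp_rw [heatKernel_one]
  fun_prop

/-- The Gaussian probability measure with density `heatKernel · 1`. -/
def gauss : Measure Space :=
  volume.withDensity fun w => ENNReal.ofReal (heatKernel w 1)

theorem measurable_gaussDensity :
    Measurable fun w : Space => ENNReal.ofReal (heatKernel w 1) :=
  continuous_heatKernel_one.measurable.ennreal_ofReal

section

variable {E : Type} [NormedAddCommGroup E] [NormedSpace ℝ E]

theorem integral_gauss (f : Space → E) :
    ∫ w, f w ∂gauss = ∫ w, heatKernel w 1 • f w := by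
  rw [gauss, integral_withDensity_eq_integral_toReal_smul measurable_gaussDensity
    (by simp)]
  simp only [ENNReal.toReal_ofReal (heatKernel_nonneg _ zero_le_one)]

theorem integrable_gauss_iff (f : Space → E) :
    Integrable f gauss ↔ Integrable fun w => heatKernel w 1 • f w := by
  rw [gauss, integrable_withDensity_iff_integrable_smul' measurable_gaussDensity
    (by simp)]
  simp only [ENNReal.toReal_ofReal (heatKernel_nonneg _ zero_le_one)]

end

/-- A non-integrable function has Bochner integral `0`, whereas the known value of the Gaussian
integral is positive. -/
theorem integrable_exp_neg_mul_sq {b : ℝ} (hb : 0 < b) :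
    Integrable fun w : Space => Real.exp (-b * ‖w‖ ^ 2) := by
  by_contra h
  have h1 := GaussianFourier.integral_rexp_neg_mul_sq_norm (V := Space) hb
  rw [integral_undef h] at h1
  have : 0 < (Real.pi / b) ^ (Module.finrank ℝ Space / 2 : ℝ) := by positivity
  linarith

/-- Scaling by `√t` turns this into `exp(-t|ξ|²)`. The semigroup law is then the functional equation
of the exponential, transported by uniqueness of characteristic functions. -/
theorem charFun_gauss (ξ : Space) : charFun gauss ξ = Complex.exp (-(‖ξ‖ : ℂ) ^ 2) := by
  have h := GaussianFourier.integral_cexp_neg_mul_sq_norm_add (V := Space) (b := 1 / 4)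
    (by norm_num) Complex.I ξ
  rw [charFun_apply, integral_gauss]
  have h2 : ∀ w : Space, heatKernel w 1 • Complex.exp ((inner ℝ w ξ : ℝ) * Complex.I) =
      ((4 * Real.pi) ^ (3 / 2 : ℝ) : ℝ)⁻¹ *
        Complex.exp (-(1 / 4) * (‖w‖ : ℂ) ^ 2 + Complex.I * (inner ℝ ξ w : ℝ)) := by
    intro w
    rw [heatKernel_one, Complex.exp_add, real_inner_comm, Complex.real_smul]
    push_cast
    rw [mul_comm Complex.I]
    ring
  simp_rw [h2]
  rw [integral_const_mul, h]
  have h3 : ((Real.pi : ℂ) / (1 / 4)) ^ ((Module.finrank ℝ Space : ℂ) / 2) =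
      ((4 * Real.pi) ^ (3 / 2 : ℝ) : ℝ) := by
    rw [Complex.ofReal_cpow (by positivity)]
    simp
    ring_nf
  rw [h3, ← mul_assoc, ← Complex.ofReal_mul, inv_mul_cancel₀ (by positivity)]
  simp

instance : IsProbabilityMeasure gauss := by
  refine ⟨?_⟩
  rw [gauss, withDensity_apply _ MeasurableSet.univ, Measure.restrict_univ,
    ← ofReal_integral_eq_lintegral_ofReal]
  · simp_rw [heatKernel_one, integral_div]
    rw [GaussianFourier.integral_rexp_neg_mul_sq_norm (V := Space) (by norm_num : (0:ℝ) < 1 / 4)]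
    have : (Real.pi / (1 / 4)) ^ ((Module.finrank ℝ Space : ℝ) / 2) =
      ((4 * Real.pi) ^ (3 / 2 : ℝ) : ℝ) := by
      simp
      ring_nf
    rw [this, div_self (by positivity)]
    simp
  · simp_rw [heatKernel_one]
    exact (integrable_exp_neg_mul_sq (by norm_num)).div_const _
  · exact Eventually.of_forall fun w => heatKernel_nonneg w zero_le_one

/-- The measure `gauss` is the time-one marginal of a convolution semigroup. -/
theorem gauss_conv {s t : ℝ} (hs : 0 ≤ s) (ht : 0 ≤ t) :
    (gauss.map (√s • ·)).conv (gauss.map (√t • ·)) = gauss.map (√(s + t) • ·) := by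
  have : ∀ r : ℝ, IsProbabilityMeasure (gauss.map (r • · : Space → Space)) := fun r =>
    Measure.isProbabilityMeasure_map (by fun_prop)
  apply Measure.ext_of_charFun
  ext ξ
  rw [charFun_conv, charFun_map_smul, charFun_map_smul, charFun_map_smul, charFun_gauss,
    charFun_gauss, charFun_gauss, ← Complex.exp_add]
  have h : ∀ r : ℝ, 0 ≤ r → (‖√r • ξ‖ : ℂ) ^ 2 = r * (‖ξ‖ : ℂ) ^ 2 := by
    intro r hr
    rw [norm_smul, Real.norm_of_nonneg (Real.sqrt_nonneg _)]
    norm_cast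
    rw [mul_pow, Real.sq_sqrt hr]
  rw [h s hs, h t ht, h (s + t) (by positivity)]
  congr 1
  push_cast
  ring

theorem integrable_exp_sq_gauss {b : ℝ} (hb : b < 1 / 4) :
    Integrable (fun w : Space => Real.exp (b * ‖w‖ ^ 2)) gauss := by
  rw [integrable_gauss_iff]
  refine ((integrable_exp_neg_mul_sq (b := 1 / 4 - b) (by linarith)).div_const
    ((4 * Real.pi) ^ (3 / 2 : ℝ))).congr (Eventually.of_forall fun w => ?_)
  simp only [heatKernel_one, smul_eq_mul]
  rw [div_mul_eq_mul_div, ← Real.exp_add]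
  congr 2
  ring

theorem integrable_norm_gauss : Integrable (fun w : Space => ‖w‖) gauss := by
  refine ((integrable_exp_sq_gauss (b := 1 / 8) (by norm_num)).const_mul 8).mono'
    (by fun_prop) (Eventually.of_forall fun w => ?_)
  rw [norm_norm]
  have := Real.add_one_le_exp (1 / 8 * ‖w‖ ^ 2)
  nlinarith [sq_nonneg (‖w‖ - 4)]

/-- The exponential moment of the Gaussian measure that controls polynomial weights. -/
def gaussMoment : ℝ := ∫ w : Space, Real.exp (1 / 8 * ‖w‖ ^ 2) ∂gauss

theorem one_le_gaussMoment : 1 ≤ gaussMoment := by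
  have h : ∫ _ : Space, (1 : ℝ) ∂gauss ≤ gaussMoment := by
    refine integral_mono (integrable_const _) (integrable_exp_sq_gauss (by norm_num)) fun w => ?_
    exact Real.one_le_exp (by positivity)
  simpa using h

/-- Completing the square in `m|w| ≤ 2m² + |w|²/8`; the rate `1/8` stays below the rate `1/4` of the
Gaussian. The constant `2m²` is the origin of the growth rate `κ`. -/
theorem exp_mul_norm_le (m : ℝ) (w : Space) :
    Real.exp (m * ‖w‖) ≤ Real.exp (2 * m ^ 2) * Real.exp (1 / 8 * ‖w‖ ^ 2) := by
  rw [← Real.exp_add]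
  gcongr
  nlinarith [sq_nonneg (‖w‖ - 4 * m)]

theorem integrable_exp_norm_gauss (m : ℝ) :
    Integrable (fun w : Space => Real.exp (m * ‖w‖)) gauss := by
  refine ((integrable_exp_sq_gauss (b := 1 / 8) (by norm_num)).const_mul
    (Real.exp (2 * m ^ 2))).mono' (by fun_prop) (Eventually.of_forall fun w => ?_)
  rw [Real.norm_of_nonneg (Real.exp_nonneg _)]
  exact exp_mul_norm_le m w

theorem integral_exp_norm_gauss_le (m : ℝ) :
    ∫ w : Space, Real.exp (m * ‖w‖) ∂gauss ≤ Real.exp (2 * m ^ 2) * gaussMoment := by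
  rw [gaussMoment, ← integral_const_mul]
  exact integral_mono (integrable_exp_norm_gauss m)
    ((integrable_exp_sq_gauss (by norm_num)).const_mul _) (exp_mul_norm_le m)

/-! ### The heat semigroup -/

variable {E F : Type} [NormedAddCommGroup E] [NormedSpace ℝ E]
  [NormedAddCommGroup F] [NormedSpace ℝ F]

/-- The heat semigroup, written as a Gaussian average; at time `0` it is the identity. -/
def heat (t : ℝ) (f : Space → E) (x : Space) : E := ∫ w, f (x - √t • w) ∂gauss

theorem heat_zero [CompleteSpace E] (f : Space → E) (x : Space) : heat 0 f x = f x := by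
  simp [heat]

theorem heatKernel_scale {t : ℝ} (ht : 0 < t) (z : Space) :
    heatKernel z t = (√t) ^ (-3 : ℤ) * heatKernel ((√t)⁻¹ • z) 1 := by
  have h4 : (4 * Real.pi * t) ^ (3 / 2 : ℝ) = (4 * Real.pi) ^ (3 / 2 : ℝ) * (√t) ^ 3 := by
    rw [Real.mul_rpow (by positivity) ht.le, Real.sqrt_eq_rpow, ← Real.rpow_natCast,
      ← Real.rpow_mul ht.le]
    norm_num
  rw [heatKernel_one, heatKernel, h4, norm_smul, mul_pow, norm_inv,
    Real.norm_of_nonneg (Real.sqrt_nonneg t), inv_pow, Real.sq_sqrt ht.le]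
  have h5 : -‖z‖ ^ 2 / (4 * t) = -(1 / 4) * (t⁻¹ * ‖z‖ ^ 2) := by
    field_simp
  rw [h5, zpow_neg]
  have : √t ≠ 0 := (Real.sqrt_pos.2 ht).ne'
  norm_cast
  field_simp

/-- The heat semigroup as an integral against the heat kernel. -/
theorem heat_eq_integral_kernel {t : ℝ} (ht : 0 < t) (f : Space → E) (x : Space) :
    heat t f x = ∫ y, heatKernel (x - y) t • f y := by
  rw [heat, integral_gauss]
  have hs : 0 < √t := Real.sqrt_pos.2 ht
  rw [← integral_sub_left_eq_self (fun y => heatKernel (x - y) t • f y) volume x]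
  simp only [sub_sub_cancel]
  have h := Measure.integral_comp_smul volume
    (fun z : Space => heatKernel z t • f (x - z)) (√t)
  have h0 : (Module.finrank ℝ Space) = 3 := by simp
  have h2 : |(√t ^ 3)⁻¹| = (√t ^ 3)⁻¹ := abs_of_pos (by positivity)
  rw [h0, h2] at h
  have h3 : ∫ z, heatKernel z t • f (x - z) = √t ^ 3 • ∫ w : Space,
      heatKernel (√t • w) t • f (x - √t • w) := by
    rw [h, smul_smul, mul_inv_cancel₀ (by positivity), one_smul]
  rw [h3, ← integral_smul]
  congr 1
  ext w
  rw [heatKernel_scale ht, smul_smul, smul_smul, inv_mul_cancel₀ hs.ne', one_smul, ← mul_assoc,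
    zpow_neg]
  congr 1
  have : √t ≠ 0 := hs.ne'
  norm_cast
  field_simp

end QTensor

namespace QTensor

variable {E F : Type} [NormedAddCommGroup E] [NormedSpace ℝ E]
  [NormedAddCommGroup F] [NormedSpace ℝ F]

/-! ### Weighted bounds -/

/-- The spatial weight `(1 + ε |x|) ^ (-k)`. -/
def decay (ε k : ℝ) (x : Space) : ℝ := (1 + ε * ‖x‖) ^ (-k)

theorem decay_pos {ε : ℝ} (hε : 0 ≤ ε) (k : ℝ) (x : Space) : 0 < decay ε k x := by
  unfold decay
  positivity

theorem decay_le_one {ε k : ℝ} (hε : 0 ≤ ε) (hk : 0 ≤ k) (x : Space) : decay ε k x ≤ 1 := by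
  unfold decay
  refine Real.rpow_le_one_of_one_le_of_nonpos ?_ (by linarith)
  have : 0 ≤ ε * ‖x‖ := by positivity
  linarith

theorem continuous_decay {ε : ℝ} (hε : 0 ≤ ε) (k : ℝ) : Continuous (decay ε k) := by
  unfold decay
  refine Continuous.rpow_const (by fun_prop) fun x => Or.inl ?_
  positivity

/-- Peetre's inequality, with the polynomial factor replaced by an exponential so that its Gaussian
average depends on `ε` only through `kε`. -/
theorem decay_sub_le {ε k : ℝ} (hε : 0 ≤ ε) (hk : 0 ≤ k) (x z : Space) :
    decay ε k (x - z) ≤ decay ε k x * Real.exp (k * ε * ‖z‖) := by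
  unfold decay
  have h1 : 1 + ε * ‖x‖ ≤ (1 + ε * ‖x - z‖) * (1 + ε * ‖z‖) := by
    have : ‖x‖ ≤ ‖x - z‖ + ‖z‖ := by simpa using norm_add_le (x - z) z
    nlinarith [mul_le_mul_of_nonneg_left this hε,
      mul_nonneg (mul_nonneg hε (norm_nonneg (x - z))) (mul_nonneg hε (norm_nonneg z))]
  have h2 : (1 + ε * ‖x‖) ^ k ≤ (1 + ε * ‖x - z‖) ^ k * Real.exp (k * ε * ‖z‖) := by
    calc (1 + ε * ‖x‖) ^ k ≤ ((1 + ε * ‖x - z‖) * (1 + ε * ‖z‖)) ^ k :=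
          Real.rpow_le_rpow (by positivity) h1 hk
      _ = (1 + ε * ‖x - z‖) ^ k * (1 + ε * ‖z‖) ^ k :=
          Real.mul_rpow (by positivity) (by positivity)
      _ ≤ (1 + ε * ‖x - z‖) ^ k * (Real.exp (ε * ‖z‖)) ^ k := by
          gcongr
          linarith [Real.add_one_le_exp (ε * ‖z‖)]
      _ = _ := by
          rw [← Real.exp_mul]
          ring_nf
  rw [Real.rpow_neg (by positivity), Real.rpow_neg (by positivity), ← div_eq_inv_mul,
    inv_eq_one_div, div_le_div_iff₀ (by positivity) (by positivity)]
  linarith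

theorem norm_heat_le {B : ℝ} {f : Space → E} (hf : ∀ y, ‖f y‖ ≤ B) (t : ℝ) (x : Space) :
    ‖heat t f x‖ ≤ B := by
  have := norm_integral_le_of_norm_le_const (μ := gauss) (f := fun w => f (x - √t • w))
    (Eventually.of_forall fun w => hf _)
  simpa [heat] using this

/-- The displacement is `√t w`, so the exponential moment is taken at `m = kε√t` and costs
`exp(2(kε)²t)`. The parameter `ε` exists to make this growth slower than any prescribed exponential.
-/
theorem norm_heat_le_decay {ε k B : ℝ} (hε : 0 ≤ ε) (hk : 0 ≤ k) {f : Space → E}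
    (hf : ∀ y, ‖f y‖ ≤ B * decay ε k y) {t : ℝ} (ht : 0 ≤ t) (x : Space) :
    ‖heat t f x‖ ≤ B * gaussMoment * Real.exp (2 * (k * ε) ^ 2 * t) * decay ε k x := by
  have hB : 0 ≤ B := by
    have h1 := (norm_nonneg _).trans (hf 0)
    exact nonneg_of_mul_nonneg_left h1 (decay_pos hε k 0)
  have h1 : ‖heat t f x‖ ≤ ∫ w : Space, B * decay ε k x * Real.exp (k * ε * √t * ‖w‖) ∂gauss := by
    refine norm_integral_le_of_norm_le ((integrable_exp_norm_gauss _).const_mul _)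
      (Eventually.of_forall fun w => (hf _).trans ?_)
    rw [mul_assoc B]
    refine mul_le_mul_of_nonneg_left ((decay_sub_le hε hk x _).trans (le_of_eq ?_)) hB
    rw [norm_smul, Real.norm_of_nonneg (Real.sqrt_nonneg t)]
    ring_nf
  refine h1.trans ?_
  rw [integral_const_mul]
  have h2 := integral_exp_norm_gauss_le (k * ε * √t)
  have h3 : 2 * (k * ε * √t) ^ 2 = 2 * (k * ε) ^ 2 * t := by
    rw [mul_pow, Real.sq_sqrt ht]
    ring
  rw [h3] at h2
  have h4 : 0 ≤ B * decay ε k x := mul_nonneg hB (decay_pos hε k x).le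
  calc _ ≤ B * decay ε k x * (Real.exp (2 * (k * ε) ^ 2 * t) * gaussMoment) := by gcongr
    _ = _ := by ring

/-! ### Gaussian averages with a kernel -/

/-- The average of `K w (f (x - √t w))` over the Gaussian measure. -/
def gaussAvg (K : Space → E →L[ℝ] F) (t : ℝ) (f : Space → E) (x : Space) : F :=
  ∫ w, K w (f (x - √t • w)) ∂gauss

theorem heat_eq_gaussAvg (t : ℝ) (f : Space → E) (x : Space) :
    heat t f x = gaussAvg (fun _ => ContinuousLinearMap.id ℝ E) t f x := rfl

theorem norm_gaussAvg_le {K : Space → E →L[ℝ] F}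
    (hKi : Integrable (fun w => ‖K w‖) gauss) {B : ℝ} {f : Space → E} (hf : ∀ y, ‖f y‖ ≤ B)
    (t : ℝ) (x : Space) : ‖gaussAvg K t f x‖ ≤ B * ∫ w, ‖K w‖ ∂gauss := by
  rw [← integral_const_mul]
  refine norm_integral_le_of_norm_le (hKi.const_mul _) (Eventually.of_forall fun w => ?_)
  rw [mul_comm]
  exact (K w).le_opNorm_of_le (hf _)

/-- Space-time functions on `t > 0` which are continuous, and bounded on bounded time intervals. -/
structure Admissible (g : Space → ℝ → E) : Prop where
  continuousOn : ContinuousOn (fun p : Space × ℝ => g p.1 p.2) (univ ×ˢ Ioi 0)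
  bounded : ∀ T : ℝ, ∃ C : ℝ, ∀ x, ∀ t ∈ Ioc 0 T, ‖g x t‖ ≤ C

theorem Admissible.continuousAt {g : Space → ℝ → E} (hg : Admissible g) (x : Space) {t : ℝ}
    (ht : 0 < t) : ContinuousAt (fun p : Space × ℝ => g p.1 p.2) (x, t) :=
  hg.continuousOn.continuousAt ((isOpen_univ.prod isOpen_Ioi).mem_nhds ⟨mem_univ _, ht⟩)

theorem Admissible.continuous_slice {g : Space → ℝ → E} (hg : Admissible g) {t : ℝ}
    (ht : 0 < t) : Continuous fun x => g x t :=
  continuous_iff_continuousAt.2 fun x =>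
    (hg.continuousAt x ht).comp (f := fun y => (y, t)) (by fun_prop)

theorem Admissible.bounded_slice {g : Space → ℝ → E} (hg : Admissible g) {t : ℝ}
    (ht : 0 < t) : ∃ C, ∀ x, ‖g x t‖ ≤ C := by
  obtain ⟨C, hC⟩ := hg.bounded t
  exact ⟨C, fun x => hC x t ⟨ht, le_rfl⟩⟩

/-- The diffusion time `τ` is arbitrary, in particular it may vanish; only the time `s` at which the
source is read must be positive. Duhamel integrands are thus continuous up to the endpoint `s = t`.
-/
theorem continuousAt_gaussAvg {K : Space → E →L[ℝ] F} (hK : Continuous K)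
    (hKi : Integrable (fun w => ‖K w‖) gauss) {g : Space → ℝ → E} (hg : Admissible g)
    (x : Space) (τ : ℝ) {s : ℝ} (hs : 0 < s) :
    ContinuousAt (fun p : Space × ℝ × ℝ => gaussAvg K p.2.1 (fun y => g y p.2.2) p.1)
      (x, τ, s) := by
  obtain ⟨C, hC⟩ := hg.bounded (s + 1)
  have hev : ∀ᶠ p : Space × ℝ × ℝ in 𝓝 (x, τ, s), p.2.2 ∈ Ioo 0 (s + 1) := by
    have : ContinuousAt (fun p : Space × ℝ × ℝ => p.2.2) (x, τ, s) := by fun_prop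
    exact this.eventually (Ioo_mem_nhds hs (by simp))
  refine continuousAt_of_dominated (bound := fun w => ‖K w‖ * C) ?_ ?_ (hKi.mul_const C) ?_
  · filter_upwards [hev] with p hp
    have : Continuous fun w => K w (g (p.1 - √p.2.1 • w) p.2.2) :=
      hK.clm_apply ((hg.continuous_slice hp.1).comp (by fun_prop))
    exact this.aestronglyMeasurable
  · filter_upwards [hev] with p hp
    exact Eventually.of_forall fun w =>
      (K w).le_opNorm_of_le (hC _ _ ⟨hp.1, hp.2.le⟩)
  · refine Eventually.of_forall fun w => ?_
    refine (K w).continuous.continuousAt.comp ?_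
    have h1 : ContinuousAt (fun p : Space × ℝ × ℝ => (p.1 - √p.2.1 • w, p.2.2)) (x, τ, s) := by
      fun_prop
    exact ContinuousAt.comp (g := fun p : Space × ℝ => g p.1 p.2)
      (f := fun p : Space × ℝ × ℝ => (p.1 - √p.2.1 • w, p.2.2)) (hg.continuousAt (x - √τ • w) hs) h1

theorem continuousAt_heat {g : Space → ℝ → E} (hg : Admissible g) (x : Space) (τ : ℝ) {s : ℝ}
    (hs : 0 < s) :
    ContinuousAt (fun p : Space × ℝ × ℝ => heat p.2.1 (fun y => g y p.2.2) p.1) (x, τ, s) :=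
  continuousAt_gaussAvg (K := fun _ => ContinuousLinearMap.id ℝ E) continuous_const
    (integrable_const _) hg x τ hs

theorem continuous_gaussAvg {K : Space → E →L[ℝ] F} (hK : Continuous K)
    (hKi : Integrable (fun w => ‖K w‖) gauss) {f : Space → E} (hf : Continuous f) {B : ℝ}
    (hB : ∀ y, ‖f y‖ ≤ B) :
    Continuous fun p : Space × ℝ => gaussAvg K p.2 f p.1 := by
  have hg : Admissible fun (x : Space) (_ : ℝ) => f x := ⟨by fun_prop, fun _ => ⟨B, fun x _ _ => hB x⟩⟩
  refine continuous_iff_continuousAt.2 fun p => ?_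
  exact (continuousAt_gaussAvg hK hKi hg p.1 p.2 one_pos).comp
    (f := fun q : Space × ℝ => (q.1, q.2, (1 : ℝ))) (by fun_prop)

theorem continuous_heat {f : Space → E} (hf : Continuous f) {B : ℝ} (hB : ∀ y, ‖f y‖ ≤ B) :
    Continuous fun p : Space × ℝ => heat p.2 f p.1 :=
  continuous_gaussAvg (K := fun _ => ContinuousLinearMap.id ℝ E) continuous_const
    (integrable_const _) hf hB

/-! ### Spatial derivatives -/

/-- The kernel `v ↦ -(1/2) w ⊗ v` of the gradient of the heat semigroup at time one. -/
def gradKernel (w : Space) : E →L[ℝ] (Space →L[ℝ] E) :=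
  (-(1 / 2) : ℝ) • ContinuousLinearMap.smulRightL ℝ Space E (innerSL ℝ w)

theorem gradKernel_apply (w z : Space) (v : E) :
    gradKernel w v z = (-(1 / 2) * inner ℝ w z : ℝ) • v := by
  simp [gradKernel, mul_smul]

theorem norm_gradKernel_apply_le (w : Space) (v : E) : ‖gradKernel w v‖ ≤ ‖w‖ * ‖v‖ := by
  refine ContinuousLinearMap.opNorm_le_bound _ (by positivity) fun z => ?_
  rw [gradKernel_apply, norm_smul, norm_mul]
  have := norm_inner_le_norm (𝕜 := ℝ) w z
  have h2 : ‖(-(1 / 2) : ℝ)‖ = 1 / 2 := by norm_num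
  rw [h2]
  have h3 : 0 ≤ ‖w‖ * ‖z‖ := by positivity
  calc 1 / 2 * ‖inner ℝ w z‖ * ‖v‖ ≤ (‖w‖ * ‖z‖) * ‖v‖ := by
        refine mul_le_mul_of_nonneg_right ?_ (norm_nonneg v)
        linarith [norm_nonneg (inner ℝ w z : ℝ)]
    _ = _ := by ring

theorem continuous_gradKernel : Continuous (gradKernel : Space → E →L[ℝ] (Space →L[ℝ] E)) := by
  unfold gradKernel
  fun_prop

theorem integrable_gradKernel :
    Integrable (fun w => ‖(gradKernel w : E →L[ℝ] (Space →L[ℝ] E))‖) gauss := by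
  have hc : Continuous fun w => ‖(gradKernel w : E →L[ℝ] (Space →L[ℝ] E))‖ :=
    (continuous_norm (E := E →L[ℝ] (Space →L[ℝ] E))).comp continuous_gradKernel
  refine integrable_norm_gauss.mono' hc.aestronglyMeasurable
    (Eventually.of_forall fun w => ?_)
  refine (norm_norm (gradKernel w : E →L[ℝ] (Space →L[ℝ] E))).le.trans ?_
  exact ContinuousLinearMap.opNorm_le_bound _ (norm_nonneg _) (norm_gradKernel_apply_le w)

/-- The spatial derivative of the heat semigroup, with the derivative on the kernel. -/
def heatGrad (t : ℝ) (f : Space → E) (x : Space) : Space →L[ℝ] E :=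
  (√t)⁻¹ • gaussAvg gradKernel t f x

theorem hasFDerivAt_heatKernel_one (z : Space) :
    HasFDerivAt (fun z : Space => heatKernel z 1)
      ((heatKernel z 1 * -(1 / 2)) • innerSL ℝ z) z := by
  have h1 : HasFDerivAt (fun z : Space => ‖z‖ ^ 2) (2 • innerSL ℝ z) z :=
    (hasStrictFDerivAt_norm_sq z).hasFDerivAt
  have h2 := ((h1.const_mul (-(1 / 4) : ℝ)).exp).mul_const (((4 * Real.pi) ^ (3 / 2 : ℝ))⁻¹)
  simp_rw [heatKernel_one, div_eq_mul_inv]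
  convert! h2 using 1
  ext v
  simp
  ring_nf

/-- A Gaussian majorant of the kernel gradient, uniform for `x` in the unit ball about `x₀`; it
dominates the differentiation under the integral. -/
theorem heatKernel_one_sub_le {x₀ x y : Space} (hx : ‖x - x₀‖ ≤ 1) :
    ‖x - y‖ * heatKernel (x - y) 1 ≤
      8 * Real.exp 1 * Real.exp (-(1 / 16) * ‖x₀ - y‖ ^ 2) := by
  rw [heatKernel_one]
  have h0 : (1 : ℝ) ≤ (4 * Real.pi) ^ (3 / 2 : ℝ) := by
    refine Real.one_le_rpow ?_ (by norm_num)
    linarith [Real.pi_gt_three]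
  have h1 : ‖x₀ - y‖ ≤ 1 + ‖x - y‖ := by
    have := norm_add_le (x₀ - x) (x - y)
    rw [norm_sub_rev x₀ x] at this
    simp only [sub_add_sub_cancel] at this
    linarith
  have h2 : ‖x - y‖ ≤ 8 * Real.exp (1 / 8 * ‖x - y‖ ^ 2) := by
    have := Real.add_one_le_exp (1 / 8 * ‖x - y‖ ^ 2)
    nlinarith [sq_nonneg (‖x - y‖ - 4)]
  calc ‖x - y‖ * (Real.exp (-(1 / 4) * ‖x - y‖ ^ 2) / (4 * Real.pi) ^ (3 / 2 : ℝ))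
      ≤ (8 * Real.exp (1 / 8 * ‖x - y‖ ^ 2)) * (Real.exp (-(1 / 4) * ‖x - y‖ ^ 2) / 1) := by
        gcongr
    _ = 8 * Real.exp (-(1 / 8) * ‖x - y‖ ^ 2) := by
        rw [div_one, mul_assoc, ← Real.exp_add]
        ring_nf
    _ ≤ 8 * Real.exp (1 + (-(1 / 16) * ‖x₀ - y‖ ^ 2)) := by
        gcongr
        have : ‖x₀ - y‖ ^ 2 ≤ (1 + ‖x - y‖) ^ 2 := by gcongr
        nlinarith [sq_nonneg (‖x - y‖ - 1)]
    _ = _ := by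
        rw [Real.exp_add]
        ring

/-- In the kernel form `x` occurs only in the kernel, so no derivative of `f` is needed. -/
theorem hasFDerivAt_heat_one {f : Space → E} (hf : Continuous f) {B : ℝ}
    (hB : ∀ y, ‖f y‖ ≤ B) (x : Space) :
    HasFDerivAt (heat 1 f) (heatGrad 1 f x) x := by
  have e1 : heat 1 f = fun x => ∫ y, heatKernel (x - y) 1 • f y := by
    ext x
    exact heat_eq_integral_kernel one_pos f x
  have hB0 : 0 ≤ B := (norm_nonneg _).trans (hB 0)
  let F' : Space → Space → Space →L[ℝ] E := fun x y =>
    heatKernel (x - y) 1 • gradKernel (x - y) (f y)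
  have e2 : heatGrad 1 f x = ∫ y, F' x y := by
    rw [heatGrad, Real.sqrt_one, inv_one, one_smul, gaussAvg, integral_gauss,
      ← integral_sub_left_eq_self _ volume x]
    simp [F']
  have hF'c : ∀ x, Continuous (F' x) := fun x =>
    (continuous_heatKernel_one.comp (by fun_prop : Continuous fun y : Space => x - y)).smul
      ((continuous_gradKernel.comp (by fun_prop : Continuous fun y : Space => x - y)).clm_apply hf)
  rw [e1, e2]
  refine hasFDerivAt_integral_of_dominated_of_fderiv_le (F' := F')
    (bound := fun y => 8 * Real.exp 1 * Real.exp (-(1 / 16) * ‖x - y‖ ^ 2) * B)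
    (Metric.closedBall_mem_nhds x one_pos) ?_ ?_ ?_ ?_ ?_ ?_
  · refine Eventually.of_forall fun z => Continuous.aestronglyMeasurable ?_
    exact (continuous_heatKernel_one.comp (by fun_prop : Continuous fun y : Space => z - y)).smul hf
  · have h1 : Integrable (fun w => f (x - w)) gauss :=
      Integrable.of_bound (hf.comp (by fun_prop)).aestronglyMeasurable B
        (Eventually.of_forall fun w => hB _)
    have h2 := ((integrable_gauss_iff _).1 h1).comp_sub_left x
    simpa using h2
  · exact (hF'c x).aestronglyMeasurable
  · refine Eventually.of_forall fun y z hz => ?_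
    rw [Metric.mem_closedBall, dist_eq_norm] at hz
    rw [norm_smul, Real.norm_of_nonneg (heatKernel_nonneg _ zero_le_one)]
    calc _ ≤ heatKernel (z - y) 1 * (‖z - y‖ * B) := by
          gcongr
          · exact heatKernel_nonneg _ zero_le_one
          · exact (norm_gradKernel_apply_le _ _).trans (by gcongr; exact hB y)
      _ = ‖z - y‖ * heatKernel (z - y) 1 * B := by ring
      _ ≤ _ := mul_le_mul_of_nonneg_right (heatKernel_one_sub_le hz) hB0
  · exact (((integrable_exp_neg_mul_sq (b := 1 / 16) (by norm_num)).comp_sub_left x).const_mul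
      _).mul_const B
  · refine Eventually.of_forall fun y z _ => ?_
    have h1 := ((hasFDerivAt_heatKernel_one (z - y)).comp z
      ((hasFDerivAt_id z).sub_const y)).smul_const (f y)
    convert! h1 using 1
    ext v
    simp [F', gradKernel_apply, smul_smul, inner_sub_left]
    ring_nf

/-- Parabolic scaling reduces the claim to time one and produces the factor `(√t)⁻¹`. -/
theorem hasFDerivAt_heat {f : Space → E} (hf : Continuous f) {B : ℝ}
    (hB : ∀ y, ‖f y‖ ≤ B) {t : ℝ} (ht : 0 < t) (x : Space) :
    HasFDerivAt (heat t f) (heatGrad t f x) x := by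
  have hs : √t ≠ 0 := (Real.sqrt_pos.2 ht).ne'
  have h1 := hasFDerivAt_heat_one (f := fun y => f (√t • y)) (hf.comp (by fun_prop))
    (fun y => hB _) ((√t)⁻¹ • x)
  have h2 : HasFDerivAt (fun z : Space => (√t)⁻¹ • z)
      ((√t)⁻¹ • ContinuousLinearMap.id ℝ Space) x :=
    (hasFDerivAt_id (𝕜 := ℝ) x).fun_const_smul _
  have h3 := h1.comp x h2
  convert! h3 using 1
  · ext z
    simp [heat, smul_sub, smul_smul, mul_inv_cancel₀ hs]
  · ext v
    simp [heatGrad, gaussAvg, smul_sub, smul_smul, mul_inv_cancel₀ hs]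

theorem norm_heatGrad_le {f : Space → E} {B : ℝ} (hB : ∀ y, ‖f y‖ ≤ B) (t : ℝ) (x : Space) :
    ‖heatGrad t f x‖ ≤
      (√t)⁻¹ * (B * ∫ w, ‖(gradKernel w : E →L[ℝ] (Space →L[ℝ] E))‖ ∂gauss) := by
  rw [heatGrad, norm_smul, norm_inv, Real.norm_of_nonneg (Real.sqrt_nonneg t)]
  gcongr
  exact norm_gaussAvg_le integrable_gradKernel hB t x

/-- Here the derivative falls on the datum, so there is no singular factor. Since a derivative is
unique, comparison with `hasFDerivAt_heat` yields integration by parts. -/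
theorem hasFDerivAt_heat_of_hasFDerivAt {f : Space → E} {f' : Space → Space →L[ℝ] E}
    (hf : ∀ y, HasFDerivAt f (f' y) y) (hf' : Continuous f') {B B' : ℝ}
    (hB : ∀ y, ‖f y‖ ≤ B) (hB' : ∀ y, ‖f' y‖ ≤ B') (t : ℝ) (x : Space) :
    HasFDerivAt (heat t f) (heat t f' x) x := by
  have hfc : Continuous f := continuous_iff_continuousAt.2 fun y => (hf y).continuousAt
  refine hasFDerivAt_integral_of_dominated_of_fderiv_le (F := fun x w => f (x - √t • w))
    (F' := fun x w => f' (x - √t • w)) (bound := fun _ => B') univ_mem ?_ ?_ ?_ ?_ ?_ ?_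
  · exact Eventually.of_forall fun z => (hfc.comp (by fun_prop)).aestronglyMeasurable
  · exact Integrable.of_bound (hfc.comp (by fun_prop)).aestronglyMeasurable B
      (Eventually.of_forall fun w => hB _)
  · exact (hf'.comp (by fun_prop)).aestronglyMeasurable
  · exact Eventually.of_forall fun w z _ => hB' _
  · exact integrable_const _
  · exact Eventually.of_forall fun w z _ => by
      simpa using! (hf (z - √t • w)).comp z ((hasFDerivAt_id z).sub_const (√t • w))

/-- Integration by parts for the Gaussian kernel. -/
theorem heatGrad_eq_heat {f : Space → E} {f' : Space → Space →L[ℝ] E}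
    (hf : ∀ y, HasFDerivAt f (f' y) y) (hf' : Continuous f') {B B' : ℝ}
    (hB : ∀ y, ‖f y‖ ≤ B) (hB' : ∀ y, ‖f' y‖ ≤ B') {t : ℝ} (ht : 0 < t) (x : Space) :
    heatGrad t f x = heat t f' x :=
  (hasFDerivAt_heat (continuous_iff_continuousAt.2 fun y => (hf y).continuousAt) hB ht x).unique
    (hasFDerivAt_heat_of_hasFDerivAt hf hf' hB hB' t x)

end QTensor

namespace QTensor

variable {E F : Type} [NormedAddCommGroup E] [NormedSpace ℝ E]
  [NormedAddCommGroup F] [NormedSpace ℝ F]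

/-! ### The Duhamel integral -/

/-- The Duhamel integral `∫₀ᵗ e^{(t - s)Δ} g(s) ds`. -/
def duh (g : Space → ℝ → E) (x : Space) (t : ℝ) : E :=
  ∫ s in (0)..t, heat (t - s) (fun y => g y s) x

/-- Duhamel integrals on the unit time interval, with a kernel `K` and a time weight `m`. -/
def duhAvg (K : Space → E →L[ℝ] F) (m : ℝ → ℝ) (g : Space → ℝ → E) (x : Space) (t : ℝ) : F :=
  ∫ r in Ioo (0 : ℝ) 1, m r • gaussAvg K (t * (1 - r)) (fun y => g y (t * r)) x

theorem continuousOn_duhAvg_integrand {K : Space → E →L[ℝ] F} (hK : Continuous K)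
    (hKi : Integrable (fun w => ‖K w‖) gauss) {m : ℝ → ℝ} (hm : ContinuousOn m (Ioo 0 1))
    {g : Space → ℝ → E} (hg : Admissible g) (x : Space) {t : ℝ} (ht : 0 < t) :
    ContinuousOn (fun r => m r • gaussAvg K (t * (1 - r)) (fun y => g y (t * r)) x)
      (Ioo 0 1) := by
  refine hm.smul fun r hr => ContinuousAt.continuousWithinAt ?_
  exact ContinuousAt.comp
    (g := fun p : Space × ℝ × ℝ => gaussAvg K p.2.1 (fun y => g y p.2.2) p.1)
    (f := fun r => (x, t * (1 - r), t * r))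
    (continuousAt_gaussAvg hK hKi hg x (t * (1 - r)) (mul_pos ht hr.1)) (by fun_prop)

theorem norm_duhAvg_integrand_le {K : Space → E →L[ℝ] F}
    (hKi : Integrable (fun w => ‖K w‖) gauss) (m : ℝ → ℝ) {g : Space → ℝ → E} {T C : ℝ}
    (hC : ∀ x, ∀ t ∈ Ioc 0 T, ‖g x t‖ ≤ C) (x : Space) {t : ℝ} (ht : t ∈ Ioc 0 T) {r : ℝ}
    (hr : r ∈ Ioo (0 : ℝ) 1) :
    ‖m r • gaussAvg K (t * (1 - r)) (fun y => g y (t * r)) x‖ ≤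
      ‖m r‖ * (C * ∫ w, ‖K w‖ ∂gauss) := by
  rw [norm_smul]
  gcongr
  refine norm_gaussAvg_le hKi (fun y => hC y _ ⟨mul_pos ht.1 hr.1, ?_⟩) _ _
  nlinarith [ht.1, ht.2, hr.2]

theorem norm_duhAvg_le {K : Space → E →L[ℝ] F}
    (hKi : Integrable (fun w => ‖K w‖) gauss) {m : ℝ → ℝ} (hm : IntegrableOn m (Ioo 0 1))
    {g : Space → ℝ → E} {T C : ℝ} (hC : ∀ x, ∀ t ∈ Ioc 0 T, ‖g x t‖ ≤ C) (x : Space) {t : ℝ}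
    (ht : t ∈ Ioc 0 T) :
    ‖duhAvg K m g x t‖ ≤ (∫ r in Ioo (0 : ℝ) 1, ‖m r‖) * (C * ∫ w, ‖K w‖ ∂gauss) := by
  rw [← integral_mul_const]
  refine norm_integral_le_of_norm_le (hm.norm.mul_const _) ?_
  filter_upwards [ae_restrict_mem measurableSet_Ioo] with r hr
  exact norm_duhAvg_integrand_le hKi m hC x ht hr

theorem continuousAt_duhAvg {K : Space → E →L[ℝ] F} (hK : Continuous K)
    (hKi : Integrable (fun w => ‖K w‖) gauss) {m : ℝ → ℝ} (hm : ContinuousOn m (Ioo 0 1))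
    (hmi : IntegrableOn m (Ioo 0 1)) {g : Space → ℝ → E} (hg : Admissible g) (x : Space) {t : ℝ}
    (ht : 0 < t) :
    ContinuousAt (fun p : Space × ℝ => duhAvg K m g p.1 p.2) (x, t) := by
  obtain ⟨C, hC⟩ := hg.bounded (t + 1)
  have hev : ∀ᶠ p : Space × ℝ in 𝓝 (x, t), p.2 ∈ Ioo 0 (t + 1) := by
    have : ContinuousAt (fun p : Space × ℝ => p.2) (x, t) := by fun_prop
    exact this.eventually (Ioo_mem_nhds ht (by simp))
  refine continuousAt_of_dominated (bound := fun r => ‖m r‖ * (C * ∫ w, ‖K w‖ ∂gauss)) ?_ ?_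
    (hmi.norm.mul_const _) ?_
  · filter_upwards [hev] with p hp
    exact (continuousOn_duhAvg_integrand hK hKi hm hg p.1 hp.1).aestronglyMeasurable
      measurableSet_Ioo
  · filter_upwards [hev] with p hp
    filter_upwards [ae_restrict_mem measurableSet_Ioo] with r hr
    exact norm_duhAvg_integrand_le hKi m hC p.1 ⟨hp.1, hp.2.le⟩ hr
  · filter_upwards [ae_restrict_mem measurableSet_Ioo] with r hr
    refine ContinuousAt.const_smul ?_ _
    exact ContinuousAt.comp
      (g := fun p : Space × ℝ × ℝ => gaussAvg K p.2.1 (fun y => g y p.2.2) p.1)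
      (f := fun p : Space × ℝ => (p.1, p.2 * (1 - r), p.2 * r))
      (continuousAt_gaussAvg hK hKi hg x (t * (1 - r)) (mul_pos ht hr.1)) (by fun_prop)

/-- The average stays bounded as `t ↓ 0`, so the prefactor `θ`, vanishing for `t ≤ 0`, makes the
product continuous across `t = 0`. -/
theorem continuous_smul_duhAvg {K : Space → E →L[ℝ] F} (hK : Continuous K)
    (hKi : Integrable (fun w => ‖K w‖) gauss) {m : ℝ → ℝ} (hm : ContinuousOn m (Ioo 0 1))
    (hmi : IntegrableOn m (Ioo 0 1)) {g : Space → ℝ → E} (hg : Admissible g) {θ : ℝ → ℝ}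
    (hθ : Continuous θ) (hθ0 : ∀ t ≤ 0, θ t = 0) :
    Continuous fun p : Space × ℝ => θ p.2 • duhAvg K m g p.1 p.2 := by
  refine continuous_iff_continuousAt.2 fun ⟨x, t⟩ => ?_
  rcases lt_or_ge 0 t with ht | ht
  · exact (hθ.comp continuous_snd).continuousAt.smul (continuousAt_duhAvg hK hKi hm hmi hg x ht)
  · obtain ⟨C, hC⟩ := hg.bounded 1
    set D : ℝ := (∫ r in Ioo (0 : ℝ) 1, ‖m r‖) * (C * ∫ w, ‖K w‖ ∂gauss)
    rw [ContinuousAt, hθ0 t ht, zero_smul]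
    have hlim : Tendsto (fun p : Space × ℝ => ‖θ p.2‖ * D) (𝓝 (x, t)) (𝓝 0) := by
      have h1 : Continuous fun p : Space × ℝ => ‖θ p.2‖ * D := by fun_prop
      have h2 := h1.tendsto (x, t)
      simpa [hθ0 t ht] using h2
    refine squeeze_zero_norm' ?_ hlim
    have hev : ∀ᶠ p : Space × ℝ in 𝓝 (x, t), p.2 < 1 := by
      have : ContinuousAt (fun p : Space × ℝ => p.2) (x, t) := by fun_prop
      exact this.eventually (Iio_mem_nhds (by linarith))
    filter_upwards [hev] with p hp
    rw [norm_smul]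
    rcases lt_or_ge 0 p.2 with h | h
    · gcongr
      exact norm_duhAvg_le hKi hmi hC p.1 ⟨h, hp.le⟩
    · simp [hθ0 _ h]

/-- The substitution `s = tr` fixes the interval of integration, so that `t` becomes a parameter for
dominated convergence. -/
theorem duh_eq_smul_duhAvg (g : Space → ℝ → E) (x : Space) (t : ℝ) :
    duh g x t = t • duhAvg (fun _ => ContinuousLinearMap.id ℝ E) (fun _ => 1) g x t := by
  have h := intervalIntegral.smul_integral_comp_mul_left
    (fun s => heat (t - s) (fun y => g y s) x) t (a := 0) (b := 1)
  rw [mul_zero, mul_one] at h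
  rw [duh, ← h, duhAvg, intervalIntegral.integral_of_le zero_le_one,
    ← integral_Ioc_eq_integral_Ioo]
  simp only [one_smul, ← heat_eq_gaussAvg, mul_sub, mul_one]

theorem continuous_duh {g : Space → ℝ → E} (hg : Admissible g) :
    Continuous fun p : Space × ℝ => duh g p.1 (max p.2 0) := by
  have h := continuous_smul_duhAvg (K := fun _ : Space => ContinuousLinearMap.id ℝ E)
    continuous_const (integrable_const _) (m := fun _ => 1) continuousOn_const
    (integrableOn_const (by simp)) hg (θ := fun t => max t 0) (by fun_prop)
    (fun t ht => max_eq_right ht)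
  refine h.congr fun p => ?_
  rw [duh_eq_smul_duhAvg]
  rcases le_total 0 p.2 with h | h
  · simp [h]
  · simp [h]

theorem integrableOn_inv_sqrt_one_sub : IntegrableOn (fun r : ℝ => (√(1 - r))⁻¹) (Ioo 0 1) := by
  have h1 : IntervalIntegrable (fun r : ℝ => r ^ (-(1 / 2) : ℝ)) volume 0 1 :=
    intervalIntegral.intervalIntegrable_rpow' (by norm_num)
  have h2 := (h1.comp_sub_left 1).symm
  simp only [sub_zero, sub_self] at h2
  have h3 := (intervalIntegrable_iff_integrableOn_Ioo_of_le zero_le_one).1 h2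
  refine h3.congr_fun (fun r hr => ?_) measurableSet_Ioo
  have : 0 ≤ 1 - r := by linarith [hr.2]
  simp only [Real.sqrt_eq_rpow]
  rw [← Real.rpow_neg this]

theorem continuousOn_inv_sqrt_one_sub : ContinuousOn (fun r : ℝ => (√(1 - r))⁻¹) (Ioo 0 1) := by
  refine ContinuousOn.inv₀ (by fun_prop) fun r hr => ?_
  exact (Real.sqrt_pos.2 (by linarith [hr.2])).ne'

/-- The spatial derivative of the Duhamel integral, with the derivative on the kernel. -/
def duhGrad (g : Space → ℝ → E) (x : Space) (t : ℝ) : Space →L[ℝ] E :=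
  √t • duhAvg gradKernel (fun r => (√(1 - r))⁻¹) g x t

theorem continuous_duhGrad {g : Space → ℝ → E} (hg : Admissible g) :
    Continuous fun p : Space × ℝ => duhGrad g p.1 p.2 :=
  continuous_smul_duhAvg continuous_gradKernel integrable_gradKernel
    continuousOn_inv_sqrt_one_sub integrableOn_inv_sqrt_one_sub hg Real.continuous_sqrt
    fun _ ht => Real.sqrt_eq_zero_of_nonpos ht

theorem duhGrad_bounded {g : Space → ℝ → E} (hg : Admissible g) (T : ℝ) :
    ∃ C : ℝ, ∀ x, ∀ t ≤ T, ‖duhGrad g x t‖ ≤ C := by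
  obtain ⟨C, hC⟩ := hg.bounded T
  refine ⟨√T * |(∫ r in Ioo (0 : ℝ) 1, ‖(√(1 - r))⁻¹‖) *
    (C * ∫ w, ‖(gradKernel w : E →L[ℝ] (Space →L[ℝ] E))‖ ∂gauss)|, fun x t ht => ?_⟩
  rw [duhGrad, norm_smul, Real.norm_of_nonneg (Real.sqrt_nonneg t)]
  rcases lt_or_ge 0 t with h | h
  · gcongr
    exact (norm_duhAvg_le integrable_gradKernel integrableOn_inv_sqrt_one_sub hC x
      ⟨h, ht⟩).trans (le_abs_self _)
  · rw [Real.sqrt_eq_zero_of_nonpos h, zero_mul]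
    positivity

theorem duh_eq_smul_integral (g : Space → ℝ → E) (x : Space) (t : ℝ) :
    duh g x t = t • ∫ r in Ioo (0 : ℝ) 1, heat (t * (1 - r)) (fun y => g y (t * r)) x := by
  rw [duh_eq_smul_duhAvg, duhAvg]
  simp only [one_smul, ← heat_eq_gaussAvg]

theorem continuousOn_duh_integrand {g : Space → ℝ → E} (hg : Admissible g) (x : Space) {t : ℝ}
    (ht : 0 < t) :
    ContinuousOn (fun r => heat (t * (1 - r)) (fun y => g y (t * r)) x) (Ioo 0 1) := by
  simpa [← heat_eq_gaussAvg] using continuousOn_duhAvg_integrand (K := fun _ : Space => ContinuousLinearMap.id ℝ E)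
    continuous_const (integrable_const _) (m := fun _ => 1) continuousOn_const hg x ht

theorem integrableOn_duh_integrand {g : Space → ℝ → E} (hg : Admissible g) (x : Space) {t : ℝ}
    (ht : 0 < t) :
    IntegrableOn (fun r => heat (t * (1 - r)) (fun y => g y (t * r)) x) (Ioo 0 1) := by
  obtain ⟨C, hC⟩ := hg.bounded t
  refine Integrable.of_bound
    ((continuousOn_duh_integrand hg x ht).aestronglyMeasurable measurableSet_Ioo) C ?_
  filter_upwards [ae_restrict_mem measurableSet_Ioo] with r hr
  refine norm_heat_le (fun y => hC y _ ⟨mul_pos ht hr.1, ?_⟩) _ _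
  nlinarith [hr.2]

/-- The gradient kernel costs `(t-s)^{-1/2}`, which is integrable in `s`. Hence the Duhamel integral
of a source that is only continuous and bounded is differentiable in space. -/
theorem hasFDerivAt_duh {g : Space → ℝ → E} (hg : Admissible g) (x : Space) {t : ℝ}
    (ht : 0 ≤ t) : HasFDerivAt (fun y => duh g y t) (duhGrad g x t) x := by
  rcases ht.eq_or_lt with rfl | ht
  · simp only [duh, intervalIntegral.integral_same, duhGrad, Real.sqrt_zero, zero_smul]
    exact hasFDerivAt_const _ _
  obtain ⟨C, hC⟩ := hg.bounded t
  have hst : 0 < √t := Real.sqrt_pos.2 ht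
  have e1 : (fun y => duh g y t) = fun y =>
      t • ∫ r in Ioo (0 : ℝ) 1, heat (t * (1 - r)) (fun y => g y (t * r)) y := by
    ext y
    exact duh_eq_smul_integral g y t
  have key : ∀ y r, (√(t * (1 - r)))⁻¹ • gaussAvg gradKernel (t * (1 - r)) (fun y => g y (t * r)) y
      = (√t)⁻¹ • ((√(1 - r))⁻¹ • gaussAvg gradKernel (t * (1 - r)) (fun y => g y (t * r)) y) := by
    intro y r
    rw [Real.sqrt_mul ht.le, mul_inv, mul_smul]
  have e2 : duhGrad g x t =
      t • ∫ r in Ioo (0 : ℝ) 1, heatGrad (t * (1 - r)) (fun y => g y (t * r)) x := by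
    simp only [heatGrad, key]
    rw [integral_smul, smul_smul, duhGrad, duhAvg]
    congr 1
    field_simp
    exact Real.sq_sqrt ht.le
  have hmem : ∀ r ∈ Ioo (0 : ℝ) 1, t * r ∈ Ioc 0 t := fun r hr =>
    ⟨mul_pos ht hr.1, by nlinarith [hr.2]⟩
  rw [e1, e2]
  refine HasFDerivAt.fun_const_smul ?_ t
  refine hasFDerivAt_integral_of_dominated_of_fderiv_le (F' := fun y r =>
      heatGrad (t * (1 - r)) (fun y => g y (t * r)) y)
    (bound := fun r => (√t)⁻¹ * ((√(1 - r))⁻¹ *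
      (C * ∫ w, ‖(gradKernel w : E →L[ℝ] (Space →L[ℝ] E))‖ ∂gauss))) univ_mem ?_ ?_ ?_ ?_ ?_ ?_
  · exact Eventually.of_forall fun y =>
      (continuousOn_duh_integrand hg y ht).aestronglyMeasurable measurableSet_Ioo
  · exact integrableOn_duh_integrand hg x ht
  · refine ContinuousOn.aestronglyMeasurable ?_ measurableSet_Ioo
    simp only [heatGrad, key]
    exact (continuousOn_duhAvg_integrand continuous_gradKernel integrable_gradKernel
      continuousOn_inv_sqrt_one_sub hg x ht).const_smul ((√t)⁻¹ : ℝ)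
  · filter_upwards [ae_restrict_mem measurableSet_Ioo] with r hr y _
    refine (norm_heatGrad_le (fun y => hC y _ (hmem r hr)) _ _).trans (le_of_eq ?_)
    rw [Real.sqrt_mul ht.le, mul_inv, mul_assoc]
  · exact (integrableOn_inv_sqrt_one_sub.mul_const _).const_mul _
  · filter_upwards [ae_restrict_mem measurableSet_Ioo] with r hr y _
    exact hasFDerivAt_heat (hg.continuous_slice (hmem r hr).1) (fun y => hC y _ (hmem r hr))
      (mul_pos ht (by linarith [hr.2])) y

theorem hasFDerivAt_duh_of_hasFDerivAt {g : Space → ℝ → E} {g' : Space → ℝ → Space →L[ℝ] E}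
    (hg : Admissible g) (hg' : Admissible g')
    (hd : ∀ x, ∀ t, 0 < t → HasFDerivAt (fun y => g y t) (g' x t) x) (x : Space) {t : ℝ}
    (ht : 0 ≤ t) : HasFDerivAt (fun y => duh g y t) (duh g' x t) x := by
  rcases ht.eq_or_lt with rfl | ht
  · simp only [duh, intervalIntegral.integral_same]
    exact hasFDerivAt_const _ _
  obtain ⟨C, hC⟩ := hg.bounded t
  obtain ⟨C', hC'⟩ := hg'.bounded t
  have e1 : (fun y => duh g y t) = fun y =>
      t • ∫ r in Ioo (0 : ℝ) 1, heat (t * (1 - r)) (fun y => g y (t * r)) y := by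
    ext y
    exact duh_eq_smul_integral g y t
  have hmem : ∀ r ∈ Ioo (0 : ℝ) 1, t * r ∈ Ioc 0 t := fun r hr =>
    ⟨mul_pos ht hr.1, by nlinarith [hr.2]⟩
  rw [e1, duh_eq_smul_integral g' x t]
  refine HasFDerivAt.fun_const_smul ?_ t
  refine hasFDerivAt_integral_of_dominated_of_fderiv_le (F' := fun y r =>
      heat (t * (1 - r)) (fun y => g' y (t * r)) y) (bound := fun _ => C') univ_mem ?_ ?_ ?_ ?_ ?_ ?_
  · exact Eventually.of_forall fun y =>
      (continuousOn_duh_integrand hg y ht).aestronglyMeasurable measurableSet_Ioo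
  · exact integrableOn_duh_integrand hg x ht
  · exact (continuousOn_duh_integrand hg' x ht).aestronglyMeasurable measurableSet_Ioo
  · filter_upwards [ae_restrict_mem measurableSet_Ioo] with r hr y _
    exact norm_heat_le (fun y => hC' y _ (hmem r hr)) _ _
  · exact integrableOn_const (by simp)
  · filter_upwards [ae_restrict_mem measurableSet_Ioo] with r hr y _
    exact hasFDerivAt_heat_of_hasFDerivAt (fun y => hd y _ (hmem r hr).1)
      (hg'.continuous_slice (hmem r hr).1) (fun y => hC y _ (hmem r hr))
      (fun y => hC' y _ (hmem r hr)) _ y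

/-! ### The semigroup property -/

/-- Averaging twice is averaging once against the convolution of the two Gaussian laws, which
`gauss_conv` identifies. -/
theorem heat_heat {f : Space → E} (hf : StronglyMeasurable f) {B : ℝ} (hB : ∀ y, ‖f y‖ ≤ B)
    {s t : ℝ} (hs : 0 ≤ s) (ht : 0 ≤ t) (x : Space) :
    heat s (heat t f) x = heat (s + t) f x := by
  have hp : ∀ r : ℝ, IsProbabilityMeasure (gauss.map (r • · : Space → Space)) := fun r =>
    Measure.isProbabilityMeasure_map (by fun_prop)
  have h1 : ∀ r : ℝ, ∀ y, heat r f y = ∫ z, f (y - z) ∂(gauss.map (√r • ·)) := by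
    intro r y
    rw [integral_map (by fun_prop)]
    · rfl
    · exact (hf.comp_measurable (by fun_prop)).aestronglyMeasurable
  have hm : ∀ y, StronglyMeasurable fun z => f (y - z) := fun y => hf.comp_measurable (by fun_prop)
  rw [h1, ← gauss_conv hs ht, integral_conv]
  · rw [integral_map (by fun_prop)]
    · simp only [heat, sub_add_eq_sub_sub]
      congr 1
      ext w
      rw [integral_map (by fun_prop)]
      exact (hm _).aestronglyMeasurable
    · refine StronglyMeasurable.aestronglyMeasurable ?_
      refine StronglyMeasurable.integral_prod_right (f := fun w w' : Space => f (x - (w + w'))) ?_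
      exact hf.comp_measurable (by fun_prop)
  · exact Integrable.of_bound (hm x).aestronglyMeasurable B (Eventually.of_forall fun z => hB _)

theorem integrable_heat_prod {g : Space → ℝ → E} (hg : Admissible g) (x : Space) (T τ t : ℝ) :
    Integrable (fun p : ℝ × Space => heat (T - p.1) (fun y => g y p.1) (x - √t • p.2))
      ((volume.restrict (Ioc 0 τ)).prod gauss) := by
  obtain ⟨C, hC⟩ := hg.bounded τ
  refine Integrable.of_bound (C := C) ?_ ?_
  · have h1 : ContinuousOn
        (fun p : ℝ × Space => heat (T - p.1) (fun y => g y p.1) (x - √t • p.2))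
        (Ioc 0 τ ×ˢ univ) := by
      intro p hp
      exact (ContinuousAt.comp
        (g := fun p : Space × ℝ × ℝ => heat p.2.1 (fun y => g y p.2.2) p.1)
        (f := fun p : ℝ × Space => (x - √t • p.2, T - p.1, p.1))
        (continuousAt_heat hg _ _ hp.1.1) (by fun_prop)).continuousWithinAt
    have h2 := h1.aestronglyMeasurable (μ := volume.prod gauss)
      (measurableSet_Ioc.prod MeasurableSet.univ)
    rwa [← Measure.prod_restrict, Measure.restrict_univ] at h2
  · have h3 : ∀ᵐ p ∂((volume.restrict (Ioc 0 τ)).prod gauss), p.1 ∈ Ioc 0 τ :=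
      Measure.quasiMeasurePreserving_fst.ae (ae_restrict_mem measurableSet_Ioc)
    filter_upwards [h3] with p hp
    exact norm_heat_le (fun y => hC y _ hp) _ _

theorem intervalIntegrable_duh {g : Space → ℝ → E} (hg : Admissible g) (x : Space) {T a b : ℝ}
    (ha : 0 ≤ a) (hb : 0 ≤ b) :
    IntervalIntegrable (fun s => heat (T - s) (fun y => g y s) x) volume a b := by
  wlog hab : a ≤ b generalizing a b
  · exact (this hb ha (le_of_not_ge hab)).symm
  obtain ⟨C, hC⟩ := hg.bounded b
  rw [intervalIntegrable_iff_integrableOn_Ioc_of_le hab]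
  refine Integrable.of_bound (C := C) ?_ ?_
  · refine ContinuousOn.aestronglyMeasurable (fun s hs => ?_) measurableSet_Ioc
    exact (ContinuousAt.comp
      (g := fun p : Space × ℝ × ℝ => heat p.2.1 (fun y => g y p.2.2) p.1)
      (f := fun s : ℝ => (x, T - s, s))
      (continuousAt_heat hg _ _ (ha.trans_lt hs.1)) (by fun_prop)).continuousWithinAt
  · filter_upwards [ae_restrict_mem measurableSet_Ioc] with s hs
    exact norm_heat_le (fun y => hC y _ ⟨ha.trans_lt hs.1, hs.2⟩) _ _

/-- Split the time integral at `τ`. On `[0, τ]` the semigroup law factors out the remaining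
evolution by `t`, which Fubini moves outside the time integral. This is what allows mild solutions
to be restarted. -/
theorem duh_add {g : Space → ℝ → E} (hg : Admissible g) (x : Space) {τ t : ℝ} (hτ : 0 < τ)
    (ht : 0 ≤ t) :
    duh g x (τ + t) =
      heat t (fun y => duh g y τ) x + duh (fun y s => g y (τ + s)) x t := by
  rw [duh, ← intervalIntegral.integral_add_adjacent_intervals (b := τ)
    (intervalIntegrable_duh hg x le_rfl hτ.le) (intervalIntegrable_duh hg x hτ.le (by positivity))]
  congr 1
  · have e : heat t (fun y => duh g y τ) x = ∫ w, (∫ s in Ioc 0 τ,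
        heat (τ - s) (fun y => g y s) (x - √t • w)) ∂gauss := by
      simp only [duh, intervalIntegral.integral_of_le hτ.le]
      rfl
    rw [e, integral_integral_swap, intervalIntegral.integral_of_le hτ.le]
    · refine setIntegral_congr_fun measurableSet_Ioc fun s hs => ?_
      obtain ⟨C, hC⟩ := hg.bounded_slice hs.1
      have h := heat_heat (hg.continuous_slice hs.1).stronglyMeasurable hC ht
        (sub_nonneg.2 hs.2) x
      rw [show t + (τ - s) = τ + t - s by ring] at h
      exact h.symm
    · exact (integrable_heat_prod hg x τ τ t).swap
  · rw [duh]
    have := intervalIntegral.integral_comp_add_left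
      (fun s => heat (τ + t - s) (fun y => g y s) x) τ (a := 0) (b := t)
    rw [add_zero] at this
    rw [← this]
    simp only [add_sub_add_left_eq_sub]

theorem norm_duh_le {g : Space → ℝ → E} {t C : ℝ} (ht : 0 ≤ t)
    (hC : ∀ x, ∀ s ∈ Ioc 0 t, ‖g x s‖ ≤ C) (x : Space) : ‖duh g x t‖ ≤ C * t := by
  have h := intervalIntegral.norm_integral_le_of_norm_le_const (a := 0) (b := t) (C := C)
    (f := fun s => heat (t - s) (fun y => g y s) x) (fun s hs => by
      rw [uIoc_of_le ht] at hs
      exact norm_heat_le (fun y => hC y s hs) _ _)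
  simpa [duh, abs_of_nonneg ht] using h

end QTensor

namespace QTensor

/-! ### Towers of spatial derivatives -/

/-- A property of space-time functions with values in an arbitrary normed space. -/
abbrev FieldPred : Type 1 :=
  ∀ (F : Type) [NormedAddCommGroup F] [NormedSpace ℝ F], (Space → ℝ → F) → Prop

/-- For positive times the function has spatial derivatives up to order `k`, all of which have the
property `P`. -/
def Tower (P : FieldPred) : ℕ → FieldPred
  | 0 => fun F _ _ u => P F u
  | k + 1 => fun F _ _ u => P F u ∧ ∃ u' : Space → ℝ → Space →L[ℝ] F,
      (∀ x t, 0 < t → HasFDerivAt (fun y => u y t) (u' x t) x) ∧ Tower P k (Space →L[ℝ] F) u'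

/-- Properties that depend on positive times only and are stable under algebraic operations. -/
structure GoodPred (P : FieldPred) : Prop where
  congr : ∀ {F : Type} [NormedAddCommGroup F] [NormedSpace ℝ F] {u v : Space → ℝ → F},
    (∀ x t, 0 < t → u x t = v x t) → P F u → P F v
  add : ∀ {F : Type} [NormedAddCommGroup F] [NormedSpace ℝ F] {u v : Space → ℝ → F},
    P F u → P F v → P F fun x t => u x t + v x t
  clm : ∀ {F G : Type} [NormedAddCommGroup F] [NormedSpace ℝ F] [NormedAddCommGroup G]
    [NormedSpace ℝ G] (L : F →L[ℝ] G) {u : Space → ℝ → F}, P F u → P G fun x t => L (u x t)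
  bilin : ∀ {F₁ F₂ G : Type} [NormedAddCommGroup F₁] [NormedSpace ℝ F₁] [NormedAddCommGroup F₂]
    [NormedSpace ℝ F₂] [NormedAddCommGroup G] [NormedSpace ℝ G] (B : F₁ →L[ℝ] F₂ →L[ℝ] G)
    {u : Space → ℝ → F₁} {v : Space → ℝ → F₂}, P F₁ u → P F₂ v → P G fun x t => B (u x t) (v x t)

section

variable {P : FieldPred} {E F G : Type} [NormedAddCommGroup E] [NormedSpace ℝ E]
  [NormedAddCommGroup F] [NormedSpace ℝ F] [NormedAddCommGroup G] [NormedSpace ℝ G]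

theorem Tower.base : ∀ {k : ℕ} {u : Space → ℝ → E}, Tower P k E u → P E u
  | 0, _, h => h
  | _ + 1, _, h => h.1

theorem Tower.pred {k : ℕ} : ∀ {E : Type} [NormedAddCommGroup E] [NormedSpace ℝ E]
    {u : Space → ℝ → E}, Tower P (k + 1) E u → Tower P k E u := by
  induction k with
  | zero => exact fun h => h.1
  | succ k ih =>
    intro E _ _ u h
    obtain ⟨h0, u', hd, h1⟩ := h
    exact ⟨h0, u', hd, ih h1⟩

theorem Tower.mono {Q : FieldPred} (hPQ : ∀ {E : Type} [NormedAddCommGroup E] [NormedSpace ℝ E]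
    {u : Space → ℝ → E}, P E u → Q E u) {k : ℕ} : ∀ {E : Type} [NormedAddCommGroup E]
    [NormedSpace ℝ E] {u : Space → ℝ → E}, Tower P k E u → Tower Q k E u := by
  induction k with
  | zero => exact fun h => hPQ h
  | succ k ih =>
    intro E _ _ u h
    obtain ⟨h0, u', hd, h1⟩ := h
    exact ⟨hPQ h0, u', hd, ih h1⟩

theorem Tower.congr (hP : GoodPred P) {k : ℕ} {u v : Space → ℝ → E}
    (huv : ∀ x t, 0 < t → u x t = v x t) (h : Tower P k E u) : Tower P k E v := by
  cases k with
  | zero => exact hP.congr huv h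
  | succ k =>
    obtain ⟨h0, u', hd, h1⟩ := h
    refine ⟨hP.congr huv h0, u', fun x t ht => ?_, h1⟩
    have : (fun y => v y t) = fun y => u y t := funext fun y => (huv y t ht).symm
    rw [this]
    exact hd x t ht

theorem Tower.add (hP : GoodPred P) {k : ℕ} : ∀ {E : Type} [NormedAddCommGroup E]
    [NormedSpace ℝ E] {u v : Space → ℝ → E}, Tower P k E u → Tower P k E v →
    Tower P k E fun x t => u x t + v x t := by
  induction k with
  | zero => exact fun hu hv => hP.add hu hv
  | succ k ih =>
    intro E _ _ u v hu hv
    obtain ⟨hu0, u', hud, hu1⟩ := hu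
    obtain ⟨hv0, v', hvd, hv1⟩ := hv
    exact ⟨hP.add hu0 hv0, _, fun x t ht => (hud x t ht).add (hvd x t ht), ih hu1 hv1⟩

theorem Tower.clm (hP : GoodPred P) {k : ℕ} : ∀ {E F : Type} [NormedAddCommGroup E]
    [NormedSpace ℝ E] [NormedAddCommGroup F] [NormedSpace ℝ F] (L : E →L[ℝ] F)
    {u : Space → ℝ → E}, Tower P k E u → Tower P k F fun x t => L (u x t) := by
  induction k with
  | zero => exact fun L _ hu => hP.clm L hu
  | succ k ih =>
    intro E F _ _ _ _ L u hu
    obtain ⟨hu0, u', hud, hu1⟩ := hu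
    exact ⟨hP.clm L hu0, _, fun x t ht => L.hasFDerivAt.comp x (hud x t ht),
      ih (ContinuousLinearMap.compL ℝ Space E F L) hu1⟩

/-- The product rule gives two terms, each again bilinear in one factor and the derivative of the
other, so the induction must range over all target spaces and all bilinear maps. -/
theorem Tower.bilin (hP : GoodPred P) {k : ℕ} : ∀ {E F G : Type} [NormedAddCommGroup E]
    [NormedSpace ℝ E] [NormedAddCommGroup F] [NormedSpace ℝ F] [NormedAddCommGroup G]
    [NormedSpace ℝ G] (B : E →L[ℝ] F →L[ℝ] G) {u : Space → ℝ → E} {v : Space → ℝ → F},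
    Tower P k E u → Tower P k F v → Tower P k G fun x t => B (u x t) (v x t) := by
  induction k with
  | zero => exact fun B _ _ hu hv => hP.bilin B hu hv
  | succ k ih =>
    intro E F G _ _ _ _ _ _ B u v hu hv
    have hu2 := hu.pred
    have hv2 := hv.pred
    obtain ⟨hu0, u', hud, hu1⟩ := hu
    obtain ⟨hv0, v', hvd, hv1⟩ := hv
    exact ⟨hP.bilin B hu0 hv0, _, fun x t ht => B.hasFDerivAt_of_bilinear (hud x t ht) (hvd x t ht),
      Tower.add hP (ih (B.precompR Space) hu2 hv1) (ih (B.precompL Space) hu1 hv2)⟩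

theorem Tower.time_smul {α : ℝ → ℝ} (hα : ∀ {E : Type} [NormedAddCommGroup E] [NormedSpace ℝ E]
    {u : Space → ℝ → E}, P E u → P E fun x t => α t • u x t) {k : ℕ} :
    ∀ {E : Type} [NormedAddCommGroup E] [NormedSpace ℝ E]
    {u : Space → ℝ → E}, Tower P k E u → Tower P k E fun x t => α t • u x t := by
  induction k with
  | zero => exact fun h => hα h
  | succ k ih =>
    intro E _ _ u hu
    obtain ⟨hu0, u', hud, hu1⟩ := hu
    exact ⟨hα hu0, _, fun x t ht => (hud x t ht).fun_const_smul (α t), ih hu1⟩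

/-- The spatial derivative of a space-time function. -/
def spaceDeriv (u : Space → ℝ → E) (x : Space) (t : ℝ) : Space →L[ℝ] E :=
  fderiv ℝ (fun y => u y t) x

theorem Tower.hasFDerivAt {k : ℕ} {u : Space → ℝ → E} (h : Tower P (k + 1) E u) (x : Space)
    {t : ℝ} (ht : 0 < t) : HasFDerivAt (fun y => u y t) (spaceDeriv u x t) x := by
  obtain ⟨-, u', hd, -⟩ := h
  exact (hd x t ht).differentiableAt.hasFDerivAt

theorem Tower.spaceDeriv (hP : GoodPred P) {k : ℕ} {u : Space → ℝ → E}
    (h : Tower P (k + 1) E u) : Tower P k (Space →L[ℝ] E) (spaceDeriv u) := by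
  obtain ⟨-, u', hd, h1⟩ := h
  exact h1.congr hP fun x t ht => (hd x t ht).fderiv.symm

theorem Tower.succ_of_spaceDeriv {k : ℕ} {u : Space → ℝ → E} (h0 : P E u)
    (hd : ∀ x t, 0 < t → HasFDerivAt (fun y => u y t) (QTensor.spaceDeriv u x t) x)
    (h : Tower P k (Space →L[ℝ] E) (QTensor.spaceDeriv u)) : Tower P (k + 1) E u :=
  ⟨h0, _, hd, h⟩

/-- The reaction term `α B(u, u) - β S(u, u) u` with time-dependent coefficients. -/
def reaction (α β : ℝ → ℝ) (B : E →L[ℝ] E →L[ℝ] E) (S : E →L[ℝ] E →L[ℝ] ℝ) (t : ℝ) (u : E) : E :=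
  α t • B u u - β t • S u u • u

theorem Tower.reaction (hP : GoodPred P) {α β : ℝ → ℝ} {k : ℕ}
    (hα : ∀ {E : Type} [NormedAddCommGroup E] [NormedSpace ℝ E]
      {u : Space → ℝ → E}, P E u → P E fun x t => α t • u x t)
    (hβ : ∀ {E : Type} [NormedAddCommGroup E] [NormedSpace ℝ E]
      {u : Space → ℝ → E}, P E u → P E fun x t => β t • u x t)
    (B : E →L[ℝ] E →L[ℝ] E) (S : E →L[ℝ] E →L[ℝ] ℝ) {u : Space → ℝ → E} (hu : Tower P k E u) :
    Tower P k E fun x t => reaction α β B S t (u x t) := by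
  have h1 := (Tower.bilin hP B hu hu).time_smul hα
  have h2 := (Tower.bilin hP (ContinuousLinearMap.lsmul ℝ ℝ : ℝ →L[ℝ] E →L[ℝ] E)
    (Tower.bilin hP S hu hu) hu).time_smul hβ
  have h3 := Tower.clm hP (-ContinuousLinearMap.id ℝ E) h2
  refine (Tower.add hP h1 h3).congr hP fun x t _ => ?_
  simp [QTensor.reaction, sub_eq_add_neg]

end

/-! ### Towers of bounded continuous functions -/

/-- `Admissible` as a property of space-time functions. -/
def AdmPred : FieldPred := fun _ _ _ u => Admissible u

theorem goodPred_adm : GoodPred AdmPred where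
  congr := by
    intro F _ _ u v huv hu
    refine ⟨hu.continuousOn.congr fun p hp => (huv _ _ hp.2).symm, fun T => ?_⟩
    obtain ⟨C, hC⟩ := hu.bounded T
    exact ⟨C, fun x t ht => by rw [← huv x t ht.1]; exact hC x t ht⟩
  add := by
    intro F _ _ u v hu hv
    refine ⟨hu.continuousOn.add hv.continuousOn, fun T => ?_⟩
    obtain ⟨C, hC⟩ := hu.bounded T
    obtain ⟨C', hC'⟩ := hv.bounded T
    exact ⟨C + C', fun x t ht => norm_add_le_of_le (hC x t ht) (hC' x t ht)⟩
  clm := by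
    intro F G _ _ _ _ L u hu
    refine ⟨L.continuous.comp_continuousOn hu.continuousOn, fun T => ?_⟩
    obtain ⟨C, hC⟩ := hu.bounded T
    exact ⟨‖L‖ * C, fun x t ht => L.le_opNorm_of_le (hC x t ht)⟩
  bilin := by
    intro F₁ F₂ G _ _ _ _ _ _ B u v hu hv
    refine ⟨(B.continuous.comp_continuousOn hu.continuousOn).clm_apply hv.continuousOn,
      fun T => ?_⟩
    obtain ⟨C, hC⟩ := hu.bounded T
    obtain ⟨C', hC'⟩ := hv.bounded T
    exact ⟨‖B‖ * C * C', fun x t ht => B.le_of_opNorm₂_le_of_le le_rfl (hC x t ht) (hC' x t ht)⟩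

theorem adm_time_smul {α : ℝ → ℝ} (hα : Continuous α) {E : Type} [NormedAddCommGroup E]
    [NormedSpace ℝ E] {u : Space → ℝ → E} (hu : AdmPred E u) :
    AdmPred E fun x t => α t • u x t := by
  refine ⟨(hα.comp continuous_snd).continuousOn.smul hu.continuousOn, fun T => ?_⟩
  obtain ⟨C, hC⟩ := hu.bounded T
  obtain ⟨C', hC'⟩ := (isCompact_Icc (a := 0) (b := T)).exists_bound_of_continuousOn hα.continuousOn
  refine ⟨C' * C, fun x t ht => ?_⟩
  rw [norm_smul]
  exact mul_le_mul (hC' t ⟨ht.1.le, ht.2⟩) (hC x t ht) (norm_nonneg _)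
    ((norm_nonneg _).trans (hC' t ⟨ht.1.le, ht.2⟩))

theorem Admissible.comp_time {E : Type} [NormedAddCommGroup E] [NormedSpace ℝ E]
    {u : Space → ℝ → E} (hu : Admissible u) {θ : ℝ → ℝ} (hθ : Continuous θ)
    (hθ0 : ∀ t, 0 < t → 0 < θ t) : Admissible fun x t => u x (θ t) := by
  refine ⟨hu.continuousOn.comp (f := fun p : Space × ℝ => (p.1, θ p.2)) (by fun_prop)
    fun p hp => ⟨mem_univ _, hθ0 _ hp.2⟩, fun T => ?_⟩
  obtain ⟨M, hM⟩ := (isCompact_Icc (a := 0) (b := T)).exists_bound_of_continuousOn hθ.continuousOn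
  obtain ⟨C, hC⟩ := hu.bounded M
  exact ⟨C, fun x t ht => hC x _ ⟨hθ0 t ht.1, (le_abs_self _).trans (hM t ⟨ht.1.le, ht.2⟩)⟩⟩

theorem Tower.comp_time {θ : ℝ → ℝ} (hθ : Continuous θ) (hθ0 : ∀ t, 0 < t → 0 < θ t) {k : ℕ} :
    ∀ {E : Type} [NormedAddCommGroup E] [NormedSpace ℝ E] {u : Space → ℝ → E},
    Tower AdmPred k E u → Tower AdmPred k E fun x t => u x (θ t) := by
  induction k with
  | zero => exact fun h => Admissible.comp_time h hθ hθ0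
  | succ k ih =>
    intro E _ _ u hu
    obtain ⟨hu0, u', hud, hu1⟩ := hu
    exact ⟨Admissible.comp_time hu0 hθ hθ0, _, fun x t ht => hud x _ (hθ0 t ht), ih hu1⟩

/-! ### Derivatives gained by the heat semigroup and by the Duhamel integral -/

section

variable {E : Type} [NormedAddCommGroup E] [NormedSpace ℝ E]

theorem admissible_heat {f : Space → E} (hf : Continuous f) {B : ℝ} (hB : ∀ y, ‖f y‖ ≤ B)
    (t₁ : ℝ) : Admissible fun x t => heat (t₁ + t) f x :=
  ⟨((continuous_heat hf hB).comp (by fun_prop : Continuous fun p : Space × ℝ =>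
    (p.1, t₁ + p.2))).continuousOn, fun _ => ⟨B, fun x _ _ => norm_heat_le hB _ x⟩⟩

theorem admissible_heatGrad {f : Space → E} (hf : Continuous f) {B : ℝ} (hB : ∀ y, ‖f y‖ ≤ B)
    {t₁ : ℝ} (ht₁ : 0 < t₁) : Admissible fun x t => heatGrad (t₁ + t) f x := by
  refine ⟨?_, fun T => ⟨(√t₁)⁻¹ *
    (B * ∫ w, ‖(gradKernel w : E →L[ℝ] (Space →L[ℝ] E))‖ ∂gauss), fun x t ht => ?_⟩⟩
  · have h1 : ContinuousOn (fun p : Space × ℝ => (√(t₁ + p.2))⁻¹) (univ ×ˢ Ioi 0) := by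
      refine ContinuousOn.inv₀ (by fun_prop) fun p hp => ?_
      have : 0 < p.2 := hp.2
      positivity
    refine h1.smul ?_
    · exact ((continuous_gaussAvg continuous_gradKernel integrable_gradKernel hf hB).comp
        (by fun_prop : Continuous fun p : Space × ℝ => (p.1, t₁ + p.2))).continuousOn
  · have hB0 : 0 ≤ B := (norm_nonneg _).trans (hB 0)
    refine (norm_heatGrad_le hB _ x).trans ?_
    gcongr
    linarith [ht.1]

/-- All available derivatives fall on the datum and one more falls on the kernel, whose age is at
least `t₁`; the singular factor is therefore bounded by `(√t₁)⁻¹`. -/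
theorem tower_heat {t₁ : ℝ} (ht₁ : 0 < t₁) {k : ℕ} : ∀ {E : Type} [NormedAddCommGroup E]
    [NormedSpace ℝ E] {f : Space → E}, Tower AdmPred k E (fun x _ => f x) →
    Tower AdmPred (k + 1) E fun x t => heat (t₁ + t) f x := by
  induction k with
  | zero =>
    intro E _ _ f hf
    have hf0 : Admissible fun x (_ : ℝ) => f x := hf
    obtain ⟨B, hB⟩ := hf0.bounded_slice one_pos
    have hfc := hf0.continuous_slice one_pos
    exact ⟨admissible_heat hfc hB t₁, _, fun x t ht => hasFDerivAt_heat hfc hB (by positivity) x,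
      admissible_heatGrad hfc hB ht₁⟩
  | succ k ih =>
    intro E _ _ f hf
    have hf0 : Admissible fun x (_ : ℝ) => f x := hf.base
    obtain ⟨B, hB⟩ := hf0.bounded_slice one_pos
    have hfc := hf0.continuous_slice one_pos
    obtain ⟨-, u', hd, h1⟩ := hf
    have hu' : Admissible u' := h1.base
    obtain ⟨B', hB'⟩ := hu'.bounded_slice one_pos
    exact ⟨admissible_heat hfc hB t₁, _, fun x t ht =>
      hasFDerivAt_heat_of_hasFDerivAt (fun y => hd y 1 one_pos) (hu'.continuous_slice one_pos)
        hB hB' (t₁ + t) x, ih (h1.comp_time (θ := fun _ => 1) continuous_const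
          fun _ _ => one_pos)⟩

theorem admissible_duh {g : Space → ℝ → E} (hg : Admissible g) : Admissible (duh g) := by
  refine ⟨(continuous_duh hg).continuousOn.congr fun p hp => ?_, fun T => ?_⟩
  · have : 0 < p.2 := hp.2
    simp only [max_eq_left this.le]
  · obtain ⟨C, hC⟩ := hg.bounded T
    refine ⟨C * T, fun x t ht => ?_⟩
    have hC0 : 0 ≤ C := (norm_nonneg _).trans (hC x t ht)
    refine (norm_duh_le ht.1.le (fun y s hs => hC y s ⟨hs.1, hs.2.trans ht.2⟩) x).trans ?_
    gcongr
    exact ht.2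

/-- As for the heat semigroup, the last derivative goes on the kernel, where its singularity is
integrable in time. This gain of one order drives the bootstrap. -/
theorem tower_duh {k : ℕ} : ∀ {E : Type} [NormedAddCommGroup E]
    [NormedSpace ℝ E] {g : Space → ℝ → E}, Tower AdmPred k E g →
    Tower AdmPred (k + 1) E (duh g) := by
  induction k with
  | zero =>
    intro E _ _ g hg
    refine ⟨admissible_duh hg, _, fun x t ht => hasFDerivAt_duh hg x ht.le,
      (continuous_duhGrad hg).continuousOn, fun T => ?_⟩
    obtain ⟨C, hC⟩ := duhGrad_bounded hg T
    exact ⟨C, fun x t ht => hC x t ht.2⟩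
  | succ k ih =>
    intro E _ _ g hg
    have hg0 : Admissible g := hg.base
    obtain ⟨-, g', hd, h1⟩ := hg
    exact ⟨admissible_duh hg0, _, fun x t ht => hasFDerivAt_duh_of_hasFDerivAt hg0 h1.base
      hd x ht.le, ih h1⟩

/-! ### Smoothness of mild solutions -/

/-- Mild solutions of `∂u/∂t = Δu + N(t, u)` with bounded measurable initial datum `f`. -/
structure IsMild (N : ℝ → E → E) (f : Space → E) (u : Space → ℝ → E) : Prop where
  measurable : StronglyMeasurable f
  bounded : ∃ B, ∀ y, ‖f y‖ ≤ B
  admissible : Admissible u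
  admissible_reaction : Admissible fun x t => N t (u x t)
  eq : ∀ x t, 0 < t → u x t = heat t f x + duh (fun y s => N s (u y s)) x t

theorem heat_add {f g : Space → E} (hf : StronglyMeasurable f) (hg : StronglyMeasurable g)
    {B C : ℝ} (hB : ∀ y, ‖f y‖ ≤ B) (hC : ∀ y, ‖g y‖ ≤ C) (t : ℝ) (x : Space) :
    heat t (fun y => f y + g y) x = heat t f x + heat t g x :=
  integral_add
    (Integrable.of_bound (hf.comp_measurable (by fun_prop)).aestronglyMeasurable B
      (Eventually.of_forall fun _ => hB _))
    (Integrable.of_bound (hg.comp_measurable (by fun_prop)).aestronglyMeasurable C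
      (Eventually.of_forall fun _ => hC _))

theorem stronglyMeasurable_heat {f : Space → E} (hf : StronglyMeasurable f) (t : ℝ) :
    StronglyMeasurable (heat t f) :=
  StronglyMeasurable.integral_prod_right (f := fun x w : Space => f (x - √t • w))
    (hf.comp_measurable (by fun_prop))

variable {N : ℝ → E → E} {f : Space → E} {u : Space → ℝ → E}

theorem IsMild.restart (h : IsMild N f u) (x : Space) {τ t : ℝ} (hτ : 0 < τ) (ht : 0 ≤ t) :
    u x (τ + t) = heat t (fun y => u y τ) x +
      duh (fun y s => N (τ + s) (u y (τ + s))) x t := by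
  obtain ⟨B, hB⟩ := h.bounded
  have hd := admissible_duh h.admissible_reaction
  obtain ⟨C, hC⟩ := hd.bounded_slice hτ
  rw [h.eq x (τ + t) (by positivity), duh_add h.admissible_reaction x hτ ht]
  simp_rw [h.eq _ τ hτ]
  rw [heat_add (stronglyMeasurable_heat h.measurable τ)
    (hd.continuous_slice hτ).stronglyMeasurable (norm_heat_le hB τ) hC,
    heat_heat h.measurable hB ht hτ.le, add_comm t τ, add_assoc]

/-- Bootstrap: `k` derivatives of `u` give `k` derivatives of the reaction term, and the restarted
Duhamel formula gains one more. The shift by `τ > 0` is needed because `Admissible` demands bounds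
down to time `0`, where derivatives of `u` may blow up. -/
theorem IsMild.tower (h : IsMild N f u)
    (hN : ∀ (k : ℕ) (τ : ℝ), 0 < τ → Tower AdmPred k E (fun x t => u x (τ + t)) →
      Tower AdmPred k E fun x t => N (τ + t) (u x (τ + t))) (k : ℕ) :
    ∀ τ, 0 < τ → Tower AdmPred k E fun x t => u x (τ + t) := by
  induction k with
  | zero =>
    intro τ hτ
    exact h.admissible.comp_time (by fun_prop) fun t ht => by positivity
  | succ k ih =>
    intro τ hτ
    have hτ2 : 0 < τ / 2 := by positivity
    have h1 : Tower AdmPred k E fun x t => u x (τ / 2 + t) := ih _ hτ2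
    have h3 := tower_duh (hN k _ hτ2 h1)
    -- The datum at the restart time `τ/2 = τ/4 + τ/4` is viewed as a field constant in time: the
    -- shift by `τ/4` frozen at the positive time `τ/4`.
    have h4 := tower_heat hτ2 ((ih (τ / 4) (by positivity)).comp_time (θ := fun _ => τ / 4)
      continuous_const fun _ _ => by positivity)
    have h5 := h3.comp_time (θ := fun t => τ / 2 + t) (by fun_prop) fun t ht => by positivity
    refine (Tower.add goodPred_adm h4 h5).congr goodPred_adm fun x t ht => ?_
    have h6 := h.restart x hτ2 (t := τ / 2 + t) (by positivity)
    rw [show τ / 2 + (τ / 2 + t) = τ + t by ring] at h6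
    rw [h6, show τ / 4 + τ / 4 = τ / 2 by ring]

end

end QTensor

namespace QTensor

variable {E : Type} [NormedAddCommGroup E] [NormedSpace ℝ E]

/-! ### The time derivative of mild solutions -/

/-- The trace of a bilinear map on `Space`; on a Hessian it is the Laplacian. -/
def traceHess : (Space →L[ℝ] Space →L[ℝ] E) →L[ℝ] E :=
  ∑ i : Fin 3, (ContinuousLinearMap.apply ℝ E (EuclideanSpace.single i (1 : ℝ))).comp
    (ContinuousLinearMap.apply ℝ (Space →L[ℝ] E) (EuclideanSpace.single i (1 : ℝ)))

theorem traceHess_apply (M : Space →L[ℝ] Space →L[ℝ] E) :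
    traceHess M = ∑ i : Fin 3, M (EuclideanSpace.single i 1) (EuclideanSpace.single i 1) := by
  simp [traceHess]

/-- Links the two derivatives of the semigroup: the time derivative of `q(x - √t w)` produces `q'`
applied to `w`, which is the trace of the gradient kernel acting on `q'`. -/
theorem traceHess_gradKernel (w : Space) (M : Space →L[ℝ] E) :
    traceHess (gradKernel w M) = (-(1 / 2) : ℝ) • M w := by
  have hw : w = ∑ i : Fin 3, w i • (EuclideanSpace.single i (1 : ℝ) : Space) := by
    ext j
    simp [Pi.single_apply]
  have hM : M w = ∑ i : Fin 3, w i • M (EuclideanSpace.single i (1 : ℝ)) := by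
    conv_lhs => rw [hw]
    simp
  rw [traceHess_apply, hM, Finset.smul_sum]
  refine Finset.sum_congr rfl fun i _ => ?_
  rw [gradKernel_apply]
  simp [smul_smul, EuclideanSpace.inner_single_right]

theorem clm_gaussAvg {F G : Type} [NormedAddCommGroup F] [NormedSpace ℝ F] [CompleteSpace F]
    [NormedAddCommGroup G] [NormedSpace ℝ G] [CompleteSpace G] (L : F →L[ℝ] G)
    {K : Space → E →L[ℝ] F} (hK : Continuous K) (hKi : Integrable (fun w => ‖K w‖) gauss)
    {f : Space → E} (hf : Continuous f) {B : ℝ} (hB : ∀ y, ‖f y‖ ≤ B) (t : ℝ) (x : Space) :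
    L (gaussAvg K t f x) = ∫ w, L (K w (f (x - √t • w))) ∂gauss := by
  refine (ContinuousLinearMap.integral_comp_comm L ?_).symm
  refine (hKi.mul_const B).mono' ?_ (Eventually.of_forall fun w => ?_)
  · exact (hK.clm_apply (hf.comp (by fun_prop))).aestronglyMeasurable
  · exact (K w).le_opNorm_of_le (hB _)

theorem clm_heat {F G : Type} [NormedAddCommGroup F] [NormedSpace ℝ F] [CompleteSpace F]
    [NormedAddCommGroup G] [NormedSpace ℝ G] [CompleteSpace G] (L : F →L[ℝ] G)
    {f : Space → F} (hf : Continuous f) {B : ℝ} (hB : ∀ y, ‖f y‖ ≤ B) (t : ℝ) (x : Space) :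
    L (heat t f x) = heat t (fun y => L (f y)) x :=
  clm_gaussAvg L (K := fun _ => ContinuousLinearMap.id ℝ F) continuous_const
    (integrable_const _) hf hB t x

/-- Differentiating `q(x - √h w)` in `h` gives the average of `-(2√h)⁻¹ q'(x - √h w) w`. By
`traceHess_gradKernel` this is the trace of the gradient of `e^{hΔ} q'`, and `heatGrad_eq_heat`
moves the derivative onto `q'`. -/
theorem hasDerivAt_heat_time [CompleteSpace E] {q : Space → E} {q' : Space → Space →L[ℝ] E}
    {q'' : Space → Space →L[ℝ] Space →L[ℝ] E} (hq : ∀ y, HasFDerivAt q (q' y) y)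
    (hq' : ∀ y, HasFDerivAt q' (q'' y) y) (hq'' : Continuous q'') {B B' B'' : ℝ}
    (hB : ∀ y, ‖q y‖ ≤ B) (hB' : ∀ y, ‖q' y‖ ≤ B') (hB'' : ∀ y, ‖q'' y‖ ≤ B'') (x : Space)
    {h : ℝ} (hh : 0 < h) :
    HasDerivAt (fun h => heat h q x) (heat h (fun y => traceHess (q'' y)) x) h := by
  have hqc : Continuous q := continuous_iff_continuousAt.2 fun y => (hq y).continuousAt
  have hqc' : Continuous q' := continuous_iff_continuousAt.2 fun y => (hq' y).continuousAt
  have hB0 : 0 ≤ B' := (norm_nonneg _).trans (hB' 0)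
  have hval : heat h (fun y => traceHess (q'' y)) x =
      ∫ w, q' (x - √h • w) (-(1 / (2 * √h)) • w) ∂gauss := by
    rw [← clm_heat traceHess hq'' hB'' h x, ← heatGrad_eq_heat hq' hq'' hB' hB'' hh x, heatGrad,
      map_smul, clm_gaussAvg traceHess continuous_gradKernel integrable_gradKernel hqc' hB',
      ← integral_smul]
    congr 1
    ext w
    rw [traceHess_gradKernel, map_smul, smul_smul]
    congr 1
    field_simp
  rw [hval]
  have hnhds : Ioi (h / 2) ∈ 𝓝 h := Ioi_mem_nhds (by linarith)
  refine (hasDerivAt_integral_of_dominated_loc_of_deriv_le (F := fun h w => q (x - √h • w))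
    (F' := fun h w => q' (x - √h • w) (-(1 / (2 * √h)) • w))
    (bound := fun w => B' * (1 / (2 * √(h / 2)) * ‖w‖)) hnhds ?_ ?_ ?_ ?_ ?_ ?_).2
  · exact Eventually.of_forall fun s => (hqc.comp (by fun_prop)).aestronglyMeasurable
  · exact Integrable.of_bound (hqc.comp (by fun_prop)).aestronglyMeasurable B
      (Eventually.of_forall fun w => hB _)
  · exact ((hqc'.comp (by fun_prop)).clm_apply (by fun_prop)).aestronglyMeasurable
  · refine Eventually.of_forall fun w s hs => ?_
    have hs' : h / 2 < s := hs
    refine (q' _).le_of_opNorm_le_of_le (hB' _) ?_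
    rw [norm_smul, norm_neg, Real.norm_of_nonneg (by positivity)]
    gcongr
  · exact (integrable_norm_gauss.const_mul _).const_mul _
  · refine Eventually.of_forall fun w s hs => ?_
    have hs' : 0 < s := lt_trans (by positivity) (show h / 2 < s from hs)
    have h1 : HasDerivAt (fun s => x - √s • w) (-(1 / (2 * √s)) • w) s := by
      simpa using ((Real.hasDerivAt_sqrt hs'.ne').smul_const w).const_sub x
    exact (hq (x - √s • w)).comp_hasDerivAt s h1

/-- Since `√h` is not differentiable at `0`, the one-sided derivative is found as the limit of the
derivatives at `h > 0`. -/
theorem hasDerivWithinAt_heat_zero [CompleteSpace E] {q : Space → E} {q' : Space → Space →L[ℝ] E}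
    {q'' : Space → Space →L[ℝ] Space →L[ℝ] E} (hq : ∀ y, HasFDerivAt q (q' y) y)
    (hq' : ∀ y, HasFDerivAt q' (q'' y) y) (hq'' : Continuous q'') {B B' B'' : ℝ}
    (hB : ∀ y, ‖q y‖ ≤ B) (hB' : ∀ y, ‖q' y‖ ≤ B') (hB'' : ∀ y, ‖q'' y‖ ≤ B'') (x : Space) :
    HasDerivWithinAt (fun h => heat h q x) (traceHess (q'' x)) (Ici 0) 0 := by
  have hqc : Continuous q := continuous_iff_continuousAt.2 fun y => (hq y).continuousAt
  have hd : ∀ h : ℝ, 0 < h →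
      HasDerivAt (fun h => heat h q x) (heat h (fun y => traceHess (q'' y)) x) h :=
    fun h hh => hasDerivAt_heat_time hq hq' hq'' hB hB' hB'' x hh
  refine hasDerivWithinAt_Ici_of_tendsto_deriv (s := Ioi 0)
    (fun h hh => (hd h hh).differentiableAt.differentiableWithinAt) ?_ self_mem_nhdsWithin ?_
  · exact ((continuous_heat hqc hB).comp
      (by fun_prop : Continuous fun h : ℝ => (x, h))).continuousWithinAt
  · have h1 : Continuous fun h : ℝ => heat h (fun y => traceHess (q'' y)) x :=
      (continuous_heat (traceHess.continuous.comp hq'') (B := ‖traceHess (E := E)‖ * B'')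
        fun y => traceHess.le_opNorm_of_le (hB'' y)).comp
        (by fun_prop : Continuous fun h : ℝ => (x, h))
    have h2 := (h1.tendsto 0).mono_left (nhdsWithin_le_nhds (s := Ioi 0))
    rw [heat_zero] at h2
    refine h2.congr' ?_
    filter_upwards [self_mem_nhdsWithin] with h hh
    exact (hd h hh).deriv.symm

/-- On the unit interval the difference quotient is exactly the average over `r` of `e^{h(1-r)Δ} g(t
+ hr)`, which converges to `g(t)`. -/
theorem hasDerivWithinAt_duh_zero [CompleteSpace E] {g : Space → ℝ → E} (hg : Admissible g)
    (x : Space) {t : ℝ} (ht : 0 < t) :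
    HasDerivWithinAt (fun h => duh (fun y s => g y (t + s)) x h) (g x t) (Ici 0) 0 := by
  rw [← hasDerivWithinAt_Ioi_iff_Ici, hasDerivWithinAt_iff_tendsto_slope'
    (by simp : (0 : ℝ) ∉ Ioi (0 : ℝ))]
  obtain ⟨C, hC⟩ := hg.bounded (t + 1)
  have h1 : Tendsto (fun h : ℝ => ∫ r in Ioo (0 : ℝ) 1,
      heat (h * (1 - r)) (fun y => g y (t + h * r)) x) (𝓝[>] 0)
      (𝓝 (∫ _ in Ioo (0 : ℝ) 1, g x t)) := by
    have hg' : Admissible fun y s => g y (t + s) :=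
      hg.comp_time (θ := fun s => t + s) (by fun_prop) fun s hs => by positivity
    refine tendsto_integral_filter_of_dominated_convergence (fun _ => C) ?_ ?_
      (integrableOn_const (by simp)) ?_
    · filter_upwards [self_mem_nhdsWithin] with h hh
      exact (continuousOn_duh_integrand hg' x hh).aestronglyMeasurable measurableSet_Ioo
    · filter_upwards [self_mem_nhdsWithin,
        nhdsWithin_le_nhds (Iio_mem_nhds (one_pos : (0 : ℝ) < 1))] with h hh hh1
      filter_upwards [ae_restrict_mem measurableSet_Ioo] with r hr
      have h2 : 0 < h * r := mul_pos hh hr.1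
      have h3 : h * r < 1 := mul_lt_one_of_nonneg_of_lt_one_left (le_of_lt hh) hh1 hr.2.le
      exact norm_heat_le (fun y => hC y _ ⟨by positivity, by linarith⟩) _ _
    · filter_upwards [ae_restrict_mem measurableSet_Ioo] with r hr
      have h4 : ContinuousAt (fun h : ℝ => heat (h * (1 - r)) (fun y => g y (t + h * r)) x) 0 := by
        refine ContinuousAt.comp
          (g := fun p : Space × ℝ × ℝ => heat p.2.1 (fun y => g y p.2.2) p.1)
          (f := fun h : ℝ => (x, h * (1 - r), t + h * r)) ?_ (by fun_prop)
        exact continuousAt_heat hg x _ (by simpa using ht)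
      have h5 := h4.tendsto.mono_left (nhdsWithin_le_nhds (s := Ioi 0))
      simpa [heat_zero] using h5
  simp only [integral_const, MeasurableSet.univ, measureReal_restrict_apply, univ_inter,
    Real.volume_real_Ioo_of_le zero_le_one, sub_zero, one_smul] at h1
  refine h1.congr' ?_
  filter_upwards [self_mem_nhdsWithin] with h hh
  have hh0 : h ≠ 0 := (show 0 < h from hh).ne'
  rw [slope_def_module, duh_eq_smul_integral, duh_eq_smul_integral, zero_smul, sub_zero, sub_zero,
    smul_smul, inv_mul_cancel₀ hh0, one_smul]

/-! ### Joint smoothness -/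

/-- Joint continuity, or joint smoothness of order `n`, at positive times. -/
def SmoothPred (n : ℕ) : FieldPred := fun _ _ _ u =>
  ContDiffOn ℝ n (fun p : Space × ℝ => u p.1 p.2) (univ ×ˢ Ioi 0)

theorem goodPred_smooth (n : ℕ) : GoodPred (SmoothPred n) where
  congr := by
    intro F _ _ u v huv hu
    exact ContDiffOn.congr hu fun p hp => (huv _ _ hp.2).symm
  add := by
    intro F _ _ u v hu hv
    exact ContDiffOn.add hu hv
  clm := by
    intro F G _ _ _ _ L u hu
    exact L.contDiff.comp_contDiffOn hu
  bilin := by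
    intro F₁ F₂ G _ _ _ _ _ _ B u v hu hv
    exact (B.contDiff.comp_contDiffOn hu).clm_apply hv

theorem smooth_time_smul {n : ℕ} {α : ℝ → ℝ} (hα : ContDiff ℝ ∞ α) {E : Type}
    [NormedAddCommGroup E] [NormedSpace ℝ E] {u : Space → ℝ → E} (hu : SmoothPred n E u) :
    SmoothPred n E fun x t => α t • u x t :=
  (((hα.of_le (by exact_mod_cast le_top)).comp contDiff_snd).contDiffOn).smul hu

/-- Continuity at a positive time is local, so the shifted towers can be glued; the bounds near time
`0` are given up. -/
theorem tower_continuous_of_shift {k : ℕ} : ∀ {E : Type} [NormedAddCommGroup E]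
    [NormedSpace ℝ E] {u : Space → ℝ → E},
    (∀ τ, 0 < τ → Tower AdmPred k E fun x t => u x (τ + t)) → Tower (SmoothPred 0) k E u := by
  have base : ∀ {k : ℕ} {E : Type} [NormedAddCommGroup E] [NormedSpace ℝ E]
      {u : Space → ℝ → E}, (∀ τ, 0 < τ → Tower AdmPred k E fun x t => u x (τ + t)) →
      SmoothPred 0 E u := by
    intro k E _ _ u h
    refine contDiffOn_zero.2 fun p hp => ContinuousAt.continuousWithinAt ?_
    have hp2 : 0 < p.2 := hp.2
    have h1 : Admissible fun x t => u x (p.2 / 2 + t) := (h (p.2 / 2) (by positivity)).base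
    have h2 := h1.continuousAt p.1 (t := p.2 - p.2 / 2) (by linarith)
    have h3 := ContinuousAt.comp (g := fun q : Space × ℝ => u q.1 (p.2 / 2 + q.2))
      (f := fun q : Space × ℝ => (q.1, q.2 - p.2 / 2)) h2 (by fun_prop)
    simpa [Function.comp_def] using h3
  induction k with
  | zero => exact fun h => base h
  | succ k ih =>
    intro E _ _ u h
    refine Tower.succ_of_spaceDeriv (base h) (fun x t ht => ?_)
      (ih fun τ hτ => (h τ hτ).spaceDeriv goodPred_adm)
    have h1 := (h (t / 2) (by positivity)).hasFDerivAt x (t := t / 2) (by positivity)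
    simpa [spaceDeriv] using h1

/-- Time and space derivatives commute. -/
theorem hasDerivAt_spaceDeriv [CompleteSpace E] {u R : Space → ℝ → E}
    (hu : Tower (SmoothPred 0) 1 E u) (hR : Tower (SmoothPred 0) 1 E R)
    (hd : ∀ x t, 0 < t → HasDerivAt (fun s => u x s) (R x t) t) (x : Space) {t : ℝ}
    (ht : 0 < t) :
    HasDerivAt (fun s => spaceDeriv u x s) (spaceDeriv R x t) t := by
  have hRc : ContinuousOn (fun p : Space × ℝ => R p.1 p.2) (univ ×ˢ Ioi 0) :=
    contDiffOn_zero.1 hR.base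
  have hR'c : ContinuousOn (fun p : Space × ℝ => spaceDeriv R p.1 p.2) (univ ×ˢ Ioi 0) :=
    contDiffOn_zero.1 (hR.spaceDeriv (goodPred_smooth 0))
  have hslice : ∀ {G : Type} [NormedAddCommGroup G] {v : Space → ℝ → G} (y : Space),
      ContinuousOn (fun p : Space × ℝ => v p.1 p.2) (univ ×ˢ Ioi 0) →
      ContinuousOn (fun s => v y s) (Ioi 0) := fun y hv =>
    hv.comp (f := fun s => (y, s)) (by fun_prop) fun s hs => ⟨mem_univ _, hs⟩
  have hsub : ∀ {a b : ℝ}, 0 < a → 0 < b → uIcc a b ⊆ Ioi 0 := fun ha hb s hs =>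
    (lt_min ha hb).trans_le hs.1
  -- Integrate the time derivative from `t/2` to `s`, differentiate in space under the integral, and
  -- then differentiate the resulting identity in `s`.
  have hint : ∀ {s : ℝ}, 0 < s → spaceDeriv u x s =
      spaceDeriv u x (t / 2) + ∫ r in (t / 2)..s, spaceDeriv R x r := by
    intro s hs
    have ht2 : 0 < t / 2 := by positivity
    have e : (fun y => u y s) = fun y => u y (t / 2) + ∫ r in (t / 2)..s, R y r := by
      ext y
      rw [intervalIntegral.integral_eq_sub_of_hasDerivAt
        (fun r hr => hd y r (hsub ht2 hs hr))
        (((hslice y hRc).mono (hsub ht2 hs)).intervalIntegrable)]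
      abel
    have hK : IsCompact (Metric.closedBall x 1 ×ˢ uIcc (t / 2) s) :=
      (isCompact_closedBall x 1).prod isCompact_uIcc
    obtain ⟨C, hC⟩ := hK.exists_bound_of_continuousOn
      (hR'c.mono (prod_mono (subset_univ _) (hsub ht2 hs)))
    have h1 : HasFDerivAt (fun y => ∫ r in (t / 2)..s, R y r)
        (∫ r in (t / 2)..s, spaceDeriv R x r) x := by
      refine intervalIntegral.hasFDerivAt_integral_of_dominated_of_fderiv_le
        (F' := fun y r => spaceDeriv R y r) (bound := fun _ => C)
        (Metric.closedBall_mem_nhds x one_pos) ?_ ?_ ?_ ?_ ?_ ?_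
      · exact Eventually.of_forall fun y =>
          (((hslice y hRc).mono (uIoc_subset_uIcc.trans (hsub ht2 hs))).aestronglyMeasurable
            measurableSet_uIoc)
      · exact ((hslice x hRc).mono (hsub ht2 hs)).intervalIntegrable
      · exact (((hslice x hR'c).mono (uIoc_subset_uIcc.trans (hsub ht2 hs))).aestronglyMeasurable
            measurableSet_uIoc)
      · exact Eventually.of_forall fun r hr y hy => hC (y, r) ⟨hy, uIoc_subset_uIcc hr⟩
      · exact intervalIntegrable_const
      · exact Eventually.of_forall fun r hr y _ =>
          hR.hasFDerivAt y (hsub ht2 hs (uIoc_subset_uIcc hr))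
    have h2 := (hu.hasFDerivAt x ht2).add h1
    rw [spaceDeriv, e]
    exact h2.fderiv
  have h3 : HasDerivAt (fun s => spaceDeriv u x (t / 2) + ∫ r in (t / 2)..s, spaceDeriv R x r)
      (spaceDeriv R x t) t := by
    refine HasDerivAt.const_add _ ?_
    have hc : ContinuousOn (fun s => spaceDeriv R x s) (Ioi 0) := hslice x hR'c
    refine intervalIntegral.integral_hasDerivAt_right
      ((hc.mono (hsub (by positivity) ht)).intervalIntegrable)
      (hc.stronglyMeasurableAtFilter isOpen_Ioi t ht)
      (hc.continuousAt (Ioi_mem_nhds ht))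
  refine h3.congr_of_eventuallyEq ?_
  filter_upwards [Ioi_mem_nhds ht] with s hs
  exact hint hs

/-- The full differential of `u` consists of the spatial derivative and the time derivative `R`. If
both are jointly `C^n`, then `u` is `C^{n+1}`. The same applies to every spatial derivative of `u`,
because its time derivative is the corresponding spatial derivative of `R`. -/
theorem tower_smooth_succ {n k : ℕ} : ∀ {E : Type} [NormedAddCommGroup E]
    [NormedSpace ℝ E] [CompleteSpace E] {u R : Space → ℝ → E},
    (∀ j, Tower (SmoothPred n) j E u) → (∀ j, Tower (SmoothPred n) j E R) →
    (∀ x t, 0 < t → HasDerivAt (fun s => u x s) (R x t) t) →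
    Tower (SmoothPred (n + 1)) k E u := by
  have base : ∀ {E : Type} [NormedAddCommGroup E] [NormedSpace ℝ E]
      {u R : Space → ℝ → E}, (∀ j, Tower (SmoothPred n) j E u) →
      (∀ j, Tower (SmoothPred n) j E R) →
      (∀ x t, 0 < t → HasDerivAt (fun s => u x s) (R x t) t) → SmoothPred (n + 1) E u := by
    intro E _ _ u R hu hR hd
    have hu' : ContDiffOn ℝ n (fun p : Space × ℝ => spaceDeriv u p.1 p.2) (univ ×ˢ Ioi 0) :=
      (hu 1).spaceDeriv (goodPred_smooth n)
    have hR0 : ContDiffOn ℝ n (fun p : Space × ℝ => R p.1 p.2) (univ ×ˢ Ioi 0) := (hR 0).base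
    have hopen : IsOpen ((univ : Set Space) ×ˢ Ioi (0 : ℝ)) := isOpen_univ.prod isOpen_Ioi
    let R₁ : Space → ℝ → ℝ →L[ℝ] E := fun x t =>
      (ContinuousLinearMap.smulRightL ℝ ℝ E (1 : ℝ →L[ℝ] ℝ)) (R x t)
    have hR₁ : ContDiffOn ℝ n (fun p : Space × ℝ => R₁ p.1 p.2) (univ ×ˢ Ioi 0) :=
      (ContinuousLinearMap.smulRightL ℝ ℝ E (1 : ℝ →L[ℝ] ℝ)).contDiff.comp_contDiffOn hR0
    suffices h : ContDiffOn ℝ ((n : WithTop ℕ∞) + 1) (fun p : Space × ℝ => u p.1 p.2)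
        (univ ×ˢ Ioi 0) by
      unfold SmoothPred
      push_cast
      exact h
    refine (contDiffOn_succ_iff_hasFDerivWithinAt_of_uniqueDiffOn hopen.uniqueDiffOn).2
      ⟨fun h => by simp at h, fun p => (spaceDeriv u p.1 p.2).coprod (R₁ p.1 p.2), ?_, ?_⟩
    · have h1 : ContDiffOn ℝ n (fun p : Space × ℝ =>
          (spaceDeriv u p.1 p.2).comp (ContinuousLinearMap.fst ℝ Space ℝ) +
            (R₁ p.1 p.2).comp (ContinuousLinearMap.snd ℝ Space ℝ)) (univ ×ˢ Ioi 0) :=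
        (hu'.clm_comp contDiffOn_const).add (hR₁.clm_comp contDiffOn_const)
      refine h1.congr fun p _ => ?_
      ext <;> simp
    · intro p hp
      have hev : ∀ᶠ q : Space × ℝ in 𝓝 p, 0 < q.2 :=
        Filter.mem_of_superset (hopen.mem_nhds hp) fun q hq => hq.2
      refine (hasStrictFDerivAt_uncurry_coprod (f := u) (f₁ := spaceDeriv u) (f₂ := R₁)
        (u := p) ?_ ?_ ?_ ?_).hasFDerivAt.hasFDerivWithinAt
      · filter_upwards [hev] with q hq
        exact (hu 1).hasFDerivAt q.1 hq
      · filter_upwards [hev] with q hq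
        have := (hd q.1 q.2 hq).hasFDerivAt
        convert! this using 1
      · exact hu'.continuousOn.continuousAt (hopen.mem_nhds hp)
      · exact hR₁.continuousOn.continuousAt (hopen.mem_nhds hp)
  induction k with
  | zero => exact fun hu hR hd => base hu hR hd
  | succ k ih =>
    intro E _ _ _ u R hu hR hd
    have hm : ∀ {G : Type} [NormedAddCommGroup G] [NormedSpace ℝ G] {v : Space → ℝ → G},
        SmoothPred n G v → SmoothPred 0 G v := fun h => ContDiffOn.of_le h (by simp)
    exact Tower.succ_of_spaceDeriv (base hu hR hd) (fun x t ht => (hu 1).hasFDerivAt x ht)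
      (ih (fun j => (hu (j + 1)).spaceDeriv (goodPred_smooth n))
        (fun j => (hR (j + 1)).spaceDeriv (goodPred_smooth n))
        fun x t ht => hasDerivAt_spaceDeriv ((hu 1).mono hm) ((hR 1).mono hm) hd x ht)

end QTensor

namespace QTensor

variable {E : Type} [NormedAddCommGroup E] [NormedSpace ℝ E]

/-! ### Mild solutions are smooth and solve the equation pointwise -/

theorem laplacian_eq_traceHess (f : Space → E) (x : Space) :
    (Δ f) x = traceHess (fderiv ℝ (fderiv ℝ f) x) := by
  rw [InnerProductSpace.laplacian_eq_iteratedFDeriv_orthonormalBasis f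
    (EuclideanSpace.basisFun (Fin 3) ℝ), traceHess_apply]
  simp [iteratedFDeriv_two_apply]

section

variable [CompleteSpace E] {N : ℝ → E → E} {f : Space → E} {u : Space → ℝ → E}

theorem IsMild.hasDerivWithinAt (h : IsMild N f u)
    (hT : ∀ k τ, 0 < τ → Tower AdmPred k E fun x t => u x (τ + t)) (x : Space) {t : ℝ}
    (ht : 0 < t) :
    HasDerivWithinAt (fun s => u x s)
      (traceHess (spaceDeriv (spaceDeriv u) x t) + N t (u x t)) (Ici t) t := by
  have ht2 : 0 < t / 2 := by positivity
  have hA := hT 2 (t / 2) ht2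
  have hA' := hA.spaceDeriv goodPred_adm
  have hA'' := hA'.spaceDeriv goodPred_adm
  have e2 : t / 2 + t / 2 = t := by ring
  have ha : Admissible fun x s => u x (t / 2 + s) := hA.base
  have ha' : Admissible fun x s => spaceDeriv u x (t / 2 + s) := hA'.base
  have ha'' : Admissible fun x s => spaceDeriv (spaceDeriv u) x (t / 2 + s) := hA''.base
  obtain ⟨B, hB⟩ := ha.bounded_slice ht2
  obtain ⟨B', hB'⟩ := ha'.bounded_slice ht2
  obtain ⟨B'', hB''⟩ := ha''.bounded_slice ht2
  have hd : ∀ y, HasFDerivAt (fun y => u y t) (spaceDeriv u y t) y := fun y => by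
    have := hA.hasFDerivAt y ht2
    simpa [spaceDeriv, e2] using this
  have hd' : ∀ y, HasFDerivAt (fun y => spaceDeriv u y t) (spaceDeriv (spaceDeriv u) y t) y :=
    fun y => by
      have := hA'.hasFDerivAt y ht2
      simpa [spaceDeriv, e2] using this
  simp only [e2] at hB hB' hB''
  have hc'' : Continuous fun y => spaceDeriv (spaceDeriv u) y t := by
    simpa [e2] using ha''.continuous_slice ht2
  have h1 := hasDerivWithinAt_heat_zero hd hd' hc'' hB hB' hB'' x
  have h2 := hasDerivWithinAt_duh_zero h.admissible_reaction x ht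
  have h3 : HasDerivWithinAt (fun r => u x (t + r))
      (traceHess (spaceDeriv (spaceDeriv u) x t) + N t (u x t)) (Ici 0) 0 := by
    refine (h1.add h2).congr (fun r hr => ?_) ?_
    · exact h.restart x ht hr
    · exact h.restart x ht le_rfl
  have h4 : HasDerivWithinAt (fun s => s - t) 1 (Ici t) t :=
    ((hasDerivAt_id t).sub_const t).hasDerivWithinAt
  have h5 := HasDerivWithinAt.scomp (t' := Ici 0) t (by simpa using h3) h4
    fun s hs => sub_nonneg.2 hs
  simpa [Function.comp_def] using h5

theorem continuousOn_slice {G : Type} [NormedAddCommGroup G] {v : Space → ℝ → G} (y : Space)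
    (hv : ContinuousOn (fun p : Space × ℝ => v p.1 p.2) (univ ×ˢ Ioi 0)) :
    ContinuousOn (fun s => v y s) (Ioi 0) :=
  hv.comp (f := fun s => (y, s)) (by fun_prop) fun _ hs => ⟨mem_univ _, hs⟩

/-- The right derivative `R` is continuous. Hence `u` and the primitive of `R` with the same value
at `t/2` have equal right derivatives, so they coincide, and the primitive is differentiable from
both sides. -/
theorem IsMild.hasDerivAt (h : IsMild N f u)
    (hT : ∀ k τ, 0 < τ → Tower AdmPred k E fun x t => u x (τ + t)) (x : Space) {t : ℝ}
    (ht : 0 < t) :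
    HasDerivAt (fun s => u x s)
      (traceHess (spaceDeriv (spaceDeriv u) x t) + N t (u x t)) t := by
  set R : ℝ → E := fun t => traceHess (spaceDeriv (spaceDeriv u) x t) + N t (u x t) with hR
  have hTc : Tower (SmoothPred 0) 2 E u := tower_continuous_of_shift (hT 2)
  have hc2 : ContinuousOn (fun p : Space × ℝ => spaceDeriv (spaceDeriv u) p.1 p.2)
      (univ ×ˢ Ioi 0) :=
    contDiffOn_zero.1 ((hTc.spaceDeriv (goodPred_smooth 0)).spaceDeriv (goodPred_smooth 0))
  have hRc : ContinuousOn R (Ioi 0) :=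
    (traceHess.continuous.comp_continuousOn (continuousOn_slice x hc2)).add
      (continuousOn_slice (v := fun y s => N s (u y s)) x h.admissible_reaction.continuousOn)
  have huc : ContinuousOn (fun s => u x s) (Ioi 0) :=
    continuousOn_slice x h.admissible.continuousOn
  have hg : ∀ s, 0 < s → HasDerivAt (fun s => u x (t / 2) + ∫ r in (t / 2)..s, R r) (R s) s := by
    intro s hs
    refine HasDerivAt.const_add _ (intervalIntegral.integral_hasDerivAt_right ?_ ?_ ?_)
    · exact (hRc.mono fun r hr => (lt_min (by positivity) hs).trans_le hr.1).intervalIntegrable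
    · exact hRc.stronglyMeasurableAtFilter isOpen_Ioi s hs
    · exact hRc.continuousAt (Ioi_mem_nhds hs)
  have ht2 : 0 < t / 2 := by positivity
  have key := eq_of_has_deriv_right_eq (a := t / 2) (b := 2 * t) (f := fun s => u x s) (f' := R)
    (g := fun s => u x (t / 2) + ∫ r in (t / 2)..s, R r)
    (fun s hs => h.hasDerivWithinAt hT x (ht2.trans_le hs.1))
    (fun s hs => (hg s (ht2.trans_le hs.1)).hasDerivWithinAt)
    (huc.mono fun s hs => ht2.trans_le hs.1)
    (fun s hs => (hg s (ht2.trans_le hs.1)).continuousAt.continuousWithinAt) (by simp)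
  refine (hg t ht).congr_of_eventuallyEq ?_
  filter_upwards [Icc_mem_nhds (by linarith : t / 2 < t) (by linarith : t < 2 * t)] with s hs
  exact key s hs

/-- Mild solutions with a quadratic-cubic reaction term are smooth and solve the equation. -/
theorem IsMild.smooth {α β : ℝ → ℝ} (hα : ContDiff ℝ ∞ α) (hβ : ContDiff ℝ ∞ β)
    {B : E →L[ℝ] E →L[ℝ] E} {S : E →L[ℝ] E →L[ℝ] ℝ} (h : IsMild (reaction α β B S) f u) :
    ContDiffOn ℝ ∞ (fun p : Space × ℝ => u p.1 p.2) (univ ×ˢ Ioi 0) ∧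
      ∀ x t, 0 < t → HasDerivAt (fun s => u x s)
        ((Δ fun y => u y t) x + reaction α β B S t (u x t)) t := by
  have hT : ∀ k τ, 0 < τ → Tower AdmPred k E fun x t => u x (τ + t) :=
    h.tower fun k τ _ hu => Tower.reaction goodPred_adm (α := fun t => α (τ + t))
      (β := fun t => β (τ + t)) (adm_time_smul (hα.continuous.comp (by fun_prop)))
      (adm_time_smul (hβ.continuous.comp (by fun_prop))) B S hu
  have hd := fun x t (ht : 0 < t) => h.hasDerivAt hT x ht
  have hall : ∀ n k, Tower (SmoothPred n) k E u := by
    intro n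
    induction n with
    | zero => exact fun k => tower_continuous_of_shift (hT k)
    | succ n ih =>
      intro k
      refine tower_smooth_succ ih (fun j => ?_) hd
      -- The Laplacian in the time derivative costs two spatial levels, which is harmless because
      -- the induction on `n` carries towers of every height.
      have h2 := ((ih (j + 2)).spaceDeriv (goodPred_smooth n)).spaceDeriv (goodPred_smooth n)
      exact Tower.add (goodPred_smooth n) (Tower.clm (goodPred_smooth n) traceHess h2)
        (Tower.reaction (goodPred_smooth n) (smooth_time_smul hα) (smooth_time_smul hβ) B S (ih j))
  refine ⟨contDiffOn_infty.2 fun n => (hall n 0).base, fun x t ht => ?_⟩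
  rw [laplacian_eq_traceHess]
  exact hd x t ht

end

end QTensor

namespace QTensor

variable {E : Type} [NormedAddCommGroup E] [NormedSpace ℝ E]

/-! ### Existence of small mild solutions -/

/-- The weights for different `ε` are equivalent: small `ε` serves the fixed point argument, while
`ε = 1` serves the data and the moment estimates. -/
theorem decay_le_decay_one {ε k : ℝ} (hε : 0 < ε) (hε1 : ε ≤ 1) (hk : 0 ≤ k) (x : Space) :
    decay ε k x ≤ ε ^ (-k) * decay 1 k x := by
  unfold decay
  rw [← Real.mul_rpow hε.le (by positivity)]
  refine Real.rpow_le_rpow_of_nonpos (by positivity) ?_ (by linarith)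
  nlinarith

theorem decay_one_le {ε k : ℝ} (hε : 0 ≤ ε) (hε1 : ε ≤ 1) (hk : 0 ≤ k) (x : Space) :
    decay 1 k x ≤ decay ε k x := by
  unfold decay
  refine Real.rpow_le_rpow_of_nonpos (by positivity) ?_ (by linarith)
  nlinarith [norm_nonneg x]

theorem integrable_decay_one {k : ℝ} (hk : 3 < k) : Integrable (decay 1 k) := by
  refine (integrable_one_add_norm (E := Space) (μ := volume) (r := k) (by simpa using hk)).congr
    (Eventually.of_forall fun x => ?_)
  simp [decay]

theorem integrable_decay {ε k : ℝ} (hε : 0 < ε) (hε1 : ε ≤ 1) (hk : 3 < k) :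
    Integrable (decay ε k) := by
  refine ((integrable_decay_one hk).const_mul (ε ^ (-k))).mono'
    (continuous_decay hε.le k).aestronglyMeasurable (Eventually.of_forall fun x => ?_)
  rw [Real.norm_of_nonneg (decay_pos hε.le k x).le]
  exact decay_le_decay_one hε hε1 (by linarith) x

theorem heatKernel_le {t₀ t : ℝ} (ht₀ : 0 < t₀) (ht : t₀ ≤ t) (z : Space) :
    heatKernel z t ≤ ((4 * Real.pi * t₀) ^ (3 / 2 : ℝ))⁻¹ := by
  have ht' : 0 < t := ht₀.trans_le ht
  rw [heatKernel, ← one_div]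
  have h1 : Real.exp (-‖z‖ ^ 2 / (4 * t)) ≤ 1 := by
    rw [Real.exp_le_one_iff]
    exact div_nonpos_of_nonpos_of_nonneg (by nlinarith [norm_nonneg z]) (by positivity)
  gcongr

theorem continuousOn_heatKernel :
    ContinuousOn (fun p : Space × ℝ => heatKernel p.1 p.2) (univ ×ˢ Ioi 0) := by
  unfold heatKernel
  have h0 : ∀ p ∈ (univ : Set Space) ×ˢ Ioi (0 : ℝ), 0 < p.2 := fun p hp => hp.2
  refine ContinuousOn.div ?_ ?_ fun p hp => ?_
  · refine ContinuousOn.rexp (ContinuousOn.div (by fun_prop) (by fun_prop) fun p hp => ?_)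
    have := h0 p hp
    positivity
  · refine ContinuousOn.rpow_const (by fun_prop) fun p hp => Or.inl ?_
    have := h0 p hp
    positivity
  · have := h0 p hp
    positivity

/-- Continuity at positive times for a datum that may be discontinuous: all regularity comes from
the kernel, bounded once `t` stays away from `0`. -/
theorem continuousOn_heat {f : Space → E} (hf : Integrable f) :
    ContinuousOn (fun p : Space × ℝ => heat p.2 f p.1) (univ ×ˢ Ioi 0) := by
  have hopen : IsOpen ((univ : Set Space) ×ˢ Ioi (0 : ℝ)) := isOpen_univ.prod isOpen_Ioi
  have h1 : ContinuousOn (fun p : Space × ℝ => ∫ y, heatKernel (p.1 - y) p.2 • f y)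
      (univ ×ˢ Ioi 0) := by
    rintro ⟨x, t⟩ hp
    have ht : 0 < t := hp.2
    refine ContinuousAt.continuousWithinAt ?_
    have hk : ∀ (y : Space) (p : Space × ℝ), 0 < p.2 →
        ContinuousAt (fun q : Space × ℝ => heatKernel (q.1 - y) q.2) p := fun y p hp =>
      ContinuousAt.comp (g := fun q : Space × ℝ => heatKernel q.1 q.2)
        (f := fun q : Space × ℝ => (q.1 - y, q.2))
        (continuousOn_heatKernel.continuousAt (hopen.mem_nhds ⟨mem_univ _, hp⟩)) (by fun_prop)
    have hev : ∀ᶠ p : Space × ℝ in 𝓝 (x, t), t / 2 < p.2 := by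
      have : ContinuousAt (fun p : Space × ℝ => p.2) (x, t) := by fun_prop
      exact this.eventually (Ioi_mem_nhds (by linarith : t / 2 < t))
    refine continuousAt_of_dominated
      (bound := fun y => ((4 * Real.pi * (t / 2)) ^ (3 / 2 : ℝ))⁻¹ * ‖f y‖) ?_ ?_
      (hf.norm.const_mul _) ?_
    · filter_upwards [hev] with p hp
      have hp' : 0 < p.2 := lt_trans (by positivity) hp
      refine AEStronglyMeasurable.smul (Continuous.aestronglyMeasurable ?_) hf.aestronglyMeasurable
      refine continuous_iff_continuousAt.2 fun y => ?_
      exact ContinuousAt.comp (g := fun q : Space × ℝ => heatKernel q.1 q.2)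
        (f := fun y : Space => (p.1 - y, p.2))
        (continuousOn_heatKernel.continuousAt (hopen.mem_nhds ⟨mem_univ _, hp'⟩)) (by fun_prop)
    · filter_upwards [hev] with p hp
      have hp' : 0 < p.2 := lt_trans (by positivity) hp
      refine Eventually.of_forall fun y => ?_
      rw [norm_smul, Real.norm_of_nonneg (heatKernel_nonneg _ hp'.le)]
      gcongr
      exact heatKernel_le (by positivity) hp.le _
    · exact Eventually.of_forall fun y => (hk y (x, t) ht).smul continuousAt_const
  exact h1.congr fun p hp => heat_eq_integral_kernel hp.2 f p.1

theorem integral_exp_neg_le {μ t : ℝ} (hμ : 0 < μ) :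
    ∫ s in (0)..t, Real.exp (-μ * s) ≤ 1 / μ := by
  rw [intervalIntegral.integral_comp_mul_left _ (by linarith : -μ ≠ 0), integral_exp, smul_eq_mul,
    mul_zero, Real.exp_zero, inv_neg, neg_mul, one_div, ← mul_neg, neg_sub]
  exact mul_le_of_le_one_right (by positivity) (by linarith [Real.exp_pos (-μ * t)])

/-- The weight loss over time `t - s` is at most that over time `t`, and the exponential decay of
the source integrates to `1/μ`. The bound therefore has the same space-time weight as for the free
evolution, with a constant independent of `t`. -/
theorem norm_duh_le_decay {ε k : ℝ} (hε : 0 ≤ ε) (hk : 0 ≤ k) {g : Space → ℝ → E} {M μ : ℝ}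
    (hμ : 0 < μ) (hg : ∀ x s, 0 < s → ‖g x s‖ ≤ M * Real.exp (-μ * s) * decay ε k x) (x : Space)
    {t : ℝ} (ht : 0 ≤ t) :
    ‖duh g x t‖ ≤ M / μ * gaussMoment * (Real.exp (2 * (k * ε) ^ 2 * t) * decay ε k x) := by
  have hM : 0 ≤ M := by
    have h1 := (norm_nonneg _).trans (hg 0 1 one_pos)
    exact nonneg_of_mul_nonneg_left (by simpa only [mul_assoc] using h1)
      (mul_pos (Real.exp_pos _) (decay_pos hε k 0))
  have hG : 0 ≤ gaussMoment := zero_le_one.trans one_le_gaussMoment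
  have hD := (decay_pos hε k x).le
  set D : ℝ := M * gaussMoment * (Real.exp (2 * (k * ε) ^ 2 * t) * decay ε k x) with hDdef
  have h1 : ‖duh g x t‖ ≤ ∫ s in (0)..t, D * Real.exp (-μ * s) := by
    refine intervalIntegral.norm_integral_le_of_norm_le ht
      (Eventually.of_forall fun s hs => ?_) (Continuous.intervalIntegrable (by fun_prop) _ _)
    refine (norm_heat_le_decay hε hk (fun y => hg y s hs.1) (sub_nonneg.2 hs.2) x).trans ?_
    have h2 : Real.exp (2 * (k * ε) ^ 2 * (t - s)) ≤ Real.exp (2 * (k * ε) ^ 2 * t) := by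
      gcongr
      linarith [hs.1]
    calc M * Real.exp (-μ * s) * gaussMoment * Real.exp (2 * (k * ε) ^ 2 * (t - s)) * decay ε k x
        ≤ M * Real.exp (-μ * s) * gaussMoment * Real.exp (2 * (k * ε) ^ 2 * t) * decay ε k x := by
          gcongr
      _ = D * Real.exp (-μ * s) := by
          rw [hDdef]
          ring
  refine h1.trans ?_
  have h3 := integral_exp_neg_le (t := t) hμ
  rw [intervalIntegral.integral_const_mul]
  have hD0 : 0 ≤ D := by positivity
  calc D * ∫ s in (0)..t, Real.exp (-μ * s) ≤ D * (1 / μ) := by gcongr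
    _ = _ := by
      rw [hDdef]
      ring

/-- A reaction term vanishing at `0`, with small Lipschitz constants near `0` that decay in time. -/
structure SmallLip (N : ℝ → E → E) (a κ L : ℝ) : Prop where
  cont : Continuous fun p : ℝ × E => N p.1 p.2
  zero : ∀ t, N t 0 = 0
  lip : ∀ t, 0 < t → ∀ r, r ≤ 1 → ∀ u v, ‖u‖ ≤ r * Real.exp (κ * t) → ‖v‖ ≤ r * Real.exp (κ * t) →
    ‖N t u - N t v‖ ≤ L * r * Real.exp (-(a - κ) * t) * ‖u - v‖

/-- The size bounds use only the growth `e^{κt}`, while the difference supplies the spatial decay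
and one more `e^{κt}`; the exponents combine to `-(a-κ) + κ = -(a-2κ)`. -/
theorem SmallLip.norm_sub_le {N : ℝ → E → E} {a κ L : ℝ} (hN : SmallLip N a κ L) (hL : 0 ≤ L)
    {ε k : ℝ} (hε : 0 ≤ ε) (hk : 0 ≤ k) {r d t : ℝ} (hr0 : 0 ≤ r) (hr : r ≤ 1) (ht : 0 < t)
    {x : Space} {u v : E} (hu : ‖u‖ ≤ r * (Real.exp (κ * t) * decay ε k x))
    (hv : ‖v‖ ≤ r * (Real.exp (κ * t) * decay ε k x))
    (huv : ‖u - v‖ ≤ d * (Real.exp (κ * t) * decay ε k x)) :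
    ‖N t u - N t v‖ ≤ L * r * d * Real.exp (-(a - 2 * κ) * t) * decay ε k x := by
  have h1 : r * (Real.exp (κ * t) * decay ε k x) ≤ r * Real.exp (κ * t) := by
    gcongr
    exact mul_le_of_le_one_right (Real.exp_nonneg _) (decay_le_one hε hk x)
  refine (hN.lip t ht r hr u v (hu.trans h1) (hv.trans h1)).trans ?_
  calc L * r * Real.exp (-(a - κ) * t) * ‖u - v‖
      ≤ L * r * Real.exp (-(a - κ) * t) * (d * (Real.exp (κ * t) * decay ε k x)) := by gcongr
    _ = L * r * d * (Real.exp (-(a - κ) * t) * Real.exp (κ * t)) * decay ε k x := by ring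
    _ = _ := by
      rw [← Real.exp_add]
      ring_nf

theorem SmallLip.norm_le {N : ℝ → E → E} {a κ L : ℝ} (hN : SmallLip N a κ L) (hL : 0 ≤ L)
    {ε k : ℝ} (hε : 0 ≤ ε) (hk : 0 ≤ k) {r t : ℝ} (hr0 : 0 ≤ r) (hr : r ≤ 1) (ht : 0 < t)
    {x : Space} {u : E} (hu : ‖u‖ ≤ r * (Real.exp (κ * t) * decay ε k x)) :
    ‖N t u‖ ≤ L * r * r * Real.exp (-(a - 2 * κ) * t) * decay ε k x := by
  have hD := decay_pos hε k x
  have := hN.norm_sub_le hL hε hk (v := 0) hr0 hr ht hu (by rw [norm_zero]; positivity)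
    (by simpa using hu)
  simpa [hN.zero] using this

theorem SmallLip.admissible {N : ℝ → E → E} {a κ L : ℝ} (hN : SmallLip N a κ L) (hL : 0 ≤ L)
    (hμ : 0 ≤ a - 2 * κ) {ε k : ℝ} (hε : 0 ≤ ε) (hk : 0 ≤ k) {r : ℝ} (hr0 : 0 ≤ r)
    (hr : r ≤ 1) {u : Space → ℝ → E}
    (hc : ContinuousOn (fun p : Space × ℝ => u p.1 p.2) (univ ×ˢ Ioi 0))
    (hu : ∀ x t, 0 < t → ‖u x t‖ ≤ r * (Real.exp (κ * t) * decay ε k x)) :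
    Admissible fun x t => N t (u x t) := by
  refine ⟨hN.cont.comp_continuousOn (continuousOn_snd.prodMk hc),
    fun _ => ⟨L * r * r, fun x t ht => ?_⟩⟩
  refine (hN.norm_le hL hε hk hr0 hr ht.1 (hu x t ht.1)).trans ?_
  have h1 : Real.exp (-(a - 2 * κ) * t) ≤ 1 := by
    rw [Real.exp_le_one_iff]
    nlinarith [ht.1]
  calc L * r * r * Real.exp (-(a - 2 * κ) * t) * decay ε k x ≤ L * r * r * 1 * 1 := by
        gcongr
        · exact (decay_pos hε k x).le
        · exact decay_le_one hε hk x
    _ = L * r * r := by ring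

open BoundedContinuousFunction in
-- Banach's fixed point theorem on the ball of radius `r` in the weighted space. `hη` lets the free
-- evolution use half of the radius, and `hLr` makes the Duhamel part a contraction with constant
-- `1/2`.
theorem exists_mild [CompleteSpace E] {N : ℝ → E → E} {a κ L : ℝ} (hN : SmallLip N a κ L)
    (hL : 0 ≤ L) (hμ : 0 < a - 2 * κ) {ε k : ℝ} (hε : 0 < ε) (hε1 : ε ≤ 1) (hk : 3 < k)
    (hκ : κ = 2 * (k * ε) ^ 2) {r η : ℝ} (hr0 : 0 < r) (hr : r ≤ 1)
    (hη : η * gaussMoment ≤ r / 2) (hLr : L * r / (a - 2 * κ) * gaussMoment ≤ 1 / 2)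
    {f : Space → E} (hf : StronglyMeasurable f) (hfη : ∀ y, ‖f y‖ ≤ η * decay ε k y) :
    ∃ u : Space → ℝ → E, IsMild N f u ∧
      ∀ x t, 0 < t → ‖u x t‖ ≤ r * (Real.exp (κ * t) * decay ε k x) := by
  have hk0 : 0 ≤ k := by linarith
  have hκ0 : 0 ≤ κ := by rw [hκ]; positivity
  let wt : Space → ℝ → ℝ := fun x t => Real.exp (κ * t) * decay ε k x
  have hw : ∀ x t, 0 < wt x t := fun x t => mul_pos (Real.exp_pos _) (decay_pos hε.le k x)
  have hwc : Continuous fun p : Space × ℝ => wt p.1 p.2 :=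
    (by fun_prop : Continuous fun p : Space × ℝ => Real.exp (κ * p.2)).mul
      ((continuous_decay hε.le k).comp continuous_fst)
  -- Dividing by the weight and using `log t` as time variable turns weighted fields on `t > 0` into
  -- bounded continuous functions on all of `Space × ℝ`, which form a Banach space.
  let field : (Space × ℝ →ᵇ E) → Space → ℝ → E := fun q x t => wt x t • q (x, Real.log t)
  have hfield : ∀ q x t, ‖field q x t‖ = wt x t * ‖q (x, Real.log t)‖ := fun q x t => by
    rw [norm_smul, Real.norm_of_nonneg (hw x t).le]
  have hfield_cont : ∀ q, ContinuousOn (fun p : Space × ℝ => field q p.1 p.2) (univ ×ˢ Ioi 0) := by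
    intro q
    refine hwc.continuousOn.smul (q.continuous.comp_continuousOn ?_)
    exact continuousOn_fst.prodMk (ContinuousOn.log continuousOn_snd fun p hp => ne_of_gt hp.2)
  have hfield_le : ∀ q ∈ Metric.closedBall (0 : Space × ℝ →ᵇ E) r, ∀ x t,
      ‖field q x t‖ ≤ r * wt x t := by
    intro q hq x t
    rw [hfield, mul_comm]
    have h1 : ‖q‖ ≤ r := by simpa using hq
    exact mul_le_mul_of_nonneg_right ((q.norm_coe_le_norm _).trans h1) (hw x t).le
  have hadm : ∀ q ∈ Metric.closedBall (0 : Space × ℝ →ᵇ E) r,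
      Admissible fun x t => N t (field q x t) := fun q hq =>
    hN.admissible hL hμ.le hε.le hk0 hr0.le hr (hfield_cont q) fun x t _ => hfield_le q hq x t
  let sol : (Space × ℝ →ᵇ E) → Space → ℝ → E := fun q x t =>
    heat t f x + duh (fun y s => N s (field q y s)) x t
  have hfint : Integrable f := ((integrable_decay hε hε1 hk).const_mul η).mono'
    hf.aestronglyMeasurable (Eventually.of_forall hfη)
  have hsol_cont : ∀ q ∈ Metric.closedBall (0 : Space × ℝ →ᵇ E) r,
      ContinuousOn (fun p : Space × ℝ => sol q p.1 p.2) (univ ×ˢ Ioi 0) := fun q hq =>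
    (continuousOn_heat hfint).add (admissible_duh (hadm q hq)).continuousOn
  have hsol_le : ∀ q ∈ Metric.closedBall (0 : Space × ℝ →ᵇ E) r, ∀ x t, 0 < t →
      ‖sol q x t‖ ≤ r * wt x t := by
    intro q hq x t ht
    have h1 := norm_heat_le_decay hε.le hk0 hfη ht.le x
    have h2 := norm_duh_le_decay hε.le hk0 (M := L * r * r) hμ (g := fun y s => N s (field q y s))
      (fun y s hs => hN.norm_le hL hε.le hk0 hr0.le hr hs (hfield_le q hq y s)) x ht.le
    rw [← hκ] at h1 h2
    have hwx := (hw x t).le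
    calc ‖sol q x t‖ ≤ η * gaussMoment * Real.exp (κ * t) * decay ε k x +
          L * r * r / (a - 2 * κ) * gaussMoment * wt x t := norm_add_le_of_le h1 h2
      _ = (η * gaussMoment) * wt x t +
          (L * r / (a - 2 * κ) * gaussMoment) * r * wt x t := by
          simp only [wt]
          ring
      _ ≤ (r / 2) * wt x t + (1 / 2) * r * wt x t := by gcongr
      _ = r * wt x t := by ring
  have hex : ∀ q : Space × ℝ →ᵇ E, q ∈ Metric.closedBall (0 : Space × ℝ →ᵇ E) r →
      ∃ q' : Space × ℝ →ᵇ E, ∀ p, q' p = (wt p.1 (Real.exp p.2))⁻¹ • sol q p.1 (Real.exp p.2) := by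
    intro q hq
    refine ⟨BoundedContinuousFunction.ofNormedAddCommGroup
      (fun p : Space × ℝ => (wt p.1 (Real.exp p.2))⁻¹ • sol q p.1 (Real.exp p.2)) ?_ r ?_,
      fun p => rfl⟩
    · have hexp : Continuous fun p : Space × ℝ => (p.1, Real.exp p.2) := by fun_prop
      refine Continuous.smul (Continuous.inv₀ (hwc.comp hexp) fun p => (hw _ _).ne') ?_
      exact (hsol_cont q hq).comp_continuous hexp fun p => ⟨mem_univ _, Real.exp_pos _⟩
    · intro p
      rw [norm_smul, norm_inv, Real.norm_of_nonneg (hw _ _).le,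
        inv_mul_le_iff₀ (hw _ _), mul_comm]
      exact hsol_le q hq _ _ (Real.exp_pos _)
  choose! Ψ hΨ using hex
  have hmaps : MapsTo Ψ (Metric.closedBall 0 r) (Metric.closedBall 0 r) := by
    intro q hq
    rw [mem_closedBall_zero_iff, BoundedContinuousFunction.norm_le hr0.le]
    intro p
    rw [hΨ q hq, norm_smul, norm_inv, Real.norm_of_nonneg (hw _ _).le,
      inv_mul_le_iff₀ (hw _ _), mul_comm]
    exact hsol_le q hq _ _ (Real.exp_pos _)
  have hcontr : ∀ q ∈ Metric.closedBall (0 : Space × ℝ →ᵇ E) r,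
      ∀ q₁ ∈ Metric.closedBall (0 : Space × ℝ →ᵇ E) r, dist (Ψ q) (Ψ q₁) ≤ 1 / 2 * dist q q₁ := by
    intro q hq q₁ hq₁
    rw [BoundedContinuousFunction.dist_le (by positivity)]
    intro p
    rw [hΨ q hq, hΨ q₁ hq₁, dist_eq_norm, ← smul_sub, norm_smul, norm_inv,
      Real.norm_of_nonneg (hw _ _).le, inv_mul_le_iff₀ (hw _ _)]
    obtain ⟨x, σ⟩ := p
    have ht := Real.exp_pos σ
    set t := Real.exp σ
    have e1 : sol q x t - sol q₁ x t =
        duh (fun y s => N s (field q y s) - N s (field q₁ y s)) x t := by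
      have h1 := intervalIntegrable_duh (hadm q hq) x (T := t) le_rfl ht.le
      have h2 := intervalIntegrable_duh (hadm q₁ hq₁) x (T := t) le_rfl ht.le
      simp only [sol, add_sub_add_left_eq_sub]
      rw [duh, duh, duh, ← intervalIntegral.integral_sub h1 h2]
      refine intervalIntegral.integral_congr_ae (Eventually.of_forall fun s hs => ?_)
      rw [uIoc_of_le ht.le] at hs
      have hi : ∀ q ∈ Metric.closedBall (0 : Space × ℝ →ᵇ E) r,
          Integrable (fun w => N s (field q (x - √(t - s) • w) s)) gauss := by
        intro q hq
        obtain ⟨C, hC⟩ := (hadm q hq).bounded_slice hs.1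
        exact Integrable.of_bound
          (((hadm q hq).continuous_slice hs.1).comp (by fun_prop)).aestronglyMeasurable C
          (Eventually.of_forall fun w => hC _)
      exact (integral_sub (hi q hq) (hi q₁ hq₁)).symm
    rw [e1]
    have h3 := norm_duh_le_decay hε.le hk0 (M := L * r * dist q q₁) hμ
      (g := fun y s => N s (field q y s) - N s (field q₁ y s)) (fun y s hs =>
        hN.norm_sub_le hL hε.le hk0 hr0.le hr hs (hfield_le q hq y s) (hfield_le q₁ hq₁ y s) (by
          simp only [field, ← smul_sub]
          rw [norm_smul, Real.norm_of_nonneg (hw y s).le, mul_comm, ← dist_eq_norm]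
          exact mul_le_mul_of_nonneg_right (BoundedContinuousFunction.dist_coe_le_dist _)
            (hw y s).le)) x ht.le
    rw [← hκ] at h3
    refine h3.trans ?_
    have hwx := (hw x t).le
    calc L * r * dist q q₁ / (a - 2 * κ) * gaussMoment * (Real.exp (κ * t) * decay ε k x)
        = (L * r / (a - 2 * κ) * gaussMoment) * dist q q₁ * wt x t := by
          simp only [wt]
          ring
      _ ≤ 1 / 2 * dist q q₁ * wt x t := by gcongr
      _ = _ := by ring
  have hcw : ContractingWith (1 / 2) (hmaps.restrict Ψ _ _) := by
    refine ⟨by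
      rw [← NNReal.coe_lt_coe]
      norm_num, LipschitzWith.of_dist_le_mul fun q q₁ => ?_⟩
    simpa [Subtype.dist_eq] using hcontr q q.2 q₁ q₁.2
  obtain ⟨q, hq, hfix, -⟩ := ContractingWith.exists_fixedPoint' 
    (Metric.isClosed_closedBall (x := (0 : Space × ℝ →ᵇ E)) (ε := r)).isComplete hmaps hcw
    (x := 0) (by simp [hr0.le]) (edist_ne_top _ _)
  have heq : ∀ x t, 0 < t → field q x t = sol q x t := by
    intro x t ht
    have h1 : q (x, Real.log t) = (wt x t)⁻¹ • sol q x t := by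
      have h2 := hΨ q hq (x, Real.log t)
      rw [hfix] at h2
      simpa [Real.exp_log ht] using h2
    simp only [field]
    rw [h1, smul_smul, mul_inv_cancel₀ (hw x t).ne', one_smul]
  refine ⟨field q, ⟨hf, ⟨η, fun y => (hfη y).trans ?_⟩, ⟨hfield_cont q, fun T => ?_⟩, hadm q hq,
    heq⟩, fun x t _ => hfield_le q hq x t⟩
  · have hη0 : 0 ≤ η := nonneg_of_mul_nonneg_left ((norm_nonneg _).trans (hfη 0))
      (decay_pos hε.le k 0)
    exact mul_le_of_le_one_right hη0 (decay_le_one hε.le hk0 y)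
  · refine ⟨r * (Real.exp (κ * T) * 1), fun x t ht => (hfield_le q hq x t).trans ?_⟩
    simp only [wt]
    gcongr
    · exact (decay_pos hε.le k x).le
    · exact ht.2
    · exact decay_le_one hε.le hk0 x

end QTensor

namespace QTensor

/-! ### A cutoff function -/

/-- For an exponent at least `2` both one-sided derivatives at the corner vanish. -/
theorem hasDerivAt_max_pow (n : ℕ) (z : ℝ) :
    HasDerivAt (fun z : ℝ => max 0 z ^ (n + 2)) ((n + 2 : ℕ) * max 0 z ^ (n + 1)) z := by
  have hpow : HasDerivAt (fun z : ℝ => z ^ (n + 2)) ((n + 2 : ℕ) * z ^ (n + 1)) z := by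
    simpa using hasDerivAt_pow (n + 2) z
  rcases lt_trichotomy z 0 with hz | rfl | hz
  · rw [max_eq_left hz.le]
    refine ((hasDerivAt_const z (0 : ℝ)).congr_of_eventuallyEq ?_).congr_deriv (by simp)
    filter_upwards [Iio_mem_nhds hz] with y hy
    simp [max_eq_left (show y < 0 from hy).le]
  · have h1 : HasDerivWithinAt (fun z : ℝ => max 0 z ^ (n + 2)) 0 (Iic 0) 0 :=
      (hasDerivWithinAt_const (0 : ℝ) (Iic 0) (0 : ℝ)).congr
        (fun y hy => by simp [max_eq_left (show y ≤ 0 from hy)]) (by simp)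
    have h2 : HasDerivWithinAt (fun z : ℝ => max 0 z ^ (n + 2)) 0 (Ici 0) 0 := by
      refine (hpow.hasDerivWithinAt.congr_deriv (by simp)).congr (fun y hy => ?_) (by simp)
      rw [max_eq_right (show 0 ≤ y from hy)]
    have h3 := h1.union h2
    rw [Iic_union_Ici, hasDerivWithinAt_univ] at h3
    simpa using h3
  · rw [max_eq_right hz.le]
    refine hpow.congr_of_eventuallyEq ?_
    filter_upwards [Ioi_mem_nhds hz] with y hy
    rw [max_eq_right (le_of_lt hy)]

/-- The profile `max (0, 1 - |x|² / R²)`. -/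
def cutProfile (R : ℝ) (x : Space) : ℝ := max 0 (1 - ‖x‖ ^ 2 / R ^ 2)

/-- The cutoff function, the fourth power of the profile. -/
def cutoff (R : ℝ) (x : Space) : ℝ := cutProfile R x ^ 4

/-- The first derivatives of the cutoff function along the coordinate axes. -/
def cutoffD (R : ℝ) (i : Fin 3) (x : Space) : ℝ := 4 * cutProfile R x ^ 3 * (-(2 * x i) / R ^ 2)

/-- The second derivatives of the cutoff function along the coordinate axes. -/
def cutoffDD (R : ℝ) (i : Fin 3) (x : Space) : ℝ :=
  12 * cutProfile R x ^ 2 * (-(2 * x i) / R ^ 2) ^ 2 - 8 * cutProfile R x ^ 3 / R ^ 2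

theorem hasLineDerivAt_cutoff_arg (R : ℝ) (i : Fin 3) (x : Space) :
    HasDerivAt (fun s : ℝ => 1 - ‖x + s • (EuclideanSpace.single i (1 : ℝ) : Space)‖ ^ 2 / R ^ 2)
      (-(2 * x i) / R ^ 2) 0 := by
  have e : ∀ s : ℝ, ‖x + s • (EuclideanSpace.single i (1 : ℝ) : Space)‖ ^ 2 =
      ‖x‖ ^ 2 + 2 * s * x i + s ^ 2 := by
    intro s
    rw [norm_add_sq_real, inner_smul_right, EuclideanSpace.inner_single_right, norm_smul]
    simp
    ring
  simp only [e]
  have h1 : HasDerivAt (fun s : ℝ => ‖x‖ ^ 2 + 2 * s * x i + s ^ 2) (2 * x i) 0 := by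
    have := ((((hasDerivAt_id (0 : ℝ)).const_mul 2).mul_const (x i)).const_add (‖x‖ ^ 2)).fun_add
      (hasDerivAt_pow 2 (0 : ℝ))
    simpa using this
  have h2 := (h1.div_const (R ^ 2)).const_sub 1
  rwa [neg_div]

theorem hasLineDerivAt_cutProfile_pow (R : ℝ) (n : ℕ) (i : Fin 3) (x : Space) :
    HasLineDerivAt ℝ (fun x => cutProfile R x ^ (n + 2))
      ((n + 2 : ℕ) * cutProfile R x ^ (n + 1) * (-(2 * x i) / R ^ 2)) x
      (EuclideanSpace.single i 1) := by
  have h1 := hasLineDerivAt_cutoff_arg R i x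
  have h2 := hasDerivAt_max_pow n
    (1 - ‖x + (0 : ℝ) • (EuclideanSpace.single i (1 : ℝ) : Space)‖ ^ 2 / R ^ 2)
  have h3 := h2.comp (0 : ℝ) h1
  simpa [HasLineDerivAt, cutProfile, Function.comp_def] using h3

theorem hasLineDerivAt_cutoff (R : ℝ) (i : Fin 3) (x : Space) :
    HasLineDerivAt ℝ (cutoff R) (cutoffD R i x) x (EuclideanSpace.single i 1) := by
  simpa [cutoff, cutoffD] using! hasLineDerivAt_cutProfile_pow R 2 i x

theorem hasLineDerivAt_cutoffD (R : ℝ) (i : Fin 3) (x : Space) :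
    HasLineDerivAt ℝ (cutoffD R i) (cutoffDD R i x) x (EuclideanSpace.single i 1) := by
  have h1 := hasLineDerivAt_cutProfile_pow R 1 i x
  have h2 : HasDerivAt (fun s : ℝ =>
      -(2 * (x + s • (EuclideanSpace.single i (1 : ℝ) : Space)) i) / R ^ 2) (-2 / R ^ 2) 0 := by
    have e : ∀ s : ℝ, (x + s • (EuclideanSpace.single i (1 : ℝ) : Space)) i = x i + s := by
      intro s
      simp
    simp only [e]
    have := ((((hasDerivAt_id (0 : ℝ)).const_add (x i)).const_mul 2).neg).div_const (R ^ 2)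
    simpa using! this
  have h3 := (HasDerivAt.const_mul 4 h1).mul h2
  unfold HasLineDerivAt
  refine h3.congr_deriv ?_
  simp [cutoffDD]
  ring

theorem cutProfile_nonneg (R : ℝ) (x : Space) : 0 ≤ cutProfile R x := le_max_left _ _

theorem cutProfile_le_one (R : ℝ) (x : Space) : cutProfile R x ≤ 1 :=
  max_le zero_le_one (by
    have : 0 ≤ ‖x‖ ^ 2 / R ^ 2 := by positivity
    linarith)

theorem continuous_cutProfile (R : ℝ) : Continuous (cutProfile R) := by
  unfold cutProfile
  fun_prop

theorem cutProfile_eq_zero {R : ℝ} (hR : 0 < R) {x : Space} (hx : R ≤ ‖x‖) :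
    cutProfile R x = 0 := by
  refine max_eq_left ?_
  have : 1 ≤ ‖x‖ ^ 2 / R ^ 2 := by
    rw [one_le_div (by positivity)]
    gcongr
  linarith

theorem cutProfile_pos {R : ℝ} {x : Space} (hx : ‖x‖ < R) : 0 < cutProfile R x := by
  refine lt_max_of_lt_right ?_
  have hR : 0 < R := (norm_nonneg x).trans_lt hx
  have : ‖x‖ ^ 2 / R ^ 2 < 1 := by
    rw [div_lt_one (by positivity)]
    gcongr
  linarith

theorem cutProfile_mono {R R' : ℝ} (hR : 0 < R) (h : R ≤ R') (x : Space) :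
    cutProfile R x ≤ cutProfile R' x := by
  unfold cutProfile
  gcongr

theorem hasCompactSupport_of_cutProfile {R : ℝ} (hR : 0 < R) {F : Type} [Zero F] {f : Space → F}
    (hf : ∀ x, cutProfile R x = 0 → f x = 0) : HasCompactSupport f := by
  refine HasCompactSupport.intro (isCompact_closedBall (0 : Space) R) fun x hx => hf x ?_
  rw [mem_closedBall_zero_iff, not_le] at hx
  exact cutProfile_eq_zero hR hx.le

/-- Only an upper bound is needed, so the negative cubic term is dropped. What remains is the square
of the profile, that is, the square root of the cutoff; this is the reason for the fourth power. -/
theorem sum_cutoffDD_le {R : ℝ} (hR : 0 < R) (x : Space) :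
    ∑ i, cutoffDD R i x ≤ 48 / R ^ 2 * cutProfile R x ^ 2 := by
  rcases le_or_gt R ‖x‖ with hx | hx
  · simp [cutoffDD, cutProfile_eq_zero hR hx]
  have h1 : ∑ i, x i ^ 2 = ‖x‖ ^ 2 := by
    rw [EuclideanSpace.norm_sq_eq]
    simp
  have h2 : ∑ i, cutoffDD R i x = 12 * cutProfile R x ^ 2 * (4 * (∑ i, x i ^ 2) / (R ^ 2) ^ 2) -
      24 * cutProfile R x ^ 3 / R ^ 2 := by
    simp only [cutoffDD, Fin.sum_univ_three]
    ring
  rw [h2, h1]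
  have h3 := cutProfile_nonneg R x
  have h4 : ‖x‖ ^ 2 ≤ R ^ 2 := by gcongr
  have h5 : 4 * ‖x‖ ^ 2 / (R ^ 2) ^ 2 ≤ 4 / R ^ 2 := by
    rw [div_le_div_iff₀ (by positivity) (by positivity)]
    nlinarith [sq_nonneg R]
  have h6 : 0 ≤ 24 * cutProfile R x ^ 3 / R ^ 2 := by positivity
  calc _ ≤ 12 * cutProfile R x ^ 2 * (4 / R ^ 2) - 0 := by gcongr
    _ = _ := by ring

/-! ### Integration by parts -/

variable {E : Type} [NormedAddCommGroup E] [InnerProductSpace ℝ E]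

/-- The left integrand is the cutoff times the second derivative of `|f|²` in direction `i`. Two
integrations by parts move both derivatives to the compactly supported cutoff. -/
theorem integral_cutoff_hess {f : Space → E} (hf : ContDiff ℝ 2 f) {R : ℝ} (hR : 0 < R)
    (i : Fin 3) :
    ∫ x, cutoff R x * (2 * inner ℝ (f x) (fderiv ℝ (fderiv ℝ f) x (EuclideanSpace.single i 1)
        (EuclideanSpace.single i 1)) + 2 * ‖fderiv ℝ f x (EuclideanSpace.single i 1)‖ ^ 2) =
      ∫ x, cutoffDD R i x * ‖f x‖ ^ 2 := by
  set e : Space := EuclideanSpace.single i 1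
  have hf1 : ContDiff ℝ 1 (fderiv ℝ f) := hf.fderiv_right (by norm_num)
  have hf2 : Continuous (fderiv ℝ (fderiv ℝ f)) := hf1.continuous_fderiv one_ne_zero
  have hd : ∀ x, HasFDerivAt f (fderiv ℝ f x) x := fun x =>
    (hf.differentiable (by norm_num) x).hasFDerivAt
  have hd1 : ∀ x, HasFDerivAt (fderiv ℝ f) (fderiv ℝ (fderiv ℝ f) x) x := fun x =>
    (hf1.differentiable one_ne_zero x).hasFDerivAt
  have l0 : ∀ x, HasDerivAt (fun s : ℝ => f (x + s • e)) (fderiv ℝ f x e) 0 := fun x =>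
    (hd x).hasLineDerivAt e
  have l1 : ∀ x, HasDerivAt (fun s : ℝ => fderiv ℝ f (x + s • e) e)
      (fderiv ℝ (fderiv ℝ f) x e e) 0 := fun x => by
    have := ((hd1 x).hasLineDerivAt e).clm_apply (hasDerivAt_const (0 : ℝ) e)
    simpa using this
  have hv : ∀ x, HasLineDerivAt ℝ (fun x => ‖f x‖ ^ 2) (2 * inner ℝ (f x) (fderiv ℝ f x e)) x e :=
    fun x => by
      have := (l0 x).norm_sq
      simpa [HasLineDerivAt] using this
  have hv1 : ∀ x, HasLineDerivAt ℝ (fun x => 2 * inner ℝ (f x) (fderiv ℝ f x e))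
      (2 * inner ℝ (f x) (fderiv ℝ (fderiv ℝ f) x e e) + 2 * ‖fderiv ℝ f x e‖ ^ 2) x e :=
    fun x => by
      have := ((l0 x).inner ℝ (l1 x)).const_mul 2
      simpa [HasLineDerivAt, mul_add] using this
  have c0 := hf.continuous
  have c1 : Continuous fun x => fderiv ℝ f x e := hf1.continuous.clm_apply continuous_const
  have c2 : Continuous fun x => fderiv ℝ (fderiv ℝ f) x e e :=
    (hf2.clm_apply continuous_const).clm_apply continuous_const
  have cq := continuous_cutProfile R
  have k0 : Continuous (cutoff R) := by unfold cutoff; fun_prop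
  have k1 : Continuous (cutoffD R i) := by unfold cutoffD; fun_prop
  have k2 : Continuous (cutoffDD R i) := by unfold cutoffDD; fun_prop
  have z0 : ∀ x, cutProfile R x = 0 → cutoff R x = 0 := fun x hx => by simp [cutoff, hx]
  have z1 : ∀ x, cutProfile R x = 0 → cutoffD R i x = 0 := fun x hx => by simp [cutoffD, hx]
  have z2 : ∀ x, cutProfile R x = 0 → cutoffDD R i x = 0 := fun x hx => by simp [cutoffDD, hx]
  have hint : ∀ {g h : Space → ℝ}, Continuous g → Continuous h →
      (∀ x, cutProfile R x = 0 → g x = 0) → Integrable fun x => g x * h x := fun hg hh hz =>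
    (hg.mul hh).integrable_of_hasCompactSupport
      (hasCompactSupport_of_cutProfile hR fun x hx => by simp [hz x hx])
  have cv : Continuous fun x => ‖f x‖ ^ 2 := by fun_prop
  have cv1 : Continuous fun x => 2 * inner ℝ (f x) (fderiv ℝ f x e) :=
    continuous_const.mul (c0.inner c1)
  have cv2 : Continuous fun x => 2 * inner ℝ (f x) (fderiv ℝ (fderiv ℝ f) x e e) +
      2 * ‖fderiv ℝ f x e‖ ^ 2 :=
    (continuous_const.mul (c0.inner c2)).add (continuous_const.mul (c1.norm.pow 2))
  have i1 := integral_bilinear_hasLineDerivAt_right_eq_neg_left_of_integrable (μ := volume)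
    (B := ContinuousLinearMap.mul ℝ ℝ) (f := cutoff R) (f' := cutoffD R i) (v := e)
    (hint k1 cv1 z1) (hint k0 cv2 z0) (hint k0 cv1 z0)
    (fun x _ => hasLineDerivAt_cutoff R i x) (fun x _ => hv1 x)
  have i2 := integral_bilinear_hasLineDerivAt_right_eq_neg_left_of_integrable (μ := volume)
    (B := ContinuousLinearMap.mul ℝ ℝ) (f := cutoffD R i) (f' := cutoffDD R i) (v := e)
    (hint k2 cv z2) (hint k1 cv1 z1) (hint k1 cv z1)
    (fun x _ => hasLineDerivAt_cutoffD R i x) (fun x _ => hv x)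
  simp only [ContinuousLinearMap.mul_apply'] at i1 i2
  rw [i1, i2, neg_neg]

end QTensor

namespace QTensor

/-! ### Uniqueness -/

variable {E : Type} [NormedAddCommGroup E] [InnerProductSpace ℝ E]

theorem continuous_cutoff (R : ℝ) : Continuous (cutoff R) := by
  have := continuous_cutProfile R
  unfold cutoff
  fun_prop

theorem cutoff_nonneg (R : ℝ) (x : Space) : 0 ≤ cutoff R x :=
  pow_nonneg (cutProfile_nonneg R x) 4

theorem cutoff_le_one (R : ℝ) (x : Space) : cutoff R x ≤ 1 :=
  pow_le_one₀ (cutProfile_nonneg R x) (cutProfile_le_one R x)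

theorem integrable_cutoff_mul {R : ℝ} (hR : 0 < R) {f : Space → ℝ} (hf : Continuous f) :
    Integrable fun x => cutoff R x * f x :=
  ((continuous_cutoff R).mul hf).integrable_of_hasCompactSupport
    (hasCompactSupport_of_cutProfile hR fun x hx => by simp [cutoff, hx])

/-- A completed square with `q` the cutoff profile and `v = |w|²`. The remainder of order `R^{-4}`,
integrated over a ball of volume of order `R³`, leaves `O(1/R)`. -/
theorem absorption_le {R c q v : ℝ} (hR : 0 < R) (hc : 0 < c) :
    v * (48 / R ^ 2 * q ^ 2) ≤ 2 * c * q ^ 4 * v ^ 2 + 288 / c / R ^ 4 := by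
  have h : 0 ≤ 2 * c * (v * q ^ 2 - 12 / (c * R ^ 2)) ^ 2 := by positivity
  have e : 2 * c * (v * q ^ 2 - 12 / (c * R ^ 2)) ^ 2 =
      2 * c * q ^ 4 * v ^ 2 + 288 / c / R ^ 4 - v * (48 / R ^ 2 * q ^ 2) := by
    field_simp
    ring
  linarith

/-- The localized energy inequality for a reaction-diffusion equation with cubic absorption. -/
theorem cutoff_energy_le {f g h : Space → E} (hf : ContDiff ℝ 2 f)
    (hg : ∀ x, g x = (Δ f) x + h x) (hgc : Continuous g) {K c : ℝ} (hc : 0 < c)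
    (hh : ∀ x, inner ℝ (f x) (h x) ≤ K * ‖f x‖ ^ 2 - c * ‖f x‖ ^ 4) {R : ℝ} (hR : 0 < R) :
    ∫ x, cutoff R x * (2 * inner ℝ (f x) (g x)) ≤
      2 * K * (∫ x, cutoff R x * ‖f x‖ ^ 2) +
        288 / c * volume.real (Metric.ball (0 : Space) 1) / R := by
  have hf1 : ContDiff ℝ 1 (fderiv ℝ f) := hf.fderiv_right (by norm_num)
  have hf2 : Continuous (fderiv ℝ (fderiv ℝ f)) := hf1.continuous_fderiv one_ne_zero
  let e : Fin 3 → Space := fun i => EuclideanSpace.single i 1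
  let H : Fin 3 → Space → ℝ := fun i x =>
    2 * inner ℝ (f x) (fderiv ℝ (fderiv ℝ f) x (e i) (e i)) + 2 * ‖fderiv ℝ f x (e i)‖ ^ 2
  have c1 : ∀ i, Continuous fun x => fderiv ℝ f x (e i) := fun i =>
    hf1.continuous.clm_apply continuous_const
  have c2 : ∀ i, Continuous fun x => fderiv ℝ (fderiv ℝ f) x (e i) (e i) := fun i =>
    (hf2.clm_apply continuous_const).clm_apply continuous_const
  have hH : ∀ i, Continuous (H i) := fun i =>
    (continuous_const.mul (hf.continuous.inner (c2 i))).add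
      (continuous_const.mul ((c1 i).norm.pow 2))
  have hcq := continuous_cutProfile R
  have hfc := hf.continuous
  have i1 : Integrable fun x => cutoff R x * (2 * inner ℝ (f x) (g x)) :=
    integrable_cutoff_mul hR (continuous_const.mul (hf.continuous.inner hgc))
  have i2 : ∀ i, Integrable fun x => cutoff R x * H i x := fun i => integrable_cutoff_mul hR (hH i)
  have i3 : ∀ i, Integrable fun x => cutoffDD R i x * ‖f x‖ ^ 2 := fun i => by
    refine Continuous.integrable_of_hasCompactSupport ?_
      (hasCompactSupport_of_cutProfile hR fun x hx => by simp [cutoffDD, hx])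
    unfold cutoffDD
    fun_prop
  have i23 : ∀ i, Integrable fun x => cutoffDD R i x * ‖f x‖ ^ 2 - cutoff R x * H i x :=
    fun i => (i3 i).sub (i2 i)
  have i4 : Integrable fun x => cutoff R x * ‖f x‖ ^ 2 :=
    integrable_cutoff_mul hR (by fun_prop)
  have i5 : Integrable ((Metric.closedBall (0 : Space) R).indicator
      fun _ => 288 / c / R ^ 4) :=
    (integrableOn_const (isCompact_closedBall _ _).measure_ne_top).integrable_indicator
      Metric.isClosed_closedBall.measurableSet
  -- The summed integration by parts is added as a zero, after which the estimate can be proved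
  -- pointwise under a single integral.
  have h0 : ∑ i, ((∫ x, cutoffDD R i x * ‖f x‖ ^ 2) - ∫ x, cutoff R x * H i x) = 0 := by
    refine Finset.sum_eq_zero fun i _ => ?_
    rw [integral_cutoff_hess hf hR i, sub_self]
  have h1 : ∫ x, cutoff R x * (2 * inner ℝ (f x) (g x)) = ∫ x, (cutoff R x *
      (2 * inner ℝ (f x) (g x)) + ∑ i, (cutoffDD R i x * ‖f x‖ ^ 2 - cutoff R x * H i x)) := by
    rw [integral_add i1 (integrable_finsetSum _ fun i _ => i23 i),
      integral_finsetSum _ fun i _ => i23 i]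
    simp only [integral_sub (i3 _) (i2 _), h0, add_zero]
  rw [h1]
  have h2 : ∀ x, cutoff R x * (2 * inner ℝ (f x) (g x)) +
      ∑ i, (cutoffDD R i x * ‖f x‖ ^ 2 - cutoff R x * H i x) ≤
      2 * K * (cutoff R x * ‖f x‖ ^ 2) +
        (Metric.closedBall (0 : Space) R).indicator (fun _ => 288 / c / R ^ 4) x := by
    intro x
    rcases le_or_gt R ‖x‖ with hx | hx
    · have hz := cutProfile_eq_zero hR hx
      have : 0 ≤ (Metric.closedBall (0 : Space) R).indicator (fun _ => 288 / c / R ^ 4) x :=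
        indicator_nonneg (fun _ _ => by positivity) x
      simpa [cutoff, cutoffDD, hz] using this
    · have hmem : x ∈ Metric.closedBall (0 : Space) R := by simpa using hx.le
      rw [indicator_of_mem hmem]
      have hl : inner ℝ (f x) (g x) =
          ∑ i, inner ℝ (f x) (fderiv ℝ (fderiv ℝ f) x (e i) (e i)) + inner ℝ (f x) (h x) := by
        rw [hg x, laplacian_eq_traceHess, traceHess_apply, inner_add_right, inner_sum]
      have hs : ∑ i, (cutoffDD R i x * ‖f x‖ ^ 2 - cutoff R x * H i x) =
          ‖f x‖ ^ 2 * ∑ i, cutoffDD R i x -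
          cutoff R x * (2 * ∑ i, inner ℝ (f x) (fderiv ℝ (fderiv ℝ f) x (e i) (e i))) -
          cutoff R x * (2 * ∑ i, ‖fderiv ℝ f x (e i)‖ ^ 2) := by
        simp only [H, Fin.sum_univ_three]
        ring
      rw [hs, hl]
      have h3 : 0 ≤ cutoff R x * (2 * ∑ i, ‖fderiv ℝ f x (e i)‖ ^ 2) :=
        mul_nonneg (cutoff_nonneg R x)
          (mul_nonneg zero_le_two (Finset.sum_nonneg fun i _ => sq_nonneg _))
      have h4 := mul_le_mul_of_nonneg_left (sum_cutoffDD_le hR x) (sq_nonneg ‖f x‖)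
      have h5 := absorption_le (q := cutProfile R x) (v := ‖f x‖ ^ 2) hR hc
      have h6 := mul_le_mul_of_nonneg_left (hh x) (cutoff_nonneg R x)
      have h7 : cutoff R x = cutProfile R x ^ 4 := rfl
      rw [← h7] at h5
      nlinarith
  refine (integral_mono (i1.add (integrable_finsetSum _ fun i _ => i23 i))
    ((i4.const_mul _).add i5) h2).trans (le_of_eq ?_)
  simp only [Pi.add_apply]
  rw [integral_add (i4.const_mul _) i5, integral_const_mul,
    integral_indicator Metric.isClosed_closedBall.measurableSet, setIntegral_const,
    Measure.addHaar_real_closedBall _ _ hR.le, smul_eq_mul]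
  congr 1
  simp only [finrank_euclideanSpace, Fintype.card_fin]
  rw [measureReal_def]
  field_simp

/-- The function `e^{-Kt} y - Dt` is nonincreasing on `t > 0` and tends to `0` at `0`; no value of
`y` at `0` is involved. -/
theorem gronwall_le {y y' : ℝ → ℝ} {K D : ℝ} (hK : 0 ≤ K) (hD : 0 ≤ D)
    (hy : ∀ t, 0 < t → HasDerivAt y (y' t) t) (hy' : ∀ t, 0 < t → y' t ≤ K * y t + D)
    (h0 : Tendsto y (𝓝[>] 0) (𝓝 0)) {t : ℝ} (ht : 0 < t) : y t ≤ D * t * Real.exp (K * t) := by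
  let z : ℝ → ℝ := fun s => Real.exp (-K * s) * y s - D * s
  have hz : ∀ s, 0 < s → HasDerivAt z
      (Real.exp (-K * s) * (-K) * y s + Real.exp (-K * s) * y' s - D) s := by
    intro s hs
    have h1 : HasDerivAt (fun s => Real.exp (-K * s)) (Real.exp (-K * s) * (-K)) s := by
      simpa using ((hasDerivAt_id s).const_mul (-K)).exp
    have h2 := (h1.fun_mul (hy s hs)).fun_sub ((hasDerivAt_id s).const_mul D)
    rw [mul_one] at h2
    exact h2
  have hanti : AntitoneOn z (Ioi 0) := by
    refine antitoneOn_of_deriv_nonpos (convex_Ioi 0)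
      (fun s hs => (hz s hs).continuousAt.continuousWithinAt)
      (fun s hs => (hz s (by simpa using hs)).differentiableAt.differentiableWithinAt) fun s hs => ?_
    have hs' : 0 < s := by simpa using hs
    rw [(hz s hs').deriv]
    have h2 : Real.exp (-K * s) ≤ 1 := Real.exp_le_one_iff.2 (by nlinarith)
    have h3 := mul_le_mul_of_nonneg_left (hy' s hs') (Real.exp_nonneg (-K * s))
    nlinarith
  have hlim : Tendsto z (𝓝[>] 0) (𝓝 0) := by
    have h4 : Tendsto (fun s => Real.exp (-K * s)) (𝓝[>] 0) (𝓝 1) := by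
      have : Continuous fun s => Real.exp (-K * s) := by fun_prop
      simpa using (this.tendsto 0).mono_left (nhdsWithin_le_nhds (s := Ioi (0 : ℝ)))
    have h5 : Tendsto (fun s => D * s) (𝓝[>] 0) (𝓝 0) := by
      have : Continuous fun s => D * s := by fun_prop
      simpa using (this.tendsto 0).mono_left (nhdsWithin_le_nhds (s := Ioi (0 : ℝ)))
    simpa [z] using (h4.mul h0).sub h5
  have h6 : z t ≤ 0 := by
    refine ge_of_tendsto hlim ?_
    filter_upwards [Ioo_mem_nhdsGT ht] with s hs
    exact hanti hs.1 ht hs.2.le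
  have h7 : Real.exp (-K * t) * y t ≤ D * t := by simpa [z] using h6
  have h8 := mul_le_mul_of_nonneg_left h7 (Real.exp_nonneg (K * t))
  rw [← mul_assoc, ← Real.exp_add] at h8
  simp only [neg_mul, add_neg_cancel, Real.exp_zero, one_mul] at h8
  linarith

theorem tendsto_cutoff_integral {w : Space → ℝ → E}
    (hwc : ContinuousOn (fun p : Space × ℝ => w p.1 p.2) (univ ×ˢ Ioi 0))
    (h0 : Tendsto (fun t => eLpNorm (fun x => w x t) 2 volume) (𝓝[>] 0) (𝓝 0)) (R : ℝ) :
    Tendsto (fun t => ∫ x, cutoff R x * ‖w x t‖ ^ 2) (𝓝[>] 0) (𝓝 0) := by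
  have h1 : Tendsto (fun t => (eLpNorm (fun x => w x t) 2 volume) ^ 2) (𝓝[>] 0) (𝓝 0) := by
    simpa using ENNReal.Tendsto.pow (n := 2) h0
  have h2 := (ENNReal.tendsto_toReal ENNReal.zero_ne_top).comp h1
  rw [ENNReal.toReal_zero] at h2
  refine tendsto_of_tendsto_of_tendsto_of_le_of_le' tendsto_const_nhds h2
    (Eventually.of_forall fun t => integral_nonneg fun x =>
      mul_nonneg (cutoff_nonneg R x) (sq_nonneg _)) ?_
  filter_upwards [self_mem_nhdsWithin,
    h1.eventually (gt_mem_nhds ENNReal.zero_lt_top)] with t ht hfin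
  have hslice : Continuous fun x => w x t :=
    continuousOn_univ.1 (hwc.comp (f := fun x => (x, t)) (by fun_prop) fun x _ => ⟨mem_univ _, ht⟩)
  rw [integral_eq_lintegral_of_nonneg_ae
    (Eventually.of_forall fun x => mul_nonneg (cutoff_nonneg R x) (sq_nonneg _))
    ((continuous_cutoff R).mul (by fun_prop)).aestronglyMeasurable]
  refine ENNReal.toReal_mono hfin.ne ?_
  have h3 : (eLpNorm (fun x => w x t) 2 volume) ^ 2 = ∫⁻ x, ‖w x t‖ₑ ^ 2 := by
    have := eLpNorm_nnreal_pow_eq_lintegral (μ := volume) (f := fun x => w x t) (p := 2)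
      two_ne_zero
    simpa using! this
  show _ ≤ (eLpNorm (fun x => w x t) 2 volume) ^ 2
  rw [h3]
  refine lintegral_mono fun x => ?_
  rw [← ofReal_norm, ← ENNReal.ofReal_pow (norm_nonneg _)]
  exact ENNReal.ofReal_le_ofReal (mul_le_of_le_one_left (sq_nonneg _) (cutoff_le_one R x))

/-- The energy in the cutoff of radius `R` is at most a constant times `1/R` at a fixed time.
Absorption replaces any growth condition at spatial infinity. -/
theorem eq_zero_of_absorption {w G : Space → ℝ → E}
    (hw : ContDiffOn ℝ ∞ (fun p : Space × ℝ => w p.1 p.2) (univ ×ˢ Ioi 0))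
    (hd : ∀ x t, 0 < t → deriv (fun s => w x s) t = (Δ fun y => w y t) x + G x t)
    {K c : ℝ} (hK : 0 ≤ K) (hc : 0 < c)
    (hG : ∀ x t, 0 < t → inner ℝ (w x t) (G x t) ≤ K * ‖w x t‖ ^ 2 - c * ‖w x t‖ ^ 4)
    (h0 : Tendsto (fun t => eLpNorm (fun x => w x t) 2 volume) (𝓝[>] 0) (𝓝 0))
    (x : Space) {t : ℝ} (ht : 0 < t) : w x t = 0 := by
  have hopen : IsOpen ((univ : Set Space) ×ˢ Ioi (0 : ℝ)) := isOpen_univ.prod isOpen_Ioi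
  have hwc := hw.continuousOn
  have hdiff : ∀ x t, 0 < t → DifferentiableAt ℝ (fun p : Space × ℝ => w p.1 p.2) (x, t) :=
    fun x t ht => (hw.contDiffAt (hopen.mem_nhds
      (show (x, t) ∈ univ ×ˢ Ioi 0 from ⟨mem_univ _, ht⟩))).differentiableAt (by simp)
  have hderiv : ∀ x t, 0 < t → HasDerivAt (fun s => w x s)
      (fderiv ℝ (fun p : Space × ℝ => w p.1 p.2) (x, t) (0, 1)) t := fun x t ht =>
    (hdiff x t ht).hasFDerivAt.comp_hasDerivAt t ((hasDerivAt_const t x).prodMk (hasDerivAt_id t))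
  let wt : Space → ℝ → E := fun x t => deriv (fun s => w x s) t
  have hwt : ∀ x t, 0 < t → HasDerivAt (fun s => w x s) (wt x t) t := fun x t ht =>
    (hderiv x t ht).differentiableAt.hasDerivAt
  have hwtc : ContinuousOn (fun p : Space × ℝ => wt p.1 p.2) (univ ×ˢ Ioi 0) :=
    ((hw.continuousOn_fderiv_of_isOpen hopen (by simp)).clm_apply
      (continuousOn_const (c := ((0 : Space), (1 : ℝ))))).congr
      fun p hp => (hderiv p.1 p.2 hp.2).deriv
  have slice : ∀ {v : Space → ℝ → E} {t : ℝ}, 0 < t →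
      ContinuousOn (fun p : Space × ℝ => v p.1 p.2) (univ ×ˢ Ioi 0) → Continuous fun x => v x t :=
    fun ht hv => continuousOn_univ.1
      (hv.comp (f := fun x => (x, _)) (by fun_prop) fun x _ => ⟨mem_univ _, ht⟩)
  have hslice : ∀ t, 0 < t → ContDiff ℝ 2 fun x => w x t := fun t ht =>
    contDiffOn_univ.1 ((hw.of_le (WithTop.coe_le_coe.2 le_top)).comp (f := fun x => (x, t))
      (by fun_prop) fun x _ => ⟨mem_univ _, ht⟩)
  have hy : ∀ {R : ℝ}, 0 < R → ∀ t, 0 < t →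
      HasDerivAt (fun t => ∫ x, cutoff R x * ‖w x t‖ ^ 2)
        (∫ x, cutoff R x * (2 * inner ℝ (w x t) (wt x t))) t := by
    intro R hR t ht
    have hK : IsCompact (Metric.closedBall (0 : Space) R ×ˢ Icc (t / 2) (2 * t)) :=
      (isCompact_closedBall _ _).prod isCompact_Icc
    have hin : ContinuousOn (fun p : Space × ℝ => 2 * inner ℝ (w p.1 p.2) (wt p.1 p.2))
        (univ ×ˢ Ioi 0) := continuousOn_const.mul (hwc.inner hwtc)
    obtain ⟨C, hC⟩ := hK.exists_bound_of_continuousOn (hin.mono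
      (prod_mono (subset_univ _) fun s hs => lt_of_lt_of_le (by positivity : 0 < t / 2) hs.1))
    refine (hasDerivAt_integral_of_dominated_loc_of_deriv_le
      (F := fun t x => cutoff R x * ‖w x t‖ ^ 2)
      (F' := fun t x => cutoff R x * (2 * inner ℝ (w x t) (wt x t)))
      (bound := fun x => cutoff R x * C)
      (Icc_mem_nhds (by linarith : t / 2 < t) (by linarith : t < 2 * t)) ?_ ?_ ?_ ?_ ?_ ?_).2
    · filter_upwards [Ioi_mem_nhds ht] with s hs
      have := slice hs hwc
      exact ((continuous_cutoff R).mul (by fun_prop)).aestronglyMeasurable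
    · have := slice ht hwc
      exact integrable_cutoff_mul hR (by fun_prop)
    · exact ((continuous_cutoff R).mul (continuous_const.mul
        ((slice ht hwc).inner (slice ht hwtc)))).aestronglyMeasurable
    · refine Eventually.of_forall fun x s hs => ?_
      rw [norm_mul, Real.norm_of_nonneg (cutoff_nonneg R x)]
      rcases le_or_gt R ‖x‖ with hx | hx
      · simp [cutoff, cutProfile_eq_zero hR hx]
      · exact mul_le_mul_of_nonneg_left (hC (x, s) ⟨by simpa using hx.le, hs⟩) (cutoff_nonneg R x)
    · exact integrable_cutoff_mul hR continuous_const
    · refine Eventually.of_forall fun x s hs => ?_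
      exact (hwt x s (lt_of_lt_of_le (by positivity : 0 < t / 2) hs.1)).norm_sq.const_mul _
  have hbound : ∀ {R : ℝ}, 0 < R → ∫ x, cutoff R x * ‖w x t‖ ^ 2 ≤
      288 / c * volume.real (Metric.ball (0 : Space) 1) / R * t *
        Real.exp (2 * K * t) := by
    intro R hR
    refine gronwall_le (by positivity) (by positivity) (hy hR) (fun s hs => ?_)
      (tendsto_cutoff_integral hwc h0 R) ht
    exact cutoff_energy_le (hslice s hs) (fun x => hd x s hs) (slice hs hwtc) hc
      (fun x => hG x s hs) hR
  by_contra hne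
  set R₀ : ℝ := ‖x‖ + 1 with hR₀
  have hR₀p : 0 < R₀ := by positivity
  have hsw := slice ht hwc
  have hpos : 0 < ∫ x, cutoff R₀ x * ‖w x t‖ ^ 2 := by
    refine Continuous.integral_pos_of_hasCompactSupport_nonneg_nonzero (x := x)
      ((continuous_cutoff R₀).mul (by fun_prop))
      (hasCompactSupport_of_cutProfile hR₀p fun x hx => by simp [cutoff, hx])
      (fun x => mul_nonneg (cutoff_nonneg _ x) (sq_nonneg _)) ?_
    have h1 : 0 < cutProfile R₀ x := cutProfile_pos (by linarith)
    have h2 : ‖w x t‖ ≠ 0 := norm_ne_zero_iff.2 hne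
    have h3 : 0 < cutoff R₀ x := pow_pos h1 4
    exact mul_ne_zero h3.ne' (pow_ne_zero 2 h2)
  -- The cutoffs increase with the radius, so the energy at radius `R₀` inherits the bound for every
  -- larger `R`, and these bounds tend to `0`.
  have hle : ∀ R, R₀ ≤ R → ∫ x, cutoff R₀ x * ‖w x t‖ ^ 2 ≤
      288 / c * volume.real (Metric.ball (0 : Space) 1) / R * t *
        Real.exp (2 * K * t) := by
    intro R hR
    have hRp := hR₀p.trans_le hR
    refine le_trans (integral_mono (integrable_cutoff_mul hR₀p (by fun_prop))
      (integrable_cutoff_mul hRp (by fun_prop)) fun x => ?_) (hbound hRp)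
    have h1 := cutProfile_mono hR₀p hR x
    have h2 := cutProfile_nonneg R₀ x
    simp only [cutoff]
    gcongr
  have hlim : Tendsto (fun R : ℝ => 288 / c * volume.real (Metric.ball (0 : Space) 1) / R *
      t * Real.exp (2 * K * t)) atTop (𝓝 0) := by
    have h1 : Tendsto (fun R : ℝ => 288 / c * volume.real (Metric.ball (0 : Space) 1) / R)
      atTop (𝓝 0) := tendsto_const_nhds.div_atTop tendsto_id
    simpa using (h1.mul_const t).mul_const (Real.exp (2 * K * t))
  have := ge_of_tendsto hlim (eventually_atTop.2 ⟨R₀, hle⟩)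
  linarith

end QTensor

namespace QTensor

/-! ### Bounds for the reaction term -/

section

variable {E : Type} [NormedAddCommGroup E] [NormedSpace ℝ E]

theorem norm_bilin_sub_le (B : E →L[ℝ] E →L[ℝ] E) (u v : E) :
    ‖B u u - B v v‖ ≤ ‖B‖ * (‖u‖ + ‖v‖) * ‖u - v‖ := by
  have h : B u u - B v v = B (u - v) u + B v (u - v) := by simp
  rw [h]
  refine (norm_add_le_of_le (B.le_opNorm₂ _ _) (B.le_opNorm₂ _ _)).trans (le_of_eq ?_)
  ring

theorem norm_cubic_sub_le (S : E →L[ℝ] E →L[ℝ] ℝ) {u v : E} {R : ℝ} (hu : ‖u‖ ≤ R)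
    (hv : ‖v‖ ≤ R) : ‖S u u • u - S v v • v‖ ≤ 3 * ‖S‖ * R ^ 2 * ‖u - v‖ := by
  have h : S u u • u - S v v • v = S u u • (u - v) + (S (u - v) u • v + S v (u - v) • v) := by
    simp only [map_sub, sub_apply, smul_sub, sub_smul]
    abel
  have h0 : 0 ≤ R := (norm_nonneg u).trans hu
  have hS : 0 ≤ ‖S‖ := norm_nonneg _
  have h1 : ‖S u u • (u - v)‖ ≤ ‖S‖ * R * R * ‖u - v‖ := by
    rw [norm_smul]
    gcongr
    exact (S.le_opNorm₂ _ _).trans (by gcongr)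
  have h2 : ‖S (u - v) u • v‖ ≤ ‖S‖ * ‖u - v‖ * R * R := by
    rw [norm_smul]
    gcongr
    exact (S.le_opNorm₂ _ _).trans (by gcongr)
  have h3 : ‖S v (u - v) • v‖ ≤ ‖S‖ * R * ‖u - v‖ * R := by
    rw [norm_smul]
    gcongr
    exact (S.le_opNorm₂ _ _).trans (by gcongr)
  rw [h]
  refine (norm_add_le_of_le h1 (norm_add_le_of_le h2 h3)).trans (le_of_eq ?_)
  ring

/-- On the ball of radius `r e^{κt}` the quadratic term gains `r e^{κt} e^{-at}` and the cubic one
its square. Both are at most `r e^{-(a-κ)t}` because `r ≤ 1` and `κ ≤ a`. -/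
theorem smallLip_reaction {a b c κ : ℝ} (hb : 0 ≤ b) (hc : 0 ≤ c) (hκ : κ ≤ a)
    (B : E →L[ℝ] E →L[ℝ] E) (S : E →L[ℝ] E →L[ℝ] ℝ) :
    SmallLip (reaction (fun t => b * Real.exp (-a * t)) (fun t => c * Real.exp (-(2 * a) * t)) B S)
      a κ (2 * b * ‖B‖ + 3 * c * ‖S‖) where
  cont := by
    unfold reaction
    fun_prop
  zero t := by simp [reaction]
  lip := by
    intro t ht r hr u v hu hv
    set R := r * Real.exp (κ * t) with hR
    have hR0 : 0 ≤ R := (norm_nonneg u).trans hu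
    have hr0 : 0 ≤ r := nonneg_of_mul_nonneg_left hR0 (Real.exp_pos _)
    have e : reaction (fun t => b * Real.exp (-a * t)) (fun t => c * Real.exp (-(2 * a) * t)) B S t u -
        reaction (fun t => b * Real.exp (-a * t)) (fun t => c * Real.exp (-(2 * a) * t)) B S t v =
        (b * Real.exp (-a * t)) • (B u u - B v v) -
          (c * Real.exp (-(2 * a) * t)) • (S u u • u - S v v • v) := by
      simp only [reaction, smul_sub]
      abel
    have h1 : ‖(b * Real.exp (-a * t)) • (B u u - B v v)‖ ≤
        2 * b * ‖B‖ * r * Real.exp (-(a - κ) * t) * ‖u - v‖ := by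
      rw [norm_smul, Real.norm_of_nonneg (by positivity)]
      calc b * Real.exp (-a * t) * ‖B u u - B v v‖
          ≤ b * Real.exp (-a * t) * (‖B‖ * (R + R) * ‖u - v‖) := by
            gcongr
            exact (norm_bilin_sub_le B u v).trans (by gcongr)
        _ = 2 * b * ‖B‖ * r * (Real.exp (-a * t) * Real.exp (κ * t)) * ‖u - v‖ := by
            rw [hR]; ring
        _ = _ := by
            rw [← Real.exp_add]
            congr 3
            ring_nf
    have h2 : ‖(c * Real.exp (-(2 * a) * t)) • (S u u • u - S v v • v)‖ ≤
        3 * c * ‖S‖ * r * Real.exp (-(a - κ) * t) * ‖u - v‖ := by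
      rw [norm_smul, Real.norm_of_nonneg (by positivity)]
      have h3 : Real.exp (-(a - κ) * t) ≤ 1 := Real.exp_le_one_iff.2 (by nlinarith)
      calc c * Real.exp (-(2 * a) * t) * ‖S u u • u - S v v • v‖
          ≤ c * Real.exp (-(2 * a) * t) * (3 * ‖S‖ * R ^ 2 * ‖u - v‖) := by
            gcongr
            exact norm_cubic_sub_le S hu hv
        _ = 3 * c * ‖S‖ * (r * r) *
            (Real.exp (-(2 * a) * t) * Real.exp (κ * t) * Real.exp (κ * t)) * ‖u - v‖ := by
            rw [hR]; ring
        _ = 3 * c * ‖S‖ * (r * r) *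
            (Real.exp (-(a - κ) * t) * Real.exp (-(a - κ) * t)) * ‖u - v‖ := by
            simp only [← Real.exp_add]
            congr 3
            ring_nf
        _ ≤ 3 * c * ‖S‖ * (1 * r) * (1 * Real.exp (-(a - κ) * t)) * ‖u - v‖ := by gcongr
        _ = _ := by ring
    rw [e]
    refine (norm_sub_le_of_le h1 h2).trans (le_of_eq ?_)
    ring

end

section

variable {E : Type} [NormedAddCommGroup E] [InnerProductSpace ℝ E]

/-- The two sides differ by exactly `(|u|² - |v|²)² / 2`: a quantitative monotonicity of the cubic
map. -/
theorem inner_cubic_sub_ge (u v : E) :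
    (‖u‖ ^ 2 + ‖v‖ ^ 2) / 2 * ‖u - v‖ ^ 2 ≤
      inner ℝ (u - v) (‖u‖ ^ 2 • u - ‖v‖ ^ 2 • v) := by
  have h1 := norm_sub_sq_real u v
  simp only [inner_sub_left, inner_sub_right, inner_smul_right, real_inner_self_eq_norm_sq,
    real_inner_comm u v]
  nlinarith [mul_self_nonneg (‖u‖ ^ 2 - ‖v‖ ^ 2)]

/-- One-sided Lipschitz bound with cubic absorption for the autonomous reaction term. -/
theorem inner_reaction_sub_le {a b c : ℝ} (ha : 0 ≤ a) (hb : 0 ≤ b) (hc : 0 < c)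
    (B : E →L[ℝ] E →L[ℝ] E) (u v : E) :
    inner ℝ (u - v) (-(a • (u - v)) + b • (B u u - B v v) - c • (‖u‖ ^ 2 • u - ‖v‖ ^ 2 • v)) ≤
      2 * (b * ‖B‖) ^ 2 / c * ‖u - v‖ ^ 2 - c / 8 * ‖u - v‖ ^ 4 := by
  set w := u - v with hw
  have h1 := inner_cubic_sub_ge u v
  rw [← hw] at h1
  have h2 : inner ℝ w (B u u - B v v) ≤ ‖B‖ * (‖u‖ + ‖v‖) * ‖w‖ ^ 2 := by
    refine (real_inner_le_norm _ _).trans ?_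
    have := mul_le_mul_of_nonneg_left (norm_bilin_sub_le B u v) (norm_nonneg w)
    rw [← hw] at this
    linarith
  have h3 : inner ℝ w (-(a • w) + b • (B u u - B v v) - c • (‖u‖ ^ 2 • u - ‖v‖ ^ 2 • v)) =
      -(a * ‖w‖ ^ 2) + b * inner ℝ w (B u u - B v v) -
        c * inner ℝ w (‖u‖ ^ 2 • u - ‖v‖ ^ 2 • v) := by
    simp only [inner_sub_right, inner_add_right, inner_smul_right, inner_neg_right,
      real_inner_self_eq_norm_sq]
  have h4 : ‖w‖ ^ 2 ≤ 2 * (‖u‖ ^ 2 + ‖v‖ ^ 2) := by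
    have := norm_sub_le u v
    rw [← hw] at this
    nlinarith [norm_nonneg w, norm_nonneg u, norm_nonneg v, sq_nonneg (‖u‖ - ‖v‖)]
  have h5 : (‖u‖ + ‖v‖) ^ 2 ≤ 2 * (‖u‖ ^ 2 + ‖v‖ ^ 2) := by
    nlinarith [sq_nonneg (‖u‖ - ‖v‖)]
  set n := b * ‖B‖ with hn
  -- Young's inequality with the weight chosen to use half of the coercive term `(c/2)(|u|² +
  -- |v|²)`. By `h4` the other half still controls `(c/8)|w|²`.
  have h6 : n * (‖u‖ + ‖v‖) ≤ 2 * n ^ 2 / c + c / 8 * (‖u‖ + ‖v‖) ^ 2 := by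
    have h : 0 ≤ c / 8 * (‖u‖ + ‖v‖ - 4 * n / c) ^ 2 := by positivity
    have e : c / 8 * (‖u‖ + ‖v‖ - 4 * n / c) ^ 2 =
        2 * n ^ 2 / c + c / 8 * (‖u‖ + ‖v‖) ^ 2 - n * (‖u‖ + ‖v‖) := by
      field_simp
      ring
    linarith
  rw [h3]
  have hw0 : 0 ≤ ‖w‖ ^ 2 := sq_nonneg _
  have h7 := mul_le_mul_of_nonneg_left h2 hb
  have h8 := mul_le_mul_of_nonneg_left h1 hc.le
  have h9 := mul_le_mul_of_nonneg_right h6 hw0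
  have h10 := mul_le_mul_of_nonneg_right (mul_le_mul_of_nonneg_left h5 hc.le) hw0
  have h11 := mul_le_mul_of_nonneg_right (mul_le_mul_of_nonneg_left h4 hc.le) hw0
  have h12 := mul_nonneg ha hw0
  nlinarith

end

/-! ### Symmetric traceless matrices -/

instance : FiniteDimensional ℝ Sym0 := inferInstanceAs (FiniteDimensional ℝ sym0)

instance : CompleteSpace Sym0 := FiniteDimensional.complete ℝ Sym0

theorem trSq_eq_norm_sq (Q : Sym0) : trSq Q = ‖Q‖ ^ 2 := by
  rw [← real_inner_self_eq_norm_sq]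
  rfl

/-- The symmetric bilinear form polarizing `devSq`. -/
def devBilAux (P Q : Sym0) : Sym0 :=
  ⟨(1 / 2 : ℝ) • (P.toMatrix * Q.toMatrix + Q.toMatrix * P.toMatrix) -
      ((P.toMatrix * Q.toMatrix).trace / 3) • (1 : Matrix (Fin 3) (Fin 3) ℝ), by
    refine ⟨?_, ?_⟩
    · rw [Matrix.transpose_sub, Matrix.transpose_smul, Matrix.transpose_add, Matrix.transpose_mul,
        Matrix.transpose_mul, Q.transpose_toMatrix, P.transpose_toMatrix, Matrix.transpose_smul,
        Matrix.transpose_one, add_comm]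
    · rw [Matrix.trace_sub, Matrix.trace_smul, Matrix.trace_smul, Matrix.trace_add,
        Matrix.trace_mul_comm Q.toMatrix P.toMatrix, Matrix.trace_one, Fintype.card_fin,
        smul_eq_mul, smul_eq_mul]
      push_cast
      ring⟩

theorem toMatrix_devBilAux (P Q : Sym0) : (devBilAux P Q).toMatrix =
    (1 / 2 : ℝ) • (P.toMatrix * Q.toMatrix + Q.toMatrix * P.toMatrix) -
      ((P.toMatrix * Q.toMatrix).trace / 3) • (1 : Matrix (Fin 3) (Fin 3) ℝ) := rfl

/-- The bounded bilinear map polarizing `devSq`. -/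
def devBil : Sym0 →L[ℝ] Sym0 →L[ℝ] Sym0 :=
  LinearMap.toContinuousBilinearMap <| LinearMap.mk₂ ℝ devBilAux
    (fun P P' Q => Sym0.toMatrix_injective <| by
      simp only [map_add, toMatrix_devBilAux, add_mul, mul_add, Matrix.trace_add, smul_add,
        add_div, add_smul]
      abel)
    (fun r P Q => Sym0.toMatrix_injective <| by
      simp only [map_smul, toMatrix_devBilAux, Matrix.smul_mul, Matrix.mul_smul, Matrix.trace_smul,
        smul_add, smul_sub, smul_smul, smul_eq_mul, mul_comm r, div_mul_eq_mul_div])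
    (fun P Q Q' => Sym0.toMatrix_injective <| by
      simp only [map_add, toMatrix_devBilAux, add_mul, mul_add, Matrix.trace_add, smul_add,
        add_div, add_smul]
      abel)
    (fun r P Q => Sym0.toMatrix_injective <| by
      simp only [map_smul, toMatrix_devBilAux, Matrix.smul_mul, Matrix.mul_smul, Matrix.trace_smul,
        smul_add, smul_sub, smul_smul, smul_eq_mul, mul_comm r, div_mul_eq_mul_div])

theorem devBil_self (Q : Sym0) : devBil Q Q = devSq Q := by
  apply Sym0.toMatrix_injective
  change (1 / 2 : ℝ) • (Q.toMatrix * Q.toMatrix + Q.toMatrix * Q.toMatrix) -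
      ((Q.toMatrix * Q.toMatrix).trace / 3) • (1 : Matrix (Fin 3) (Fin 3) ℝ) =
    Q.toMatrix * Q.toMatrix - (trSq Q / 3) • (1 : Matrix (Fin 3) (Fin 3) ℝ)
  rw [← two_smul ℝ (Q.toMatrix * Q.toMatrix), smul_smul]
  norm_num [trSq]

/-- The initial data cancel in the difference, which therefore tends to `0` in `L²` as `t ↓ 0`; the
absorption argument does the rest. -/
theorem IsSmoothSolution.unique {a b c : ℝ} (ha : 0 ≤ a) (hb : 0 ≤ b) (hc : 0 < c)
    {Q₀ : Space → Sym0} (hQ₀ : AEStronglyMeasurable Q₀) {P Q : Space → ℝ → Sym0}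
    (hP : IsSmoothSolution a b c Q₀ P) (hQ : IsSmoothSolution a b c Q₀ Q) (x : Space) {t : ℝ}
    (ht : 0 < t) : P x t = Q x t := by
  have hopen : IsOpen ((univ : Set Space) ×ˢ Ioi (0 : ℝ)) := isOpen_univ.prod isOpen_Ioi
  have hslice : ∀ {W : Space → ℝ → Sym0} {t : ℝ}, 0 < t →
      ContDiffOn ℝ ∞ (fun p : Space × ℝ => W p.1 p.2) (univ ×ˢ Ioi 0) →
      ContDiff ℝ 2 fun x => W x t := fun {W t} ht hW =>
    contDiffOn_univ.1 ((hW.of_le (WithTop.coe_le_coe.2 le_top)).comp (f := fun x => (x, t))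
      (by fun_prop) fun x _ => ⟨mem_univ _, ht⟩)
  have hdiff : ∀ {W : Space → ℝ → Sym0} (x : Space) {t : ℝ}, 0 < t →
      ContDiffOn ℝ ∞ (fun p : Space × ℝ => W p.1 p.2) (univ ×ˢ Ioi 0) →
      DifferentiableAt ℝ (fun s => W x s) t := fun {W} x t ht hW =>
    (((hW.contDiffAt (hopen.mem_nhds (show (x, t) ∈ univ ×ˢ Ioi 0 from ⟨mem_univ _, ht⟩))).differentiableAt
      (by simp)).hasFDerivAt.comp_hasDerivAt t
        ((hasDerivAt_const t x).prodMk (hasDerivAt_id t))).differentiableAt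
  refine sub_eq_zero.1 (eq_zero_of_absorption (w := fun x t => P x t - Q x t)
    (G := fun x t => -(a • (P x t - Q x t)) + b • (devBil (P x t) (P x t) - devBil (Q x t) (Q x t)) -
      c • (‖P x t‖ ^ 2 • P x t - ‖Q x t‖ ^ 2 • Q x t)) (hP.smooth.sub hQ.smooth) ?_
    (K := 2 * (b * ‖devBil‖) ^ 2 / c) (c := c / 8) (by positivity) (by positivity)
    (fun x t _ => inner_reaction_sub_le ha hb hc devBil (P x t) (Q x t)) ?_ x ht)
  · intro x t ht
    have h1 : (Δ fun y => P y t - Q y t) x = (Δ fun y => P y t) x - (Δ fun y => Q y t) x := by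
      have := (hslice ht hP.smooth).contDiffAt (x := x).laplacian_sub
        ((hslice ht hQ.smooth).contDiffAt (x := x))
      simpa using! this
    rw [h1, deriv_fun_sub (hdiff x ht hP.smooth) (hdiff x ht hQ.smooth), hP.equation x t ht,
      hQ.equation x t ht]
    simp only [devBil_self, trSq_eq_norm_sq, smul_sub, mul_smul]
    abel
  · have h2 := hP.initial.add hQ.initial
    rw [add_zero] at h2
    refine tendsto_of_tendsto_of_tendsto_of_le_of_le' tendsto_const_nhds h2
      (Eventually.of_forall fun _ => zero_le) ?_
    filter_upwards [self_mem_nhdsWithin] with t ht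
    have e : (fun x => P x t - Q x t) = (fun x => P x t - Q₀ x) - fun x => Q x t - Q₀ x := by
      ext1 x
      simp
    rw [e]
    refine (eLpNorm_sub_le ((hP.memH t ht).1.1.sub hQ₀) ((hQ.memH t ht).1.1.sub hQ₀)
      one_le_two).trans ?_
    exact add_le_add (le_max_left _ _) (le_max_left _ _)

end QTensor

namespace QTensor

/-! ### Large time asymptotics of the heat semigroup -/

variable {E : Type} [NormedAddCommGroup E] [NormedSpace ℝ E]

theorem exp_neg_sq_le {q n : ℝ} (hq : 0 ≤ q) (hn : 0 ≤ n) :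
    Real.exp (-(1 / 4) * n ^ 2) ≤ Real.exp (q ^ 2) * (1 + n) ^ (-q) := by
  have h1 : (1 + n) ^ q ≤ Real.exp (q * n) := by
    rw [mul_comm, Real.exp_mul]
    exact Real.rpow_le_rpow (by positivity) (by linarith [Real.add_one_le_exp n]) hq
  have h2 : Real.exp (-(1 / 4) * n ^ 2) * (1 + n) ^ q ≤ Real.exp (q ^ 2) := by
    calc Real.exp (-(1 / 4) * n ^ 2) * (1 + n) ^ q
        ≤ Real.exp (-(1 / 4) * n ^ 2) * Real.exp (q * n) := by gcongr
      _ ≤ Real.exp (q ^ 2) := by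
        rw [← Real.exp_add]
        gcongr
        nlinarith [sq_nonneg (q - n / 2)]
  rw [Real.rpow_neg (by positivity), ← div_eq_mul_inv, le_div_iff₀ (by positivity)]
  exact h2

theorem heatKernel_one_le_exp (w : Space) : heatKernel w 1 ≤ Real.exp (-(1 / 4) * ‖w‖ ^ 2) := by
  rw [heatKernel_one]
  refine div_le_self (Real.exp_nonneg _) (Real.one_le_rpow ?_ (by norm_num))
  linarith [Real.pi_gt_three]

theorem decay_smul {σ : ℝ} (hσ : 0 ≤ σ) (q : ℝ) (w : Space) : decay 1 q (σ • w) = decay σ q w := by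
  simp [decay, norm_smul, abs_of_nonneg hσ]

theorem decay_anti {σ₁ σ₂ q : ℝ} (h2 : 0 ≤ σ₂) (h : σ₂ ≤ σ₁) (hq : 0 ≤ q) (x : Space) :
    decay σ₁ q x ≤ decay σ₂ q x := by
  unfold decay
  refine Real.rpow_le_rpow_of_nonpos (by positivity) ?_ (by linarith)
  gcongr

theorem decay_sub_le_rpow {ε k : ℝ} (hε : 0 ≤ ε) (hk : 0 ≤ k) (x z : Space) :
    decay ε k (x - z) ≤ (1 + ε * ‖z‖) ^ k * decay ε k x := by
  unfold decay
  have h1 : 1 + ε * ‖x‖ ≤ (1 + ε * ‖x - z‖) * (1 + ε * ‖z‖) := by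
    have : ‖x‖ ≤ ‖x - z‖ + ‖z‖ := by simpa using norm_add_le (x - z) z
    have h2 := mul_le_mul_of_nonneg_left this hε
    have h3 : 0 ≤ ε * ‖x - z‖ * (ε * ‖z‖) := by positivity
    nlinarith
  have h4 := Real.rpow_le_rpow (by positivity) h1 hk
  rw [Real.mul_rpow (by positivity) (by positivity)] at h4
  rw [Real.rpow_neg (by positivity), Real.rpow_neg (by positivity), ← div_eq_mul_inv,
    le_div_iff₀ (by positivity), inv_mul_le_iff₀ (by positivity)]
  exact h4

theorem rpow_mul_decay_one (m q : ℝ) (x : Space) :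
    (1 + ‖x‖) ^ m * decay 1 q x = decay 1 (q - m) x := by
  rw [decay, decay, one_mul, ← Real.rpow_add (by positivity)]
  congr 1
  ring

/-- The factor `(1 + |w|)²` covers the polynomial prefactors that appear when the kernel is
differentiated in space or in scale. -/
theorem sq_mul_heatKernel_one_le {q : ℝ} (hq : 0 ≤ q) (w : Space) :
    (1 + ‖w‖) ^ 2 * heatKernel w 1 ≤ Real.exp ((q + 2) ^ 2) * decay 1 q w := by
  have h1 := (heatKernel_one_le_exp w).trans
    (exp_neg_sq_le (q := q + 2) (by linarith) (norm_nonneg w))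
  have h2 : (1 + ‖w‖) ^ 2 * decay 1 (q + 2) w = decay 1 q w := by
    have := rpow_mul_decay_one 2 (q + 2) w
    rw [Real.rpow_two] at this
    rw [this, add_sub_cancel_right]
  calc (1 + ‖w‖) ^ 2 * heatKernel w 1
      ≤ (1 + ‖w‖) ^ 2 * (Real.exp ((q + 2) ^ 2) * (1 + ‖w‖) ^ (-(q + 2))) := by gcongr
    _ = Real.exp ((q + 2) ^ 2) * ((1 + ‖w‖) ^ 2 * decay 1 (q + 2) w) := by
      rw [decay, one_mul]
      ring
    _ = _ := by rw [h2]

theorem heatKernel_one_le_decay {q : ℝ} (hq : 0 ≤ q) (w : Space) :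
    heatKernel w 1 ≤ Real.exp ((q + 2) ^ 2) * decay 1 q w := by
  refine le_trans ?_ (sq_mul_heatKernel_one_le hq w)
  refine le_mul_of_one_le_left (heatKernel_nonneg w zero_le_one) (one_le_pow₀ ?_)
  linarith [norm_nonneg w]

/-- Mean value inequality on the ball of radius `|v|` about `u`, on which the weight varies by at
most the factor `(1 + |v|)^q`. -/
theorem abs_heatKernel_one_sub_le {q : ℝ} (hq : 0 ≤ q) (u v : Space) :
    |heatKernel (u - v) 1 - heatKernel u 1| ≤
      Real.exp ((q + 2) ^ 2) * ((1 + ‖v‖) ^ q * decay 1 q u) * ‖v‖ := by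
  have h := (convex_closedBall u ‖v‖).norm_image_sub_le_of_norm_hasFDerivWithin_le
    (f := fun z => heatKernel z 1) (𝕜 := ℝ)
    (C := Real.exp ((q + 2) ^ 2) * ((1 + ‖v‖) ^ q * decay 1 q u))
    (fun z _ => (hasFDerivAt_heatKernel_one z).hasFDerivWithinAt) (fun z hz => ?_)
    (Metric.mem_closedBall_self (norm_nonneg v)) (y := u - v) (by simp)
  · simpa using h
  · have h1 : ‖(heatKernel z 1 * -(1 / 2)) • innerSL ℝ z‖ ≤ (1 + ‖z‖) ^ 2 * heatKernel z 1 := by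
      have h0 := heatKernel_nonneg z zero_le_one
      rw [norm_smul, innerSL_apply_norm, norm_mul, Real.norm_of_nonneg h0]
      norm_num
      nlinarith [norm_nonneg z, mul_nonneg h0 (norm_nonneg z), mul_nonneg h0 (sq_nonneg ‖z‖)]
    refine h1.trans ((sq_mul_heatKernel_one_le hq z).trans ?_)
    have h2 := decay_sub_le_rpow zero_le_one hq u (u - z)
    rw [sub_sub_cancel, one_mul] at h2
    have h3 : ‖u - z‖ ≤ ‖v‖ := by
      rw [← dist_eq_norm, dist_comm]
      exact hz
    have h4 := (decay_pos zero_le_one q u).le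
    gcongr
    exact h2.trans (by gcongr)

/-- Mean value inequality in the scale `σ`, where `σ³ Φ(σz, 1)` is the heat kernel at time `σ^{-2}`.
Over the interval the weight is largest at the smallest scale `σ₂`. -/
theorem abs_scaled_heatKernel_sub_le {q : ℝ} (hq : 0 ≤ q) (z : Space) {σ₁ σ₂ : ℝ} (h2 : 0 < σ₂)
    (h : σ₂ ≤ σ₁) : |σ₁ ^ 3 * heatKernel (σ₁ • z) 1 - σ₂ ^ 3 * heatKernel (σ₂ • z) 1| ≤
      3 * σ₁ ^ 2 * (Real.exp ((q + 2) ^ 2) * decay σ₂ q z) * (σ₁ - σ₂) := by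
  have hder : ∀ σ ∈ Icc σ₂ σ₁, HasDerivWithinAt (fun σ : ℝ => σ ^ 3 * heatKernel (σ • z) 1)
      ((3 * σ ^ 2 - σ ^ 4 * ‖z‖ ^ 2 / 2) * heatKernel (σ • z) 1) (Icc σ₂ σ₁) σ := by
    intro σ _
    refine HasDerivAt.hasDerivWithinAt ?_
    have h1 : HasDerivAt (fun σ : ℝ => heatKernel (σ • z) 1)
        (heatKernel (σ • z) 1 * (-(1 / 2) * σ * ‖z‖ ^ 2)) σ := by
      have h3 := (hasFDerivAt_heatKernel_one (σ • z)).comp_hasDerivAt σ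
        ((hasDerivAt_id σ).smul_const z)
      refine h3.congr_deriv ?_
      simp
      ring
    refine ((hasDerivAt_pow 3 σ).fun_mul h1).congr_deriv ?_
    norm_num
    ring
  have hmvt := (convex_Icc σ₂ σ₁).norm_image_sub_le_of_norm_hasDerivWithin_le
    (C := 3 * σ₁ ^ 2 * (Real.exp ((q + 2) ^ 2) * decay σ₂ q z)) hder (fun σ hσ => ?_)
    (left_mem_Icc.2 h) (right_mem_Icc.2 h)
  · simpa [abs_of_nonneg (sub_nonneg.2 h)] using hmvt
  · have hσ0 : 0 < σ := h2.trans_le hσ.1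
    have h0 := heatKernel_nonneg (σ • z) zero_le_one
    rw [norm_mul, Real.norm_of_nonneg h0]
    have hn : ‖σ • z‖ = σ * ‖z‖ := by rw [norm_smul, Real.norm_of_nonneg hσ0.le]
    have h4 : ‖3 * σ ^ 2 - σ ^ 4 * ‖z‖ ^ 2 / 2‖ ≤ 3 * σ ^ 2 * (1 + ‖σ • z‖) ^ 2 := by
      rw [hn, Real.norm_eq_abs, abs_le]
      have h5 : 0 ≤ σ ^ 3 * ‖z‖ := by positivity
      have h6 : 0 ≤ σ ^ 4 * ‖z‖ ^ 2 := by positivity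
      have h7 : 0 ≤ σ ^ 2 := sq_nonneg _
      constructor <;> nlinarith
    calc ‖3 * σ ^ 2 - σ ^ 4 * ‖z‖ ^ 2 / 2‖ * heatKernel (σ • z) 1
        ≤ 3 * σ ^ 2 * (1 + ‖σ • z‖) ^ 2 * heatKernel (σ • z) 1 := by gcongr
      _ = 3 * σ ^ 2 * ((1 + ‖σ • z‖) ^ 2 * heatKernel (σ • z) 1) := by ring
      _ ≤ 3 * σ₁ ^ 2 * (Real.exp ((q + 2) ^ 2) * decay σ₂ q z) := by
        have h5 : (1 + ‖σ • z‖) ^ 2 * heatKernel (σ • z) 1 ≤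
            Real.exp ((q + 2) ^ 2) * decay σ₂ q z := by
          refine (sq_mul_heatKernel_one_le hq _).trans ?_
          rw [decay_smul hσ0.le]
          exact mul_le_mul_of_nonneg_left (decay_anti h2.le hσ.1 hq z) (Real.exp_nonneg _)
        have h6 := hσ.2
        exact mul_le_mul (by gcongr) h5 (by positivity) (by positivity)

theorem heatKernel_eq_scaled {t : ℝ} (ht : 0 < t) (z : Space) :
    heatKernel z t = (√t)⁻¹ ^ 3 * heatKernel ((√t)⁻¹ • z) 1 := by
  rw [heatKernel_scale ht, zpow_neg, inv_pow]
  norm_cast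

/-- Shift in space at time `τ`, then in time from `τ` to `T`. Each shift gains at least one factor
`τ^{-1/2}` over the size `τ^{-3/2}` of the kernel, whence `τ^{-2}`. -/
theorem abs_heatKernel_sub_le {q τ T : ℝ} (hq : 0 ≤ q) (hτ : 1 ≤ τ) (hT : τ ≤ T) (x y : Space) :
    |heatKernel (x - y) τ - heatKernel x T| ≤ 3 * Real.exp ((q + 2) ^ 2) * (τ ^ 2)⁻¹ *
      decay (√T)⁻¹ q x * (‖y‖ * (1 + ‖y‖) ^ q + (T - τ)) := by
  have hτ0 : 0 < τ := by linarith
  have hT0 : 0 < T := by linarith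
  have ha : 1 ≤ √τ := Real.one_le_sqrt.2 hτ
  have hab : √τ ≤ √T := Real.sqrt_le_sqrt hT
  have ha0 : 0 < √τ := by linarith
  have hb0 : 0 < √T := by linarith
  set σ₁ := (√τ)⁻¹ with h1
  set σ₂ := (√T)⁻¹ with h2
  have hσ1 : 0 < σ₁ := by positivity
  have hσ2 : 0 < σ₂ := by positivity
  have hσ : σ₂ ≤ σ₁ := inv_anti₀ ha0 hab
  have hσ11 : σ₁ ≤ 1 := inv_le_one_of_one_le₀ ha
  have hσ4 : (τ ^ 2)⁻¹ = σ₁ ^ 4 := by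
    rw [h1, inv_pow]
    congr 1
    nth_rewrite 1 [← Real.sq_sqrt hτ0.le]
    ring
  have hdiff : σ₁ - σ₂ ≤ (T - τ) * σ₁ ^ 2 := by
    have e1 : σ₁ - σ₂ = (√T - √τ) * (σ₁ * σ₂) := by
      rw [h1, h2]
      field_simp
    have e2 : T - τ = (√T - √τ) * (√T + √τ) := by
      nlinarith [Real.sq_sqrt hτ0.le, Real.sq_sqrt hT0.le]
    rw [e1, e2, mul_assoc]
    refine mul_le_mul_of_nonneg_left ?_ (by linarith)
    calc σ₁ * σ₂ ≤ σ₁ * σ₁ := by gcongr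
      _ = 1 * σ₁ ^ 2 := by ring
      _ ≤ (√T + √τ) * σ₁ ^ 2 := by
        gcongr
        linarith
  have hE := Real.exp_pos ((q + 2) ^ 2)
  set e := Real.exp ((q + 2) ^ 2) with he
  have hd := (decay_pos hσ2.le q x).le
  rw [heatKernel_eq_scaled hτ0, heatKernel_eq_scaled hT0, hσ4, smul_sub]
  have k1 : |σ₁ ^ 3 * heatKernel (σ₁ • x - σ₁ • y) 1 - σ₁ ^ 3 * heatKernel (σ₁ • x) 1| ≤
      e * σ₁ ^ 4 * decay σ₂ q x * (‖y‖ * (1 + ‖y‖) ^ q) := by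
    rw [← mul_sub, abs_mul, abs_of_pos (by positivity : 0 < σ₁ ^ 3)]
    have h3 := abs_heatKernel_one_sub_le hq (σ₁ • x) (σ₁ • y)
    rw [decay_smul hσ1.le, norm_smul, Real.norm_of_nonneg hσ1.le] at h3
    have h4 : 1 + σ₁ * ‖y‖ ≤ 1 + ‖y‖ := by
      have := mul_le_mul_of_nonneg_right hσ11 (norm_nonneg y)
      linarith
    calc σ₁ ^ 3 * |heatKernel (σ₁ • x - σ₁ • y) 1 - heatKernel (σ₁ • x) 1|
        ≤ σ₁ ^ 3 * (e * ((1 + σ₁ * ‖y‖) ^ q * decay σ₁ q x) * (σ₁ * ‖y‖)) := by gcongr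
      _ ≤ σ₁ ^ 3 * (e * ((1 + ‖y‖) ^ q * decay σ₂ q x) * (σ₁ * ‖y‖)) := by
        have := decay_anti hσ2.le hσ hq x
        have := (decay_pos hσ1.le q x).le
        gcongr
      _ = _ := by ring
  have k2 : |σ₁ ^ 3 * heatKernel (σ₁ • x) 1 - σ₂ ^ 3 * heatKernel (σ₂ • x) 1| ≤
      3 * e * σ₁ ^ 4 * decay σ₂ q x * (T - τ) := by
    refine (abs_scaled_heatKernel_sub_le hq x hσ2 hσ).trans ?_
    calc 3 * σ₁ ^ 2 * (e * decay σ₂ q x) * (σ₁ - σ₂)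
        ≤ 3 * σ₁ ^ 2 * (e * decay σ₂ q x) * ((T - τ) * σ₁ ^ 2) := by gcongr
      _ = _ := by ring
  have k3 : 0 ≤ e * σ₁ ^ 4 * decay σ₂ q x * (‖y‖ * (1 + ‖y‖) ^ q) := by positivity
  refine (abs_sub_le _ _ _).trans ((add_le_add k1 k2).trans ?_)
  nlinarith

theorem heatKernel_le_decay {q T : ℝ} (hq : 0 ≤ q) (hT : 1 ≤ T) (x : Space) :
    heatKernel x T ≤ Real.exp ((q + 2) ^ 2) * decay (√T)⁻¹ q x := by
  have hs : 1 ≤ √T := Real.one_le_sqrt.2 hT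
  have hσ : 0 ≤ (√T)⁻¹ := by positivity
  rw [heatKernel_eq_scaled (by linarith), ← decay_smul hσ]
  have h1 : (√T)⁻¹ ^ 3 ≤ 1 := pow_le_one₀ hσ (inv_le_one_of_one_le₀ hs)
  exact (mul_le_of_le_one_left (heatKernel_nonneg _ zero_le_one) h1).trans
    (heatKernel_one_le_decay hq _)

theorem integrable_of_decay {ε k : ℝ} (hε : 0 < ε) (hε1 : ε ≤ 1) (hk : 3 < k) {f : Space → E}
    (hf : AEStronglyMeasurable f) {B : ℝ} (hB : ∀ y, ‖f y‖ ≤ B * decay ε k y) : Integrable f :=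
  ((integrable_decay hε hε1 hk).const_mul B).mono' hf (Eventually.of_forall hB)

theorem norm_integral_le_of_decay {ε k : ℝ} (hε : 0 < ε) (hε1 : ε ≤ 1) (hk : 3 < k)
    {f : Space → E} {B : ℝ} (hB : ∀ y, ‖f y‖ ≤ B * decay ε k y) :
    ‖∫ y, f y‖ ≤ B * ∫ y, decay ε k y := by
  rw [← integral_const_mul]
  exact norm_integral_le_of_norm_le ((integrable_decay hε hε1 hk).const_mul B)
    (Eventually.of_forall hB)

/-- Approximation of the heat semigroup on decaying data by multiples of the heat kernel. -/
theorem norm_heat_sub_heatKernel_le {ε k q : ℝ} (hε : 0 < ε) (hε1 : ε ≤ 1) (hq : 0 ≤ q)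
    (hk : q + 4 < k) : ∃ K : ℝ, 0 ≤ K ∧ ∀ {f : Space → E} {B : ℝ}, AEStronglyMeasurable f →
      (∀ y, ‖f y‖ ≤ B * decay ε k y) → ∀ {τ s : ℝ}, 0 ≤ τ → 0 ≤ s → ∀ x,
      ‖heat τ f x - heatKernel x (τ + s + 1) • ∫ y, f y‖ ≤
        K * B * (s + 2) ^ 3 * (((τ + s + 1) ^ 2)⁻¹ * decay (√(τ + s + 1))⁻¹ q x) := by
  have hk0 : 0 ≤ k := by linarith
  have hk3 : 3 < k := by linarith
  set J := ∫ y, decay 1 (k - (q + 1)) y with hJ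
  set I := ∫ y, decay ε k y with hI
  have hJ0 : 0 ≤ J := integral_nonneg fun y => (decay_pos zero_le_one _ y).le
  have hI0 : 0 ≤ I := integral_nonneg fun y => (decay_pos hε.le _ y).le
  set e := Real.exp ((q + 2) ^ 2) with he
  have he0 : 0 < e := Real.exp_pos _
  have hgM : 0 ≤ gaussMoment := zero_le_one.trans one_le_gaussMoment
  set K₁ := 3 * e * (ε ^ (-k) * J) with hK₁
  set K₂ := gaussMoment * Real.exp (2 * (k * ε) ^ 2) * ε ^ (-k) + e * I with hK₂
  have hK₁0 : 0 ≤ K₁ := by positivity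
  have hK₂0 : 0 ≤ K₂ := by positivity
  refine ⟨K₁ + K₂, by positivity, fun {f B} hf hB {τ s} hτ hs x => ?_⟩
  have hB0 : 0 ≤ B :=
    nonneg_of_mul_nonneg_left ((norm_nonneg _).trans (hB 0)) (decay_pos hε.le k 0)
  have hfi := integrable_of_decay hε hε1 hk3 hf hB
  set T := τ + s + 1 with hT
  have hT1 : 1 ≤ T := by linarith
  have hT0 : 0 < T := by linarith
  have hd : 0 ≤ decay (√T)⁻¹ q x := (decay_pos (by positivity) q x).le
  -- For `τ ≥ 1` the kernels are compared, using `T ≤ (s+2)τ`. For `τ < 1` the kernel is too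
  -- singular for this, but then `T ≤ s+2`, so the claimed factor `(s+2)³ T^{-2}` is at least `1`
  -- and crude bounds on both terms suffice.
  rcases le_or_gt 1 τ with h1 | h1
  · have hτ0 : 0 < τ := by linarith
    have hTτ : τ ≤ T := by linarith
    have hi1 : Integrable fun y => heatKernel (x - y) τ • f y := by
      refine hfi.bdd_smul (C := ((4 * Real.pi * τ) ^ (3 / 2 : ℝ))⁻¹) ?_ ?_
      · refine Continuous.aestronglyMeasurable ?_
        exact continuousOn_univ.1 (continuousOn_heatKernel.comp (f := fun y : Space => (x - y, τ))
          (by fun_prop) fun y _ => ⟨mem_univ _, hτ0⟩)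
      · refine Eventually.of_forall fun y => ?_
        rw [Real.norm_of_nonneg (heatKernel_nonneg _ hτ)]
        exact heatKernel_le hτ0 le_rfl _
    have hi2 : Integrable fun y => heatKernel x T • f y := hfi.smul _
    rw [heat_eq_integral_kernel hτ0, ← integral_smul, ← integral_sub hi1 hi2]
    have hpt : ∀ y, ‖heatKernel (x - y) τ • f y - heatKernel x T • f y‖ ≤
        3 * e * (τ ^ 2)⁻¹ * decay (√T)⁻¹ q x * ((s + 2) * (B * ε ^ (-k))) *
          decay 1 (k - (q + 1)) y := by
      intro y
      rw [← sub_smul, norm_smul, Real.norm_eq_abs]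
      have h2 := abs_heatKernel_sub_le hq h1 hTτ x y
      have h3 : ‖y‖ * (1 + ‖y‖) ^ q + (T - τ) ≤ (s + 2) * (1 + ‖y‖) ^ (q + 1) := by
        have hy := norm_nonneg y
        have h4 : 1 ≤ (1 + ‖y‖) ^ q := Real.one_le_rpow (by linarith) hq
        rw [Real.rpow_add_one (by positivity)]
        have h5 : T - τ = s + 1 := by rw [hT]; ring
        rw [h5]
        nlinarith [mul_nonneg hs (by positivity : 0 ≤ (1 + ‖y‖) ^ q * ‖y‖),
          mul_nonneg hs (sub_nonneg.2 h4), mul_nonneg (by linarith : 0 ≤ (1 + ‖y‖) ^ q) hy]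
      have h6 : ‖f y‖ ≤ B * (ε ^ (-k) * decay 1 k y) :=
        (hB y).trans (mul_le_mul_of_nonneg_left (decay_le_decay_one hε hε1 hk0 y) hB0)
      calc |heatKernel (x - y) τ - heatKernel x T| * ‖f y‖
          ≤ (3 * e * (τ ^ 2)⁻¹ * decay (√T)⁻¹ q x * ((s + 2) * (1 + ‖y‖) ^ (q + 1))) *
            (B * (ε ^ (-k) * decay 1 k y)) := by
            gcongr
            exact h2.trans (by gcongr)
        _ = 3 * e * (τ ^ 2)⁻¹ * decay (√T)⁻¹ q x * ((s + 2) * (B * ε ^ (-k))) *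
            ((1 + ‖y‖) ^ (q + 1) * decay 1 k y) := by ring
        _ = _ := by rw [rpow_mul_decay_one]
    refine (norm_integral_le_of_norm_le
      ((integrable_decay_one (by linarith : 3 < k - (q + 1))).const_mul _)
      (Eventually.of_forall hpt)).trans ?_
    rw [integral_const_mul, ← hJ]
    have h7 : (τ ^ 2)⁻¹ ≤ (s + 2) ^ 2 * (T ^ 2)⁻¹ := by
      rw [← div_eq_mul_inv, le_div_iff₀ (by positivity), inv_mul_le_iff₀ (by positivity), ← mul_pow]
      refine pow_le_pow_left₀ hT0.le ?_ 2
      rw [hT]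
      nlinarith
    calc 3 * e * (τ ^ 2)⁻¹ * decay (√T)⁻¹ q x * ((s + 2) * (B * ε ^ (-k))) * J
        ≤ 3 * e * ((s + 2) ^ 2 * (T ^ 2)⁻¹) * decay (√T)⁻¹ q x * ((s + 2) * (B * ε ^ (-k))) * J := by
          gcongr
      _ = K₁ * B * (s + 2) ^ 3 * ((T ^ 2)⁻¹ * decay (√T)⁻¹ q x) := by rw [hK₁]; ring
      _ ≤ _ := by
          gcongr
          linarith
  · have h2 : ‖heat τ f x‖ ≤ B * gaussMoment * Real.exp (2 * (k * ε) ^ 2) *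
        (ε ^ (-k) * decay (√T)⁻¹ q x) := by
      refine (norm_heat_le_decay hε.le hk0 hB hτ x).trans ?_
      have h3 : Real.exp (2 * (k * ε) ^ 2 * τ) ≤ Real.exp (2 * (k * ε) ^ 2) :=
        Real.exp_le_exp.2 (mul_le_of_le_one_right (by positivity) h1.le)
      have h4 : decay ε k x ≤ ε ^ (-k) * decay (√T)⁻¹ q x := by
        refine (decay_le_decay_one hε hε1 hk0 x).trans ?_
        gcongr
        refine le_trans ?_ (decay_anti (σ₁ := 1) (by positivity)
          (inv_le_one_of_one_le₀ (Real.one_le_sqrt.2 hT1)) hq x)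
        unfold decay
        refine Real.rpow_le_rpow_of_exponent_le ?_ (by linarith)
        linarith [norm_nonneg x]
      have h5 := (decay_pos hε.le k x).le
      gcongr
    have h6 : ‖heatKernel x T • ∫ y, f y‖ ≤ e * decay (√T)⁻¹ q x * (B * I) := by
      rw [norm_smul, Real.norm_of_nonneg (heatKernel_nonneg x hT0.le)]
      have := heatKernel_le_decay hq hT1 x
      have := norm_integral_le_of_decay hε hε1 hk3 hB
      gcongr
    have h7 : 1 ≤ (s + 2) ^ 3 * (T ^ 2)⁻¹ := by
      rw [← div_eq_mul_inv, one_le_div (by positivity)]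
      calc T ^ 2 ≤ (s + 2) ^ 2 := pow_le_pow_left₀ hT0.le (by linarith) 2
        _ ≤ (s + 2) ^ 3 := pow_le_pow_right₀ (by linarith) (by norm_num)
    calc ‖heat τ f x - heatKernel x T • ∫ y, f y‖
        ≤ B * gaussMoment * Real.exp (2 * (k * ε) ^ 2) * (ε ^ (-k) * decay (√T)⁻¹ q x) +
          e * decay (√T)⁻¹ q x * (B * I) := norm_sub_le_of_le h2 h6
      _ = K₂ * B * decay (√T)⁻¹ q x * 1 := by rw [hK₂]; ring
      _ ≤ K₂ * B * decay (√T)⁻¹ q x * ((s + 2) ^ 3 * (T ^ 2)⁻¹) := by gcongr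
      _ = K₂ * B * (s + 2) ^ 3 * ((T ^ 2)⁻¹ * decay (√T)⁻¹ q x) := by ring
      _ ≤ _ := by
          gcongr
          linarith

end QTensor

namespace QTensor

variable {E : Type} [NormedAddCommGroup E] [NormedSpace ℝ E]

/-! ### Large time asymptotics of mild solutions -/

/-- The cubic loss in the source time `s` uses up only half of the exponential rate `μ`. -/
theorem add_two_pow_le {μ s : ℝ} (hμ : 0 < μ) (hs : 0 ≤ s) :
    (s + 2) ^ 3 ≤ (2 + 6 / μ) ^ 3 * Real.exp (μ / 2 * s) := by
  have h1 : s + 2 ≤ (2 + 6 / μ) * Real.exp (μ / 6 * s) := by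
    have h2 := Real.add_one_le_exp (μ / 6 * s)
    calc s + 2 ≤ (2 + 6 / μ) * (μ / 6 * s + 1) := by
          have h3 : (2 + 6 / μ) * (μ / 6 * s + 1) = s + 2 + (μ / 3 * s + 6 / μ) := by
            field_simp
            ring
          have : 0 ≤ μ / 3 * s + 6 / μ := by positivity
          linarith
      _ ≤ _ := by gcongr
  refine (pow_le_pow_left₀ (by linarith) h1 3).trans (le_of_eq ?_)
  rw [mul_pow, ← Real.exp_nat_mul]
  congr 2
  push_cast
  ring

theorem continuousOn_integral_of_decay {ε k : ℝ} (hε : 0 < ε) (hε1 : ε ≤ 1) (hk : 3 < k)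
    {g : Space → ℝ → E} (hg : Admissible g) {M : ℝ}
    (hM : ∀ x s, 0 < s → ‖g x s‖ ≤ M * decay ε k x) :
    ContinuousOn (fun s => ∫ y, g y s) (Ioi 0) := by
  refine continuousOn_of_dominated (bound := fun y => M * decay ε k y)
    (fun s hs => (hg.continuous_slice hs).aestronglyMeasurable)
    (fun s hs => Eventually.of_forall fun y => hM y s hs)
    ((integrable_decay hε hε1 hk).const_mul M) (Eventually.of_forall fun y s hs => ?_)
  exact ((hg.continuousAt y hs).comp (f := fun s => (y, s)) (by fun_prop)).continuousWithinAt

/-- The slice at time `s` diffuses for time `t - s`; comparing it with the kernel at `(t-s) + s + 1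
= t + 1` gives the same profile for every `s`. The coefficient is the total mass of the source over
all times, and the part emitted after `t` is exponentially small. -/
theorem norm_duh_sub_heatKernel_le [CompleteSpace E] {ε k q : ℝ} (hε : 0 < ε) (hε1 : ε ≤ 1)
    (hq : 0 ≤ q) (hk : q + 4 < k) {g : Space → ℝ → E} (hg : Admissible g) {M μ : ℝ} (hμ : 0 < μ)
    (hM : ∀ x s, 0 < s → ‖g x s‖ ≤ M * Real.exp (-μ * s) * decay ε k x) :
    ∃ (A : E) (C : ℝ), ∀ x t, 0 ≤ t → ‖duh g x t - heatKernel x (t + 1) • A‖ ≤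
      C * (((t + 1) ^ 2)⁻¹ * decay (√(t + 1))⁻¹ q x) := by
  have hk3 : 3 < k := by linarith
  have hM0 : 0 ≤ M := by
    have h1 := (norm_nonneg _).trans (hM 0 1 one_pos)
    exact nonneg_of_mul_nonneg_left (by simpa only [mul_assoc] using h1)
      (mul_pos (Real.exp_pos _) (decay_pos hε.le k 0))
  have hM' : ∀ x s, 0 < s → ‖g x s‖ ≤ M * decay ε k x := by
    intro x s hs
    refine (hM x s hs).trans ?_
    have h1 : Real.exp (-μ * s) ≤ 1 := Real.exp_le_one_iff.2 (by nlinarith)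
    have h2 := (decay_pos hε.le k x).le
    gcongr
    exact mul_le_of_le_one_right hM0 h1
  obtain ⟨K, hK0, hK⟩ := norm_heat_sub_heatKernel_le (E := E) hε hε1 hq hk
  set I := ∫ y, decay ε k y with hI
  have hI0 : 0 ≤ I := integral_nonneg fun y => (decay_pos hε.le _ y).le
  set G : ℝ → E := fun s => ∫ y, g y s with hG
  have hGn : ∀ s, 0 < s → ‖G s‖ ≤ M * I * Real.exp (-μ * s) := fun s hs =>
    (norm_integral_le_of_decay hε hε1 hk3 fun y => hM y s hs).trans (le_of_eq (by ring))
  have hGc : ContinuousOn G (Ioi 0) := continuousOn_integral_of_decay hε hε1 hk3 hg hM'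
  have hexp : IntegrableOn (fun s => M * I * Real.exp (-μ * s)) (Ioi 0) :=
    (integrableOn_exp_mul_Ioi (by linarith : -μ < 0) 0).const_mul _
  have hGi : IntegrableOn G (Ioi 0) := by
    refine hexp.mono' (hGc.aestronglyMeasurable measurableSet_Ioi) ?_
    filter_upwards [ae_restrict_mem measurableSet_Ioi] with s hs
    exact hGn s hs
  set e := Real.exp ((q + 2) ^ 2) with he
  set c := (2 + 6 / μ) ^ 3 with hc
  have hc0 : 0 ≤ c := by positivity
  refine ⟨∫ s in Ioi 0, G s, K * M * c * (1 / (μ / 2)) + e * (M * I / μ * c), fun x t ht => ?_⟩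
  set P := ((t + 1) ^ 2)⁻¹ * decay (√(t + 1))⁻¹ q x with hP
  have hd := (decay_pos (inv_nonneg.2 (Real.sqrt_nonneg (t + 1))) q x).le
  have hP0 : 0 ≤ P := mul_nonneg (by positivity) hd
  have hsplit : ∫ s in Ioi 0, G s = (∫ s in (0)..t, G s) + ∫ s in Ioi t, G s := by
    have hdisj : Disjoint (Ioc 0 t) (Ioi t) :=
      Set.disjoint_left.2 fun s h1 h2 => not_lt.2 h1.2 h2
    rw [intervalIntegral.integral_of_le ht, ← setIntegral_union hdisj measurableSet_Ioi
      (hGi.mono_set Ioc_subset_Ioi_self) (hGi.mono_set (Ioi_subset_Ioi ht)),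
      Ioc_union_Ioi_eq_Ioi ht]
  have hGt : IntervalIntegrable G volume 0 t := by
    rw [intervalIntegrable_iff_integrableOn_Ioc_of_le ht]
    exact hGi.mono_set Ioc_subset_Ioi_self
  have hGt' : IntervalIntegrable (fun s => heatKernel x (t + 1) • G s) volume 0 t := hGt.smul _
  have h1 : duh g x t - heatKernel x (t + 1) • ∫ s in Ioi 0, G s =
      (∫ s in (0)..t, (heat (t - s) (fun y => g y s) x - heatKernel x (t + 1) • G s)) -
        heatKernel x (t + 1) • ∫ s in Ioi t, G s := by
    rw [intervalIntegral.integral_sub (intervalIntegrable_duh hg x le_rfl ht) hGt',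
      intervalIntegral.integral_smul, hsplit, smul_add, duh]
    abel
  have h2 : ‖∫ s in (0)..t, (heat (t - s) (fun y => g y s) x - heatKernel x (t + 1) • G s)‖ ≤
      K * M * c * (1 / (μ / 2)) * P := by
    have h3 : ‖∫ s in (0)..t, (heat (t - s) (fun y => g y s) x - heatKernel x (t + 1) • G s)‖ ≤
        ∫ s in (0)..t, K * M * c * P * Real.exp (-(μ / 2) * s) := by
      refine intervalIntegral.norm_integral_le_of_norm_le ht
        (Eventually.of_forall fun s hs => ?_) (Continuous.intervalIntegrable (by fun_prop) _ _)
      have h4 := hK (hg.continuous_slice hs.1).aestronglyMeasurable (fun y => hM y s hs.1)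
        (sub_nonneg.2 hs.2) hs.1.le x
      rw [sub_add_cancel] at h4
      refine h4.trans ?_
      have h5 := add_two_pow_le hμ hs.1.le
      calc K * (M * Real.exp (-μ * s)) * (s + 2) ^ 3 * P
          ≤ K * (M * Real.exp (-μ * s)) * (c * Real.exp (μ / 2 * s)) * P := by gcongr
        _ = K * M * c * P * (Real.exp (-μ * s) * Real.exp (μ / 2 * s)) := by ring
        _ = _ := by
          rw [← Real.exp_add]
          congr 2
          ring
    refine h3.trans ?_
    rw [intervalIntegral.integral_const_mul]
    have h6 := integral_exp_neg_le (t := t) (half_pos hμ)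
    calc K * M * c * P * ∫ s in (0)..t, Real.exp (-(μ / 2) * s)
        ≤ K * M * c * P * (1 / (μ / 2)) := by gcongr
      _ = _ := by ring
  have h7 : ‖∫ s in Ioi t, G s‖ ≤ M * I / μ * Real.exp (-μ * t) := by
    have h8 : ‖∫ s in Ioi t, G s‖ ≤ ∫ s in Ioi t, M * I * Real.exp (-μ * s) := by
      refine norm_integral_le_of_norm_le (hexp.mono_set (Ioi_subset_Ioi ht)) ?_
      filter_upwards [ae_restrict_mem measurableSet_Ioi] with s hs
      exact hGn s (ht.trans_lt hs)
    refine h8.trans (le_of_eq ?_)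
    rw [integral_const_mul, integral_exp_mul_Ioi (by linarith : -μ < 0)]
    field_simp
  have h9 : ‖heatKernel x (t + 1) • ∫ s in Ioi t, G s‖ ≤ e * (M * I / μ * c) * P := by
    rw [norm_smul, Real.norm_of_nonneg (heatKernel_nonneg x (by linarith))]
    have h10 := heatKernel_le_decay hq (by linarith : 1 ≤ t + 1) x
    have h11 : Real.exp (-μ * t) ≤ c * ((t + 1) ^ 2)⁻¹ := by
      rw [← div_eq_mul_inv, le_div_iff₀ (by positivity)]
      have h12 := add_two_pow_le hμ ht
      have h13 : (t + 1) ^ 2 ≤ (t + 2) ^ 3 := by nlinarith [pow_nonneg ht 3, pow_nonneg ht 2]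
      calc Real.exp (-μ * t) * (t + 1) ^ 2
          ≤ Real.exp (-μ * t) * (c * Real.exp (μ / 2 * t)) := by
            gcongr
            exact h13.trans h12
        _ = c * Real.exp (-(μ / 2) * t) := by
            rw [mul_left_comm, ← Real.exp_add]
            congr 2
            ring
        _ ≤ c * 1 := by
            gcongr
            exact Real.exp_le_one_iff.2 (by nlinarith)
        _ = c := mul_one c
    calc heatKernel x (t + 1) * ‖∫ s in Ioi t, G s‖
        ≤ (e * decay (√(t + 1))⁻¹ q x) * (M * I / μ * (c * ((t + 1) ^ 2)⁻¹)) := by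
          gcongr
          exact h7.trans (by gcongr)
      _ = _ := by rw [hP]; ring
  rw [h1, add_mul]
  exact norm_sub_le_of_le h2 h9

/-- The large time expansion of a solution of the inhomogeneous heat equation. -/
theorem exists_asymptotic [CompleteSpace E] {ε δ : ℝ} (hδ : 0 < δ) (hε : 0 < ε) (hε1 : ε ≤ 1)
    {f : Space → E} {B : ℝ} (hf : AEStronglyMeasurable f)
    (hB : ∀ y, ‖f y‖ ≤ B * decay ε (8 + δ) y)
    {g : Space → ℝ → E} (hg : Admissible g) {M μ : ℝ} (hμ : 0 < μ)
    (hM : ∀ x s, 0 < s → ‖g x s‖ ≤ M * Real.exp (-μ * s) * decay ε (8 + δ) x) :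
    ∃ (A : E) (C : ℝ), ∀ x t, 0 ≤ t →
      weight δ x t * ‖heat t f x + duh g x t - heatKernel x (t + 1) • A‖ ≤ C := by
  have hq : 0 ≤ 4 + δ / 2 := by linarith
  -- Decay `8 + δ` leaves `q + 1` integrable moments for `q = 4 + δ/2`, with margin `δ/2`.
  have hk : 4 + δ / 2 + 4 < 8 + δ := by linarith
  obtain ⟨K, hK0, hK⟩ := norm_heat_sub_heatKernel_le (E := E) hε hε1 hq hk
  obtain ⟨A, C, hA⟩ := norm_duh_sub_heatKernel_le hε hε1 hq hk hg hμ hM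
  refine ⟨(∫ y, f y) + A, K * B * (0 + 2) ^ 3 + C, fun x t ht => ?_⟩
  have h1 := hK hf hB ht le_rfl x
  rw [add_zero] at h1
  have h2 := norm_add_le_of_le h1 (hA x t ht)
  have h3 : heat t f x + duh g x t - heatKernel x (t + 1) • ((∫ y, f y) + A) =
      heat t f x - heatKernel x (t + 1) • (∫ y, f y) +
        (duh g x t - heatKernel x (t + 1) • A) := by
    rw [smul_add]
    abel
  have h4 : weight δ x t * (((t + 1) ^ 2)⁻¹ * decay (√(t + 1))⁻¹ (4 + δ / 2) x) = 1 := by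
    have h5 : 0 < 1 + ‖x‖ / √(t + 1) := by positivity
    have h6 : t + 1 ≠ 0 := by linarith
    rw [weight, decay, Real.rpow_neg (by positivity), inv_mul_eq_div (√(t + 1))]
    have h7 := (Real.rpow_pos_of_pos h5 (4 + δ / 2)).ne'
    field_simp
  have hw : 0 ≤ weight δ x t := by
    unfold weight
    positivity
  rw [h3]
  refine (mul_le_mul_of_nonneg_left h2 hw).trans (le_of_eq ?_)
  rw [← add_mul, mul_left_comm, h4, mul_one]

/-! ### Continuity at the initial time -/

/-- The factor `t` makes the Duhamel part vanish as `t ↓ 0` with an integrable spatial weight. -/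
theorem norm_duh_le_mul_decay {ε k : ℝ} (hε : 0 ≤ ε) (hk : 0 ≤ k) {g : Space → ℝ → E} {M : ℝ}
    (hg : ∀ x s, 0 < s → ‖g x s‖ ≤ M * decay ε k x) (x : Space) {t : ℝ} (ht : 0 ≤ t) :
    ‖duh g x t‖ ≤ M * gaussMoment * Real.exp (2 * (k * ε) ^ 2 * t) * decay ε k x * t := by
  have hM : 0 ≤ M :=
    nonneg_of_mul_nonneg_left ((norm_nonneg _).trans (hg 0 1 one_pos)) (decay_pos hε k 0)
  have hG : 0 ≤ gaussMoment := zero_le_one.trans one_le_gaussMoment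
  have hD := (decay_pos hε k x).le
  have h := intervalIntegral.norm_integral_le_of_norm_le_const (a := 0) (b := t)
    (f := fun s => heat (t - s) (fun y => g y s) x)
    (C := M * gaussMoment * Real.exp (2 * (k * ε) ^ 2 * t) * decay ε k x) fun s hs => ?_
  · rwa [sub_zero, abs_of_nonneg ht] at h
  · rw [uIoc_of_le ht] at hs
    refine (norm_heat_le_decay hε hk (fun y => hg y s hs.1) (sub_nonneg.2 hs.2) x).trans ?_
    gcongr
    linarith [hs.1]

theorem tendsto_translate {f : Space → E} (hf : Integrable f) :
    Tendsto (fun y : Space => ∫⁻ x, ‖f (x - y) - f x‖ₑ) (𝓝 0) (𝓝 0) := by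
  have hL := memLp_one_iff_integrable.2 hf
  let g : C(Space, C(Space, Space)) := (ContinuousMap.mk (fun a : Space × Space => a.2 - a.1)).curry
  have hg : ∀ y, MeasurePreserving (g y) (volume : Measure Space) volume := fun y =>
    measurePreserving_sub_right volume y
  have hc : Continuous fun y => Lp.compMeasurePreserving (g y) (hg y) (hL.toLp f) :=
    (continuous_const (y := hL.toLp f)).compMeasurePreservingLp g.continuous hg ENNReal.one_ne_top
  have h1 : ∀ y : Space, ∫⁻ x, ‖f (x - y) - f x‖ₑ =
      edist (Lp.compMeasurePreserving (g y) (hg y) (hL.toLp f)) (hL.toLp f) := by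
    intro y
    rw [Lp.toLp_compMeasurePreserving, Lp.edist_toLp_toLp, eLpNorm_one_eq_lintegral_enorm]
    rfl
  have h0 : Lp.compMeasurePreserving (g 0) (hg 0) (hL.toLp f) = hL.toLp f := by
    rw [Lp.toLp_compMeasurePreserving]
    congr 1
    ext x
    simp [g]
  simp_rw [h1]
  have h2 := (hc.edist (continuous_const (y := hL.toLp f))).tendsto 0
  rwa [h0, edist_self] at h2

/-- Strong continuity of the heat semigroup at time zero in `L¹`. -/
theorem tendsto_heat_sub [CompleteSpace E] {f : Space → E} (hf : StronglyMeasurable f)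
    (hfi : Integrable f) {B : ℝ} (hB : ∀ y, ‖f y‖ ≤ B) :
    Tendsto (fun t : ℝ => ∫⁻ x, ‖heat t f x - f x‖ₑ) (𝓝[>] 0) (𝓝 0) := by
  have hmeas : ∀ t : ℝ, StronglyMeasurable
      (Function.uncurry fun (x w : Space) => f (x - √t • w) - f x) := fun t =>
    (hf.comp_measurable (by fun_prop)).sub (hf.comp_measurable (by fun_prop))
  -- The `L¹` error is at most the Gaussian average of the translation errors, each bounded by
  -- `2‖f‖₁` and tending to `0`.
  have h1 : ∀ t : ℝ, ∫⁻ x, ‖heat t f x - f x‖ₑ ≤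
      ∫⁻ w, ∫⁻ x, ‖f (x - √t • w) - f x‖ₑ ∂volume ∂gauss := by
    intro t
    rw [← lintegral_lintegral_swap (hmeas t).enorm.aemeasurable]
    refine lintegral_mono fun x => ?_
    have h2 : heat t f x - f x = ∫ w, (f (x - √t • w) - f x) ∂gauss := by
      rw [integral_sub _ (integrable_const _), integral_const, probReal_univ, one_smul, heat]
      exact Integrable.of_bound (hf.comp_measurable (by fun_prop)).aestronglyMeasurable B
        (Eventually.of_forall fun _ => hB _)
    rw [h2]
    exact enorm_integral_le_lintegral_enorm _
  have h3 : ∀ y : Space, ∫⁻ x, ‖f (x - y) - f x‖ₑ ≤ 2 * ∫⁻ x, ‖f x‖ₑ := by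
    intro y
    calc ∫⁻ x, ‖f (x - y) - f x‖ₑ ≤ ∫⁻ x, (‖f (x - y)‖ₑ + ‖f x‖ₑ) :=
          lintegral_mono fun x => enorm_sub_le
      _ = (∫⁻ x, ‖f (x - y)‖ₑ) + ∫⁻ x, ‖f x‖ₑ := lintegral_add_right _ hf.enorm
      _ = 2 * ∫⁻ x, ‖f x‖ₑ := by
          rw [lintegral_sub_right_eq_self (fun x => ‖f x‖ₑ) y, two_mul]
  refine tendsto_of_tendsto_of_tendsto_of_le_of_le tendsto_const_nhds ?_ (fun _ => zero_le) h1
  have h4 := tendsto_lintegral_filter_of_dominated_convergence (μ := gauss) (l := 𝓝[>] (0 : ℝ))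
    (F := fun t w => ∫⁻ x, ‖f (x - √t • w) - f x‖ₑ) (f := fun _ => 0)
    (fun _ => 2 * ∫⁻ x, ‖f x‖ₑ)
    (Eventually.of_forall fun t => (hmeas t).enorm.lintegral_prod_left')
    (Eventually.of_forall fun t => Eventually.of_forall fun w => h3 _) ?_
    (Eventually.of_forall fun w => ?_)
  · simpa using h4
  · rw [lintegral_const, measure_univ, mul_one]
    exact ENNReal.mul_ne_top (by simp) hfi.2.ne
  · refine (tendsto_translate hfi).comp ?_
    have : Continuous fun t : ℝ => √t • w := by fun_prop
    simpa using (this.tendsto 0).mono_left (nhdsWithin_le_nhds (s := Ioi (0 : ℝ)))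

end QTensor

namespace QTensor

/-! ### Bounded integrable functions -/

section

variable {E : Type} [NormedAddCommGroup E]

/-- From `|f|^p ≤ M^{p-1} |f|`: under a uniform bound, `L¹` convergence controls the exponents `2`
and `6` at once. -/
theorem eLpNorm_le_of_bound {f : Space → E} {M : ℝ} (hM : ∀ x, ‖f x‖ ≤ M) {p : ℝ≥0∞} (hp : 1 ≤ p)
    (hp' : p ≠ ⊤) : eLpNorm f p volume ≤
      (ENNReal.ofReal M ^ (p.toReal - 1) * ∫⁻ x, ‖f x‖ₑ) ^ (1 / p.toReal) := by
  have hq : 1 ≤ p.toReal := by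
    rw [← ENNReal.toReal_one]
    exact ENNReal.toReal_mono hp' hp
  rw [eLpNorm_eq_lintegral_rpow_enorm_toReal (one_pos.trans_le hp).ne' hp',
    ← lintegral_const_mul' _ _ (ENNReal.rpow_ne_top_of_nonneg (by linarith) ENNReal.ofReal_ne_top)]
  refine ENNReal.rpow_le_rpow (lintegral_mono fun x => ?_) (by positivity)
  calc ‖f x‖ₑ ^ p.toReal = ‖f x‖ₑ ^ (p.toReal - 1) * ‖f x‖ₑ := by
        conv_lhs => rw [← sub_add_cancel p.toReal 1]
        rw [ENNReal.rpow_add_of_nonneg _ _ (by linarith) zero_le_one, ENNReal.rpow_one]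
    _ ≤ ENNReal.ofReal M ^ (p.toReal - 1) * ‖f x‖ₑ := by
        have h : ‖f x‖ₑ ≤ ENNReal.ofReal M := by
          rw [← ofReal_norm]
          exact ENNReal.ofReal_le_ofReal (hM x)
        exact mul_le_mul_left (ENNReal.rpow_le_rpow h (by linarith)) _

theorem memLp_of_bound_of_integrable {f : Space → E} {M : ℝ} (hM : ∀ x, ‖f x‖ ≤ M)
    (hf : Integrable f) {p : ℝ≥0∞} (hp : 1 ≤ p) (hp' : p ≠ ⊤) : MemLp f p volume := by
  have hq : 1 ≤ p.toReal := by
    rw [← ENNReal.toReal_one]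
    exact ENNReal.toReal_mono hp' hp
  refine ⟨hf.1, (eLpNorm_le_of_bound hM hp hp').trans_lt
    (ENNReal.rpow_lt_top_of_nonneg (by positivity) (ENNReal.mul_ne_top ?_ hf.2.ne))⟩
  exact ENNReal.rpow_ne_top_of_nonneg (by linarith) ENNReal.ofReal_ne_top

theorem tendsto_eLpNorm_of_bound {ι : Type*} {l : Filter ι} {W : ι → Space → E} {M : ℝ}
    (hM : ∀ᶠ t in l, ∀ x, ‖W t x‖ ≤ M) (h : Tendsto (fun t => ∫⁻ x, ‖W t x‖ₑ) l (𝓝 0))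
    {p : ℝ≥0∞} (hp : 1 ≤ p) (hp' : p ≠ ⊤) :
    Tendsto (fun t => eLpNorm (W t) p volume) l (𝓝 0) := by
  have hq : 1 ≤ p.toReal := by
    rw [← ENNReal.toReal_one]
    exact ENNReal.toReal_mono hp' hp
  have h1 : Tendsto (fun t => (ENNReal.ofReal M ^ (p.toReal - 1) * ∫⁻ x, ‖W t x‖ₑ) ^
      (1 / p.toReal)) l (𝓝 0) := by
    have h2 := ENNReal.Tendsto.const_mul (a := ENNReal.ofReal M ^ (p.toReal - 1)) h
      (Or.inr (ENNReal.rpow_ne_top_of_nonneg (by linarith) ENNReal.ofReal_ne_top))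
    rw [mul_zero] at h2
    have h3 := ((ENNReal.continuous_rpow_const (y := 1 / p.toReal)).tendsto 0).comp h2
    rwa [ENNReal.zero_rpow_of_pos (by positivity)] at h3
  refine tendsto_of_tendsto_of_tendsto_of_le_of_le' tendsto_const_nhds h1
    (Eventually.of_forall fun _ => zero_le) ?_
  filter_upwards [hM] with t ht
  exact eLpNorm_le_of_bound ht hp hp'

end

theorem tendsto_normH {ι : Type*} {l : Filter ι} {W : ι → Space → Sym0} {M : ℝ}
    (hM : ∀ᶠ t in l, ∀ x, ‖W t x‖ ≤ M) (h : Tendsto (fun t => ∫⁻ x, ‖W t x‖ₑ) l (𝓝 0)) :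
    Tendsto (fun t => normH (W t)) l (𝓝 0) := by
  have := (tendsto_eLpNorm_of_bound hM h one_le_two ENNReal.ofNat_ne_top).max
    (tendsto_eLpNorm_of_bound hM h (p := 6) (by norm_num) ENNReal.ofNat_ne_top)
  rwa [max_self] at this

theorem normH_congr {f g : Space → Sym0} (h : f =ᵐ[volume] g) : normH f = normH g := by
  rw [normH, normH, eLpNorm_congr_ae h, eLpNorm_congr_ae h]

/-! ### Initial data -/

theorem ae_norm_le_of_normA {δ η : ℝ} (hη : 0 ≤ η) {Q₀ : Space → Sym0}
    (h : normA δ Q₀ ≤ ENNReal.ofReal η) : ∀ᵐ x, ‖Q₀ x‖ ≤ η * decay 1 (8 + δ) x := by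
  filter_upwards [ENNReal.ae_le_essSup fun x => ENNReal.ofReal ((1 + ‖x‖) ^ (8 + δ) * ‖Q₀ x‖)]
    with x hx
  have h1 := (ENNReal.ofReal_le_ofReal_iff hη).1 (hx.trans h)
  rw [decay, one_mul, Real.rpow_neg (by positivity), ← div_eq_mul_inv, le_div_iff₀ (by positivity),
    mul_comm]
  exact h1

/-- A representative of the initial datum that satisfies the weighted bound everywhere, and is
continuous if possible. -/
theorem exists_representative {δ η : ℝ} (hη : 0 ≤ η) {Q₀ : Space → Sym0} (hQ : MemA δ Q₀)
    (h : normA δ Q₀ ≤ ENNReal.ofReal η) :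
    ∃ f : Space → Sym0, StronglyMeasurable f ∧ Q₀ =ᵐ[volume] f ∧
      (∀ x, ‖f x‖ ≤ η * decay 1 (8 + δ) x) ∧
      ((∃ Q₁ : Space → Sym0, Continuous Q₁ ∧ Q₀ =ᵐ[volume] Q₁) → Continuous f) := by
  have hae := ae_norm_le_of_normA hη h
  have hdc := continuous_decay zero_le_one (8 + δ)
  by_cases hcont : ∃ Q₁ : Space → Sym0, Continuous Q₁ ∧ Q₀ =ᵐ[volume] Q₁
  · obtain ⟨Q₁, hc, heq⟩ := hcont
    refine ⟨Q₁, hc.stronglyMeasurable, heq, fun x => ?_, fun _ => hc⟩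
    have h1 : ∀ᵐ x, ‖Q₁ x‖ ≤ η * decay 1 (8 + δ) x := by
      filter_upwards [hae, heq] with x hx hx'
      rwa [← hx']
    have h2 : IsClosed {x | ‖Q₁ x‖ ≤ η * decay 1 (8 + δ) x} :=
      isClosed_le hc.norm (continuous_const.mul hdc)
    -- For a continuous representative the bound holds on a closed set of full measure, which is
    -- dense, hence everywhere.
    have h3 := (Measure.dense_of_ae h1).closure_eq
    rw [h2.closure_eq] at h3
    exact h3.symm.subset (mem_univ x)
  · have hm := hQ.1.1
    let S : Set Space := {x | ‖hm.mk Q₀ x‖ ≤ η * decay 1 (8 + δ) x}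
    have hS : MeasurableSet S := measurableSet_le hm.stronglyMeasurable_mk.norm.measurable
      (continuous_const.mul hdc).measurable
    -- Without a continuous representative, a measurable one is set to zero on the null set where
    -- the bound fails.
    refine ⟨S.indicator (hm.mk Q₀), hm.stronglyMeasurable_mk.indicator hS, ?_, fun x => ?_,
      fun h => absurd h hcont⟩
    · filter_upwards [hae, hm.ae_eq_mk] with x hx hx'
      have : x ∈ S := by
        show ‖hm.mk Q₀ x‖ ≤ _
        rwa [← hx']
      rw [indicator_of_mem this, hx']
    · by_cases hx : x ∈ S
      · rw [indicator_of_mem hx]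
        exact hx
      · rw [indicator_of_notMem hx, norm_zero]
        exact mul_nonneg hη (decay_pos zero_le_one _ x).le

/-! ### The solution with small initial datum -/

/-- The choice `ε ≤ √a / (3k)` gives `2(kε)² ≤ 2a/9`. -/
theorem exists_decay_rate {a k : ℝ} (ha : 0 < a) (hk : 1 ≤ k) :
    ∃ ε : ℝ, 0 < ε ∧ ε ≤ 1 ∧ 2 * (k * ε) ^ 2 ≤ a / 4 := by
  have hs := Real.sqrt_pos.2 ha
  refine ⟨min 1 (√a / (3 * k)), by positivity, min_le_left _ _, ?_⟩
  have h1 : k * min 1 (√a / (3 * k)) ≤ √a / 3 := by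
    calc k * min 1 (√a / (3 * k)) ≤ k * (√a / (3 * k)) := by
          gcongr
          exact min_le_right _ _
      _ = √a / 3 := by field_simp
  have h2 := pow_le_pow_left₀ (by positivity) h1 2
  rw [div_pow, Real.sq_sqrt ha.le] at h2
  linarith

/-- The reaction term of the equation for `e ^ (a t) Q`. -/
def qReaction (a b c : ℝ) : ℝ → Sym0 → Sym0 :=
  reaction (fun t => b * Real.exp (-a * t)) (fun t => c * Real.exp (-(2 * a) * t)) devBil
    (innerSL ℝ)

theorem exists_smallLip_qReaction {a b c κ : ℝ} (hb : 0 ≤ b) (hc : 0 ≤ c) (hκ : κ ≤ a) :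
    ∃ L, 0 ≤ L ∧ SmallLip (qReaction a b c) a κ L :=
  ⟨_, by positivity, smallLip_reaction hb hc hκ devBil (innerSL ℝ)⟩

/-- Differentiating `e^{-at}` restores the linear term, and the homogeneity of the quadratic and
cubic terms absorbs the exponentials of the coefficients. -/
theorem hasDerivAt_exp_smul {a b c : ℝ} {f : Space → Sym0} {u : Space → ℝ → Sym0}
    (hu : IsMild (qReaction a b c) f u) (x : Space) {t : ℝ} (ht : 0 < t) :
    HasDerivAt (fun s => Real.exp (-a * s) • u x s)
      ((Δ fun y => Real.exp (-a * t) • u y t) x - a • (Real.exp (-a * t) • u x t) +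
        b • devSq (Real.exp (-a * t) • u x t) -
        (c * trSq (Real.exp (-a * t) • u x t)) • (Real.exp (-a * t) • u x t)) t := by
  obtain ⟨hsm, hd⟩ := hu.smooth (by fun_prop) (by fun_prop)
  have hslice : ContDiff ℝ 2 fun x => u x t :=
    contDiffOn_univ.1 ((hsm.of_le (WithTop.coe_le_coe.2 le_top)).comp (f := fun x => (x, t))
      (by fun_prop) fun x _ => ⟨mem_univ _, ht⟩)
  have h1 : (Δ fun y => Real.exp (-a * t) • u y t) x =
      Real.exp (-a * t) • (Δ fun y => u y t) x :=
    InnerProductSpace.laplacian_smul (Real.exp (-a * t)) hslice.contDiffAt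
  have h2 : HasDerivAt (fun s => Real.exp (-a * s)) (Real.exp (-a * t) * (-a)) t := by
    simpa using ((hasDerivAt_id t).const_mul (-a)).exp
  refine (h2.fun_smul (hd x t ht)).congr_deriv ?_
  have h3 : Real.exp (-(2 * a) * t) = Real.exp (-a * t) * Real.exp (-a * t) := by
    rw [← Real.exp_add]
    congr 1
    ring
  have h4 : ∀ v, (innerSL ℝ : Sym0 →L[ℝ] Sym0 →L[ℝ] ℝ) v v = ‖v‖ ^ 2 :=
    real_inner_self_eq_norm_sq
  rw [h1, ← devBil_self, trSq_eq_norm_sq, norm_smul, mul_pow, Real.norm_of_nonneg (Real.exp_nonneg _)]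
  simp only [reaction, h3, map_smul, smul_apply, h4, smul_add, smul_sub, smul_smul]
  module

/-- Write `e^{-at} u - f` as `(e^{tΔ} f - f)`, plus the Duhamel integral, minus `(1 - e^{-at}) u`.
The first term vanishes in `L¹` by strong continuity; the others are at most `c(t)` times an
integrable weight with `c(t) → 0`. -/
theorem tendsto_normH_exp_smul {a ε k κ M r η : ℝ} (ha : 0 ≤ a) (hε : 0 < ε) (hε1 : ε ≤ 1)
    (hk : 3 < k) (hκ : 0 ≤ κ) (hr : 0 ≤ r) {f : Space → Sym0} {u g : Space → ℝ → Sym0}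
    (hf : StronglyMeasurable f) (hfη : ∀ x, ‖f x‖ ≤ η * decay ε k x)
    (hu : ∀ x t, 0 < t → ‖u x t‖ ≤ r * (Real.exp (κ * t) * decay ε k x))
    (hM : ∀ x s, 0 < s → ‖g x s‖ ≤ M * decay ε k x)
    (heq : ∀ x t, 0 < t → u x t = heat t f x + duh g x t) :
    Tendsto (fun t => normH fun x => Real.exp (-a * t) • u x t - f x) (𝓝[>] 0) (𝓝 0) := by
  have hk0 : 0 ≤ k := by linarith
  have hM0 : 0 ≤ M :=
    nonneg_of_mul_nonneg_left ((norm_nonneg _).trans (hM 0 1 one_pos)) (decay_pos hε.le k 0)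
  have hη0 : 0 ≤ η :=
    nonneg_of_mul_nonneg_left ((norm_nonneg _).trans (hfη 0)) (decay_pos hε.le k 0)
  have hG : 0 ≤ gaussMoment := zero_le_one.trans one_le_gaussMoment
  have hfb : ∀ x, ‖f x‖ ≤ η := fun x =>
    (hfη x).trans (mul_le_of_le_one_right hη0 (decay_le_one hε.le hk0 x))
  have hfi := integrable_of_decay hε hε1 hk hf.aestronglyMeasurable hfη
  have hI : ∫⁻ x, ENNReal.ofReal (decay ε k x) ≠ ⊤ :=
    (integrable_decay hε hε1 hk).lintegral_lt_top.ne
  have he1 : ∀ t, 0 < t → Real.exp (-a * t) ≤ 1 := fun t ht => Real.exp_le_one_iff.2 (by nlinarith)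
  let c : ℝ → ℝ := fun t => M * gaussMoment * Real.exp (2 * (k * ε) ^ 2 * t) * t +
    (1 - Real.exp (-a * t)) * (r * Real.exp (κ * t))
  have hc : Tendsto (fun t => ENNReal.ofReal (c t)) (𝓝[>] 0) (𝓝 0) := by
    have : Continuous fun t => ENNReal.ofReal (c t) := ENNReal.continuous_ofReal.comp (by fun_prop)
    simpa [c] using (this.tendsto 0).mono_left (nhdsWithin_le_nhds (s := Ioi (0 : ℝ)))
  refine tendsto_normH (M := r * Real.exp κ + η) ?_ ?_
  · filter_upwards [Ioo_mem_nhdsGT one_pos] with t ht x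
    refine norm_sub_le_of_le ?_ (hfb x)
    rw [norm_smul, Real.norm_of_nonneg (Real.exp_nonneg _)]
    have h1 : Real.exp (κ * t) ≤ Real.exp κ := Real.exp_le_exp.2 (by nlinarith [ht.2])
    calc Real.exp (-a * t) * ‖u x t‖ ≤ 1 * (r * (Real.exp κ * 1)) := by
          gcongr
          · exact he1 t ht.1
          · refine (hu x t ht.1).trans ?_
            have := decay_le_one hε.le hk0 x
            have := (decay_pos hε.le k x).le
            gcongr
      _ = r * Real.exp κ := by ring
  · have h2 := (tendsto_heat_sub hf hfi hfb).add
      (ENNReal.Tendsto.mul_const (b := ∫⁻ x, ENNReal.ofReal (decay ε k x)) hc (Or.inr hI))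
    rw [zero_mul, add_zero] at h2
    refine tendsto_of_tendsto_of_tendsto_of_le_of_le' tendsto_const_nhds h2
      (Eventually.of_forall fun _ => zero_le) ?_
    filter_upwards [self_mem_nhdsWithin] with t ht
    have ht0 : 0 < t := ht
    have hdm : Measurable fun x : Space => ENNReal.ofReal (c t) * ENNReal.ofReal (decay ε k x) :=
      (continuous_decay hε.le k).measurable.ennreal_ofReal.const_mul _
    rw [← lintegral_const_mul' _ _ ENNReal.ofReal_ne_top, ← lintegral_add_right _ hdm]
    refine lintegral_mono fun x => ?_
    have hd := (decay_pos hε.le k x).le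
    have h3 : Real.exp (-a * t) • u x t - f x =
        (heat t f x - f x) + (duh g x t - (1 - Real.exp (-a * t)) • u x t) := by
      rw [sub_smul, one_smul]
      nth_rewrite 2 [heq x t ht]
      abel
    have h4 : ‖duh g x t - (1 - Real.exp (-a * t)) • u x t‖ ≤ c t * decay ε k x := by
      have h5 : ‖(1 - Real.exp (-a * t)) • u x t‖ ≤
          (1 - Real.exp (-a * t)) * (r * (Real.exp (κ * t) * decay ε k x)) := by
        have h6 := sub_nonneg.2 (he1 t ht)
        rw [norm_smul, Real.norm_of_nonneg h6]
        exact mul_le_mul_of_nonneg_left (hu x t ht) h6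
      refine (norm_sub_le_of_le (norm_duh_le_mul_decay hε.le hk0 hM x ht0.le) h5).trans
        (le_of_eq ?_)
      ring
    show ‖Real.exp (-a * t) • u x t - f x‖ₑ ≤ _
    rw [h3]
    refine (enorm_add_le _ _).trans (add_le_add le_rfl ?_)
    rw [← ofReal_norm, ← ENNReal.ofReal_mul' hd]
    exact ENNReal.ofReal_le_ofReal h4

/-- The Duhamel integral and the shifted kernel are continuous up to `t = 0`, so only the free
evolution of `f` decides whether the remainder is. -/
theorem memX0_of_mild {δ B : ℝ} {f : Space → Sym0}
    {g : Space → ℝ → Sym0} (hf : Integrable f) (hfB : ∀ y, ‖f y‖ ≤ B) (hg : Admissible g)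
    {A : Sym0} {C : ℝ} (hC : ∀ x t, 0 ≤ t →
      weight δ x t * ‖heat t f x + duh g x t - heatKernel x (t + 1) • A‖ ≤ C) :
    MemX0 δ (Ioi 0) (fun x t => heat t f x + duh g x t - heatKernel x (t + 1) • A) ∧
      (Continuous f →
        MemX0 δ (Ici 0) fun x t => heat t f x + duh g x t - heatKernel x (t + 1) • A) := by
  have hK : ContinuousOn (fun p : Space × ℝ => heatKernel p.1 (p.2 + 1) • A) (univ ×ˢ Ici 0) := by
    have h1 : Continuous fun p : Space × ℝ => (p.1, p.2 + 1) := by fun_prop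
    refine (continuousOn_heatKernel.comp h1.continuousOn fun p hp => ?_).smul continuousOn_const
    have : 0 ≤ p.2 := hp.2
    exact ⟨mem_univ _, show 0 < p.2 + 1 by linarith⟩
  have hsub : (univ : Set Space) ×ˢ Ioi (0 : ℝ) ⊆ univ ×ˢ Ici 0 :=
    prod_mono subset_rfl Ioi_subset_Ici_self
  refine ⟨⟨((continuousOn_heat hf).add (admissible_duh hg).continuousOn).sub (hK.mono hsub),
    C, fun x t ht => hC x t (le_of_lt ht)⟩, fun hc => ⟨?_, C, fun x t ht => hC x t ht⟩⟩
  refine ((continuous_heat hc hfB).continuousOn.add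
    ((continuous_duh hg).continuousOn.congr fun p hp => ?_)).sub hK
  have : 0 ≤ p.2 := hp.2
  simp only [max_eq_left this]

end QTensor

end

/-! ### The main theorem -/

open QTensor in
theorem theorem3p1 (δ : ℝ) (hδ : 0 < δ) (a b c : ℝ) (habc : (a, b, c) ∈ QTensor.paramRegion) :
    ∃ η : ℝ, 0 < η ∧
      ∀ Q₀ : QTensor.Space → QTensor.Sym0,
        QTensor.MemA δ Q₀ → QTensor.normA δ Q₀ ≤ ENNReal.ofReal η →
        ∃ Q : QTensor.Space → ℝ → QTensor.Sym0,
          QTensor.IsSmoothSolution a b c Q₀ Q ∧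
          (∀ Q' : QTensor.Space → ℝ → QTensor.Sym0, QTensor.IsSmoothSolution a b c Q₀ Q' →
            ∀ x : QTensor.Space, ∀ t : ℝ, 0 < t → Q' x t = Q x t) ∧
          ∃ (A : QTensor.Sym0) (V : QTensor.Space → ℝ → QTensor.Sym0),
            QTensor.MemX0 δ (Set.Ioi 0) V ∧
            ((∃ Q₁ : QTensor.Space → QTensor.Sym0,
                Continuous Q₁ ∧ Q₀ =ᵐ[MeasureTheory.volume] Q₁) →
              QTensor.MemX0 δ (Set.Ici 0) V) ∧
            ∀ x : QTensor.Space, ∀ t : ℝ, 0 < t →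
              Q x t = (Real.exp (-a * t) * QTensor.heatKernel x (t + 1)) • A +
                Real.exp (-a * t) • V x t := by
  obtain ⟨ha, hb, hc, -⟩ := habc
  simp only at ha hb hc
  have hk3 : 3 < 8 + δ := by linarith
  obtain ⟨ε, hε, hε1, hεa⟩ := exists_decay_rate ha (by linarith : 1 ≤ 8 + δ)
  set κ := 2 * ((8 + δ) * ε) ^ 2 with hκ
  have hκ0 : 0 ≤ κ := by positivity
  have hμ : 0 < a - 2 * κ := by linarith
  obtain ⟨L, hL, hN⟩ := exists_smallLip_qReaction hb.le hc.le (by linarith : κ ≤ a)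
  have hG : 0 < gaussMoment := zero_lt_one.trans_le one_le_gaussMoment
  obtain ⟨r, hr0, hr1, hLr⟩ : ∃ r : ℝ, 0 < r ∧ r ≤ 1 ∧
      L * r / (a - 2 * κ) * gaussMoment ≤ 1 / 2 := by
    -- The radius making the Duhamel map a contraction with constant `1/2`; `L + 1` replaces `L`,
    -- which could be zero.
    refine ⟨min 1 ((a - 2 * κ) / (2 * (L + 1) * gaussMoment)), by positivity, min_le_left _ _, ?_⟩
    calc L * min 1 ((a - 2 * κ) / (2 * (L + 1) * gaussMoment)) / (a - 2 * κ) * gaussMoment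
        ≤ L * ((a - 2 * κ) / (2 * (L + 1) * gaussMoment)) / (a - 2 * κ) * gaussMoment := by
          gcongr
          exact min_le_right _ _
      _ = L / (L + 1) * (1 / 2) := by field_simp
      _ ≤ 1 * (1 / 2) := by
          gcongr
          rw [div_le_one (by positivity)]
          linarith
      _ = 1 / 2 := one_mul _
  -- The free evolution of data of size `η` then fills at most half of the ball of radius `r`.
  set η := r / (2 * gaussMoment) with hη
  have hη0 : 0 < η := by positivity
  refine ⟨η, hη0, fun Q₀ hQ₀ hsmall => ?_⟩
  obtain ⟨f, hf, hfeq, hfb, hfc⟩ := exists_representative hη0.le hQ₀ hsmall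
  have hfη : ∀ y, ‖f y‖ ≤ η * decay ε (8 + δ) y := fun y => (hfb y).trans
    (mul_le_mul_of_nonneg_left (decay_one_le hε.le hε1 (by linarith) y) hη0.le)
  obtain ⟨u, hu, hur⟩ := exists_mild hN hL hμ hε hε1 hk3 hκ hr0 hr1
    (by rw [hη]; field_simp; rfl) hLr hf hfη
  have hgM : ∀ x s, 0 < s → ‖qReaction a b c s (u x s)‖ ≤
      L * r * r * Real.exp (-(a - 2 * κ) * s) * decay ε (8 + δ) x := fun x s hs =>
    hN.norm_le hL hε.le (by linarith) hr0.le hr1 hs (hur x s hs)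
  have hgM' : ∀ x s, 0 < s → ‖qReaction a b c s (u x s)‖ ≤ L * r * r * decay ε (8 + δ) x := by
    intro x s hs
    refine (hgM x s hs).trans ?_
    have h1 : Real.exp (-(a - 2 * κ) * s) ≤ 1 := Real.exp_le_one_iff.2 (by nlinarith)
    have h2 := (decay_pos hε.le (8 + δ) x).le
    exact mul_le_mul_of_nonneg_right (mul_le_of_le_one_right (by positivity) h1) h2
  have hsol : IsSmoothSolution a b c Q₀ fun x t => Real.exp (-a * t) • u x t := by
    have hsm := (hu.smooth (by fun_prop) (by fun_prop)).1
    refine ⟨?_, fun x t ht => (hasDerivAt_exp_smul hu x ht).deriv, fun t ht => ?_, ?_⟩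
    · have : ContDiff ℝ ∞ fun p : Space × ℝ => Real.exp (-a * p.2) := by fun_prop
      exact this.contDiffOn.smul hsm
    · have hbd : ∀ x, ‖Real.exp (-a * t) • u x t‖ ≤
          Real.exp (-a * t) * (r * Real.exp (κ * t)) * decay ε (8 + δ) x := by
        intro x
        rw [norm_smul, Real.norm_of_nonneg (Real.exp_nonneg _), mul_assoc]
        gcongr
        rw [mul_assoc]
        exact hur x t ht
      have hct : Continuous fun x => Real.exp (-a * t) • u x t :=
        (hu.admissible.continuous_slice ht).fun_const_smul _
      have hint := integrable_of_decay hε hε1 hk3 hct.aestronglyMeasurable hbd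
      have hbd' : ∀ x, ‖Real.exp (-a * t) • u x t‖ ≤
          Real.exp (-a * t) * (r * Real.exp (κ * t)) := fun x =>
        (hbd x).trans (mul_le_of_le_one_right (by positivity)
          (decay_le_one hε.le (by linarith) x))
      exact ⟨memLp_of_bound_of_integrable hbd' hint one_le_two ENNReal.ofNat_ne_top,
        memLp_of_bound_of_integrable hbd' hint (by norm_num) ENNReal.ofNat_ne_top⟩
    · refine (tendsto_normH_exp_smul ha.le hε hε1 hk3 hκ0 hr0.le hf hfη hur hgM'
        hu.eq).congr fun t => normH_congr ?_
      filter_upwards [hfeq] with x hx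
      rw [hx]
  obtain ⟨A, C, hA⟩ := exists_asymptotic hδ hε hε1 hf.aestronglyMeasurable hfη
    hu.admissible_reaction hμ hgM
  have hfi := integrable_of_decay hε hε1 hk3 hf.aestronglyMeasurable hfη
  obtain ⟨B, hB⟩ := hu.bounded
  obtain ⟨hV, hV'⟩ := memX0_of_mild hfi hB hu.admissible_reaction hA
  refine ⟨_, hsol, fun Q' hQ' x t ht => hQ'.unique ha.le hb.le hc hQ₀.1.1 hsol x ht,
    A, _, hV, fun h => hV' (hfc h), fun x t ht => ?_⟩
  rw [hu.eq x t ht, mul_smul, ← smul_add, add_sub_cancel]
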